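/- Let $g$ be a finite-dimensional simple Lie algebra over $\mathbb{C}$, let $t_0,t_+,t_-\in g$ be the images of the standard generators under a homomorphism $sl_2\to g$, normalized by $[t_0,t_\pm]=\pm t_\pm$ and $[t_+,t_-]=2t_0$, and let $\delta\in g$ be the following grading element. (a) If $\mathrm{ad}_{t_0}$ defines an integral grading of $g$, one may take $\delta=t_0$. (b) If $g=sl_n$ and the embedding corresponds to a partition $(p_1,\dots,p_r)$ of $n$, label the standard basis of $\mathbb{C}^n$ by the boxes $(l,k)$, $1\le l\le r$, $1\le k\le p_l$, so that $t_+=\sum E_{(l,k),(l,k+1)}$, $t_0=\sum\left(\frac{p_l+1}{2}-k\right)E_{(l,k),(l,k)}$ and $t_-=\sum k(p_l-k)E_{(l,k+1),(l,k)}$ (after an isomorphism of Lie algebras). Then one takes $\delta=\sum(\mu-k)E_{(l,k),(l,k)}$, where $\mu$ is the mean of $k$ over all $n$ boxes. In both cases $\mathrm{ad}_\delta$ is an integral grading of $g$; let $g_+$ be the sum of its eigenspaces with positive eigenvalue. Let $K$ be a nondegenerate invariant symmetric bilinear form on $g$ (for instance the Cartan–Killing form), let $\{t_a\}$ be a basis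 of $g$ consisting of eigenvectors of $\mathrm{ad}_\delta$, and let Greek indices run over those $a$ with $t_a\in g_+$. Put $t^a=K^{ab}t_b$, where $(K^{ab})$ is the inverse of the matrix $K_{ab}=K(t_a,t_b)$; let $J^a$ be the image of $t^a$ in the universal enveloping algebra $\mathcal{U}g$, define $f^{ab}{}_c$ by $[t^a,t^b]=f^{ab}{}_c\,t^c$, and let $\chi(J^\alpha)$ be the coefficient of $t_\alpha$ in $t_+$ (so that $\chi(J^\alpha)$ is $1$ if $t_\alpha=t_+$ and $0$ otherwise, when $t_+$ is a basis vector). Let $Cl(g_+\oplus g_+^*)$ be the Clifford algebra generated by $g_+$ and $g_+^*$ with $v\in g_+$ anticommuting among themselves, $\varphi\in g_+^*$ anticommuting among themselves, and $\varphi v+v\varphi=\varphi(v)$. Let $c_\alpha$ be the generator $t_\alpha\in g_+$ and $b^\alpha$ the generator in $g_+^*$ dual to it. Let $\Omega=\mathcal{U}g\otimes Cl(g_+\oplus g_+^*)$, with $\deg(\mathcal{U}g)=0$, $\deg(c_\alpha)=1$, $\deg(b^\alpha)=-1$, and let $d(X)=[Q,X]$ (graded commutator), where $$Q=\left(J^\alpha-\chi(J^\alpha)\right)c_\alpha-\tfrac12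 f^{\alpha\beta}{}_\gamma\, b^\gamma c_\alpha c_\beta ,$$ with summation over repeated indices. Then $\Omega=\bigoplus_{k\in\mathbb{Z}}\Omega^k$ is a $\mathbb{Z}$-grading, $d(\Omega^k)\subseteq\Omega^{k+1}$ and $d^2=0$. Let $g_{lw}=\ker(\mathrm{ad}_{t_-}:g\to g)$. The BRST cohomology satisfies $$H^k(\Omega;d)\cong(\mathcal{U}g_{lw})\,\delta_{k,0}$$ as vector spaces: $H^k(\Omega;d)=0$ for every integer $k\neq0$, and $H^0(\Omega;d)$ (by definition the space underlying the quantum finite $W$ algebra) is isomorphic, as a vector space, to the universal enveloping algebra $\mathcal{U}g_{lw}$, and equivalently to the polynomial (symmetric) algebra on the vector space $g_{lw}$. -/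

import Mathlib

open scoped TensorProduct

namespace FiniteW

noncomputable section

/-! ### `sl₂`-embeddings and grading elements -/

/-- The images `t₀, t₊, t₋` of the standard generators under a homomorphism `sl₂ → g`,
with the normalization `[t₀, t_±] = ± t_±` and `[t₊, t₋] = 2 t₀`. -/
structure Sl2Embedding (g : Type*) [LieRing g] [LieAlgebra ℂ g] where
  tzero : g
  tplus : g
  tminus : g
  lie_zero_plus : ⁅tzero, tplus⁆ = tplus
  lie_zero_minus : ⁅tzero, tminus⁆ = -tminus
  lie_plus_minus : ⁅tplus, tminus⁆ = (2 : ℂ) • tzero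

/-- The boxes of a diagram with `r` rows of lengths `p 0, …, p (r-1)`. The box `⟨l, k⟩` lies in
row `l` and column `k` (both counted from `0`). The boxes label the standard basis of `ℂⁿ`,
where `n = ∑ p l`. -/
abbrev Box {r : ℕ} (p : Fin r → ℕ) : Type := Σ l : Fin r, Fin (p l)

/-- `t₊ = ∑ E_{(l,k),(l,k+1)}`. -/
def stdPlus {r : ℕ} (p : Fin r → ℕ) : Matrix (Box p) (Box p) ℂ :=
  Matrix.of fun x y => if x.1 = y.1 ∧ (y.2 : ℕ) = x.2 + 1 then 1 else 0

/-- `t₀ = ∑ ((p_l + 1) / 2 - k) E_{(l,k),(l,k)}`, columns counted from `1`. -/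
def stdZero {r : ℕ} (p : Fin r → ℕ) : Matrix (Box p) (Box p) ℂ :=
  Matrix.diagonal fun x => ((p x.1 : ℂ) + 1) / 2 - ((x.2 : ℕ) + 1)

/-- `t₋ = ∑ k (p_l - k) E_{(l,k+1),(l,k)}`, columns counted from `1`. -/
def stdMinus {r : ℕ} (p : Fin r → ℕ) : Matrix (Box p) (Box p) ℂ :=
  Matrix.of fun x y =>
    if x.1 = y.1 ∧ (x.2 : ℕ) = y.2 + 1 then
      ((y.2 : ℕ) + 1 : ℂ) * ((p y.1 : ℂ) - ((y.2 : ℕ) + 1))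
    else 0

/-- `δ = ∑ (μ - k) E_{(l,k),(l,k)}`, columns counted from `1`, where `μ` is the mean of the column
numbers of all boxes, that is `(∑ k m_k) / (∑ m_k)` with `m_k` the number of boxes in
column `k`. -/
def stdDelta {r : ℕ} (p : Fin r → ℕ) : Matrix (Box p) (Box p) ℂ :=
  Matrix.diagonal fun x =>
    (∑ y : Box p, (((y.2 : ℕ) : ℂ) + 1)) / (Fintype.card (Box p) : ℂ) - ((x.2 : ℕ) + 1)

/-- The grading element `δ` attached to an `sl₂`-embedding. If the grading by `ad t₀` is integral,
it is `t₀`. If `g` is `sl_n`, it is the diagonal matrix `stdDelta p`, in a matrix realization in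
which the embedding has the standard form given by a partition `p` of `n`. (Integrality of the
grading in the first case is carried by a `HomogeneousBasis`.) -/
inductive IsGradingElement {g : Type*} [LieRing g] [LieAlgebra ℂ g] (i : Sl2Embedding g) :
    g → Prop
  | integral : IsGradingElement i i.tzero
  | special {r : ℕ} (p : Fin r → ℕ)
      (e : g ≃ₗ⁅ℂ⁆ LieAlgebra.SpecialLinear.sl (Box p) ℂ) (δ : g)
      (h_zero : (e i.tzero : Matrix (Box p) (Box p) ℂ) = stdZero p)
      (h_plus : (e i.tplus : Matrix (Box p) (Box p) ℂ) = stdPlus p)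
      (h_minus : (e i.tminus : Matrix (Box p) (Box p) ℂ) = stdMinus p)
      (h_delta : (e δ : Matrix (Box p) (Box p) ℂ) = stdDelta p) : IsGradingElement i δ

variable {g : Type*} [LieRing g] [LieAlgebra ℂ g]

/-- `g_lw = ker (ad t₋)`, a Lie subalgebra of `g`. -/
def gLowestWeight (i : Sl2Embedding g) : LieSubalgebra ℂ g where
  __ := LinearMap.ker (LieAlgebra.ad ℂ g i.tminus)
  lie_mem' := by
    intro x y hx hy
    change ⁅i.tminus, x⁆ = 0 at hx
    change ⁅i.tminus, y⁆ = 0 at hy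
    change ⁅i.tminus, ⁅x, y⁆⁆ = 0
    rw [leibniz_lie, hx, hy, zero_lie, lie_zero, add_zero]

/-- `g₊`: the sum of the eigenspaces of `ad δ` with positive integral eigenvalue. -/
def gPlus (δ : g) : Submodule ℂ g :=
  ⨆ (k : ℤ) (_ : 0 < k), Module.End.eigenspace (LieAlgebra.ad ℂ g δ) (k : ℂ)

/-- A basis `t_a` of `g` consisting of homogeneous elements for an integral grading by `ad δ`. -/
structure HomogeneousBasis (δ : g) (I : Type*) where
  basis : Module.Basis I ℂ g
  deg : I → ℤ
  lie_basis : ∀ a, ⁅δ, basis a⁆ = (deg a : ℂ) • basis a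

/-! ### The ghost Clifford algebra and the BRST complex -/

/-- The Clifford algebra `Cl(g₊ ⊕ g₊^*)` of the quadratic form `(φ, v) ↦ φ v`, so that
`φ v + v φ = φ(v)`. -/
abbrev Ghosts (δ : g) : Type _ :=
  CliffordAlgebra (QuadraticForm.dualProd ℂ (gPlus δ))

/-- The ghost attached to `v ∈ g₊`; it has degree `+1`. -/
def ghost {δ : g} (v : gPlus δ) : Ghosts δ :=
  CliffordAlgebra.ι (QuadraticForm.dualProd ℂ (gPlus δ)) (0, v)

/-- The antighost attached to `φ ∈ g₊^*`; it has degree `-1`. -/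
def antighost {δ : g} (φ : Module.Dual ℂ (gPlus δ)) : Ghosts δ :=
  CliffordAlgebra.ι (QuadraticForm.dualProd ℂ (gPlus δ)) (φ, 0)

/-- `Ω = U(g) ⊗ Cl(g₊ ⊕ g₊^*)`. -/
abbrev Omega (δ : g) : Type _ := UniversalEnvelopingAlgebra ℂ g ⊗[ℂ] Ghosts δ

/-- A product of ghosts and antighosts. -/
def ghostMonomial {δ : g} (w : List (gPlus δ ⊕ Module.Dual ℂ (gPlus δ))) : Ghosts δ :=
  (w.map (Sum.elim ghost antighost)).prod

/-- The number of ghosts minus the number of antighosts in a product. -/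
def ghostNumber {δ : g} (w : List (gPlus δ ⊕ Module.Dual ℂ (gPlus δ))) : ℤ :=
  (w.map (Sum.elim (fun _ => (1 : ℤ)) (fun _ => -1))).sum

/-- The degree `k` part `Ω^k` of `Ω`. -/
def omegaDeg (δ : g) (k : ℤ) : Submodule ℂ (Omega δ) :=
  Submodule.span ℂ {X | ∃ (u : UniversalEnvelopingAlgebra ℂ g)
    (w : List (gPlus δ ⊕ Module.Dual ℂ (gPlus δ))), ghostNumber w = k ∧ X = u ⊗ₜ ghostMonomial w}

/-- The parity automorphism of `Ω`; it is `(-1)^k` on `Ω^k`. -/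
def parity (δ : g) : Omega δ →ₐ[ℂ] Omega δ :=
  Algebra.TensorProduct.map (AlgHom.id ℂ _) CliffordAlgebra.involute

lemma parity_of_mem {δ : g} {k : ℤ} {X : Omega δ} (hX : X ∈ omegaDeg δ k) :
    parity δ X = ((-1 : ℂ) ^ k) • X := by
  refine Submodule.span_induction ?_ ?_ ?_ ?_ hX
  · clear hX
    rintro _ ⟨u, w, rfl, rfl⟩
    have key : CliffordAlgebra.involute (ghostMonomial w)
        = ((-1 : ℂ) ^ ghostNumber w) • ghostMonomial w := by
      induction w with
      | nil => simp [ghostMonomial, ghostNumber]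
      | cons a w ih =>
        rcases a with v | φ
        · simp only [ghostMonomial, ghostNumber, List.map_cons, List.prod_cons, List.sum_cons,
            Sum.elim_inl, map_mul] at ih ⊢
          rw [ih, zpow_add₀ (by norm_num)]
          simp [ghost]
        · simp only [ghostMonomial, ghostNumber, List.map_cons, List.prod_cons, List.sum_cons,
            Sum.elim_inr, map_mul] at ih ⊢
          rw [ih, zpow_add₀ (by norm_num)]
          simp [antighost]
    simp [parity, key]
  · simp
  · intro x y _ _ hx hy
    rw [map_add, hx, hy, smul_add]
  · intro a x _ hx
    rw [map_smul, hx, smul_comm]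

lemma HomogeneousBasis.mem_gPlus {δ : g} {I : Type*} (t : HomogeneousBasis δ I) {a : I} (ha : 0 < t.deg a) :
    t.basis a ∈ gPlus δ :=
  Submodule.mem_iSup_of_mem (t.deg a) (Submodule.mem_iSup_of_mem ha
    (Module.End.mem_eigenspace_iff.2 (t.lie_basis a)))

section Charge

variable {δ : g} {I : Type*} [Fintype I] [DecidableEq I]

/-- The indices `α` with `t_α ∈ g₊`. -/
abbrev HomogeneousBasis.Pos (t : HomogeneousBasis δ I) : Type _ := {a : I // 0 < t.deg a}

/-- The ghost `c_α`. -/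
def ghostC (t : HomogeneousBasis δ I) (α : t.Pos) : Ghosts δ :=
  ghost ⟨t.basis α, t.mem_gPlus α.2⟩

/-- The antighost `b^α`, attached to the element of `g₊^*` dual to `t_α`. -/
def antighostB (t : HomogeneousBasis δ I) (α : t.Pos) : Ghosts δ :=
  antighost ((t.basis.coord α).comp (gPlus δ).subtype)

/-- The element `t^a = K^{ab} t_b` of `g`, where `K_{ab} = K(t_a, t_b)`. -/
def upper (K : LinearMap.BilinForm ℂ g) (hK : K.Nondegenerate) (t : HomogeneousBasis δ I) :
    Module.Basis I ℂ g :=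
  K.dualBasis hK t.basis

/-- The structure constants `f^{ab}_c` with indices raised by `K`: `[t^a, t^b] = f^{ab}_c t^c`. -/
def structureConst (K : LinearMap.BilinForm ℂ g) (hK : K.Nondegenerate)
    (t : HomogeneousBasis δ I) (a b c : I) : ℂ :=
  (upper K hK t).repr ⁅upper K hK t a, upper K hK t b⁆ c

/-- The generator `J^a` of the quantum Kirillov algebra `U(g)`; these satisfy
`[J^a, J^b] = f^{ab}_c J^c`. -/
def current (K : LinearMap.BilinForm ℂ g) (hK : K.Nondegenerate) (t : HomogeneousBasis δ I)
    (a : I) : UniversalEnvelopingAlgebra ℂ g :=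
  UniversalEnvelopingAlgebra.ι ℂ (upper K hK t a)

/-- `χ(J^α)`: the `α`-component of `t₊`. In a basis that contains `t₊` it is `1` if `t_α = t₊`
and `0` otherwise. -/
def chi (i : Sl2Embedding g) (t : HomogeneousBasis δ I) (α : t.Pos) : ℂ :=
  t.basis.repr i.tplus α

/-- The BRST charge
`Q = (J^α - χ(J^α)) c_α - ½ f^{αβ}_γ b^γ c_α c_β`, summed over indices of `g₊`. -/
def charge (i : Sl2Embedding g) (K : LinearMap.BilinForm ℂ g) (hK : K.Nondegenerate)
    (t : HomogeneousBasis δ I) : Omega δ :=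
  (∑ α : t.Pos, (current K hK t α - algebraMap ℂ _ (chi i t α)) ⊗ₜ[ℂ] ghostC t α)
    - (1 / 2 : ℂ) • ∑ α : t.Pos, ∑ β : t.Pos, ∑ γ : t.Pos, structureConst K hK t α β γ •
        ((1 : UniversalEnvelopingAlgebra ℂ g) ⊗ₜ[ℂ] (antighostB t γ * ghostC t α * ghostC t β))

/-- The BRST differential `d X = [Q, X]`, a graded commutator. -/
def differential (i : Sl2Embedding g) (K : LinearMap.BilinForm ℂ g) (hK : K.Nondegenerate)
    (t : HomogeneousBasis δ I) : Omega δ →ₗ[ℂ] Omega δ :=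
  LinearMap.mulLeft ℂ (charge i K hK t)
    - (LinearMap.mulRight ℂ (charge i K hK t)).comp (parity δ).toLinearMap

lemma differential_of_mem (i : Sl2Embedding g) (K : LinearMap.BilinForm ℂ g)
    (hK : K.Nondegenerate) (t : HomogeneousBasis δ I) {k : ℤ} {X : Omega δ}
    (hX : X ∈ omegaDeg δ k) :
    differential i K hK t X
      = charge i K hK t * X - ((-1 : ℂ) ^ k) • (X * charge i K hK t) := by
  simp [differential, parity_of_mem hX]

/-- The cocycles of degree `k`. -/
def cocycles (i : Sl2Embedding g) (K : LinearMap.BilinForm ℂ g) (hK : K.Nondegenerate)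
    (t : HomogeneousBasis δ I) (k : ℤ) : Submodule ℂ (Omega δ) :=
  omegaDeg δ k ⊓ LinearMap.ker (differential i K hK t)

/-- The coboundaries of degree `k`. -/
def coboundaries (i : Sl2Embedding g) (K : LinearMap.BilinForm ℂ g) (hK : K.Nondegenerate)
    (t : HomogeneousBasis δ I) (k : ℤ) : Submodule ℂ (Omega δ) :=
  (omegaDeg δ (k - 1)).map (differential i K hK t)

/-- The BRST cohomology `H^k(Ω; d)`. -/
abbrev Cohomology (i : Sl2Embedding g) (K : LinearMap.BilinForm ℂ g) (hK : K.Nondegenerate)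
    (t : HomogeneousBasis δ I) (k : ℤ) : Type _ :=
  cocycles i K hK t k ⧸ (coboundaries i K hK t k).submoduleOf (cocycles i K hK t k)

end Charge

end

end FiniteW

namespace FiniteW

noncomputable section

/-! ### Filtrations by the weight of words in generators -/

section WordFiltration

variable {A : Type*} [Ring A] [Algebra ℂ A] {Γ : Type*}

/-! Up to terms of lower weight the BRST complex is a Koszul complex. A Laplacian whose diagonal
part has nonnegative integer entries does the work of a spectral sequence.

Write `e` for `t₊`, `u α` for `t^α`, `v α` for `t_α`, and `b`, `c` for the antighosts and ghosts
attached to elements of `g` by means of `K`. Replace `J(y)` by the corrected current `Ĵ(y) = J(y) +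
∑ β, b([y, u β]) c(v β)`, and let `P` project onto the negative part. Then `Q` sends `b(u α)` to
`Ĵ(u α) - χ`, sends `Ĵ(y)` to `c([y, e]) + ∑ α, Ĵ((1 - P)[u α, y]) c(v α)`, and sends `c` to a
quadratic expression in ghosts (`charge_mul_b`, `charge_lie_ghostCurrent`, `charge_mul_c`). These
formulas and the Jacobi identity show that `Q²` commutes with all generators, which is all that `d²
= 0` requires.

Both kinds of grading element make `ad e` injective in negative degrees
(`IsGradingElement.isGoodGrading`). By duality under `K`, `ad e` is then onto positive degrees, so
`g` has a homogeneous basis made of the `u α`, of elements `y α` with `[y α, e] = t_α`, and of a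
basis `η` of `ker (ad e)`, which lies in nonnegative degrees (`exists_adapted_basis`). Let `z α =
Ĵ(u α) - χ`, and denote the corrected currents of `y α` and `η` by the same letters. A current of
degree `k` gets weight `2 max(k, 0) + 1`, an antighost weight `1`, and `c(v α)` weight `2 deg(v α) -
1`. All supercommutators then lose weight, while `d` preserves weight with leading part `b ↦ z`, `y
↦ c`, `η ↦ 0` (`koszulModel`).

On symbols, the homotopy `z ↦ b`, `c ↦ y` gives a Laplacian that multiplies a monomial by the number
of its letters other than `η` (`laplacian_wordProd`). Poincaré–Birkhoff–Witt together with normal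
ordering identifies symbols with `Ω` linearly and compatibly with weights. The transported homotopy
`h` therefore makes `Δ = dh + hd` triangular, with that number, which is at most the weight, on the
diagonal (`triangularLaplacian`). Now `Δ` commutes with `d` and is null-homotopic, so `p(Δ)` acts as
the identity on cohomology whenever `p(0) = 1`. Taking for `p` a power of a polynomial that vanishes
at `1, …, n` annihilates everything in degree `k ≠ 0` (`exists_eq_of_ne_zero`). In degree `0` it
leaves the corrections of the monomials in the `η` as a basis of the cohomology (`exists_cocycles`).

Thus `H⁰` has the size of a polynomial ring in `dim ker (ad t₊)` variables. Counting the adapted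
basis for `t₊` and for `t₋` shows that the two centralizers have the same dimension
(`finrank_ker_eq`), and Poincaré–Birkhoff–Witt for `g_lw` finishes. That theorem is proved only for
matrix Lie algebras, by letting the enveloping algebra act through invariant vector fields near the
identity; the adjoint representation makes a simple `g` such an algebra. -/

/-- The product of the letters of a word. -/
def wordProd {A : Type*} [Monoid A] {Γ : Type*} (gen : Γ → A) (w : List Γ) : A :=
  (w.map gen).prod

/-- The total weight of a word. -/
def wordWt {Γ : Type*} (wt : Γ → ℕ) (w : List Γ) : ℕ := (w.map wt).sum

@[simp] lemma wordProd_nil {A : Type*} [Monoid A] {Γ : Type*} (gen : Γ → A) :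
    wordProd gen [] = 1 := rfl

@[simp] lemma wordProd_cons {A : Type*} [Monoid A] {Γ : Type*} (gen : Γ → A) (a : Γ)
    (w : List Γ) : wordProd gen (a :: w) = gen a * wordProd gen w := by
  simp [wordProd]

@[simp] lemma wordProd_append {A : Type*} [Monoid A] {Γ : Type*} (gen : Γ → A)
    (w w' : List Γ) : wordProd gen (w ++ w') = wordProd gen w * wordProd gen w' := by
  simp [wordProd]

@[simp] lemma wordWt_nil (wt : Γ → ℕ) : wordWt wt [] = 0 := rfl

@[simp] lemma wordWt_cons (wt : Γ → ℕ) (a : Γ) (w : List Γ) :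
    wordWt wt (a :: w) = wt a + wordWt wt w := by
  simp [wordWt]

@[simp] lemma wordWt_append (wt : Γ → ℕ) (w w' : List Γ) :
    wordWt wt (w ++ w') = wordWt wt w + wordWt wt w' := by
  simp [wordWt]

lemma wordWt_perm (wt : Γ → ℕ) {w w' : List Γ} (h : w.Perm w') : wordWt wt w = wordWt wt w' :=
  (h.map wt).sum_eq

/-- The span of the products of words of weight less than `n`. -/
def wordFil (gen : Γ → A) (wt : Γ → ℕ) (n : ℕ) : Submodule ℂ A :=
  Submodule.span ℂ {X | ∃ w : List Γ, wordWt wt w < n ∧ wordProd gen w = X}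

variable {gen : Γ → A} {wt : Γ → ℕ}

lemma wordProd_mem {w : List Γ} {n : ℕ} (h : wordWt wt w < n) :
    wordProd gen w ∈ wordFil gen wt n :=
  Submodule.subset_span ⟨w, h, rfl⟩

lemma gen_mem_wordFil {a : Γ} {n : ℕ} (h : wt a < n) : gen a ∈ wordFil gen wt n := by
  simpa using wordProd_mem (gen := gen) (wt := wt) (w := [a]) (n := n) (by simpa using h)

lemma one_mem_wordFil {n : ℕ} (h : 0 < n) : (1 : A) ∈ wordFil gen wt n := by
  simpa using wordProd_mem (gen := gen) (wt := wt) (w := []) (n := n) (by simpa using h)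

lemma algebraMap_mem_wordFil (r : ℂ) {n : ℕ} (h : 0 < n) :
    algebraMap ℂ A r ∈ wordFil gen wt n := by
  rw [Algebra.algebraMap_eq_smul_one]
  exact Submodule.smul_mem _ _ (one_mem_wordFil h)

lemma wordFil_mono {m n : ℕ} (h : m ≤ n) : wordFil gen wt m ≤ wordFil gen wt n :=
  Submodule.span_mono fun _ ⟨w, hw, e⟩ => ⟨w, hw.trans_le h, e⟩

@[simp] lemma wordFil_zero : wordFil gen wt 0 = ⊥ := by
  simp [wordFil]

/-- The bound in `wordFil` is strict, so the factors have weights at most `m - 1` and `n - 1`. This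
is why `m + n` may exceed `k` by one. -/
lemma mul_mem_wordFil {m n k : ℕ} (h : m + n ≤ k + 1) {x y : A} (hx : x ∈ wordFil gen wt m)
    (hy : y ∈ wordFil gen wt n) : x * y ∈ wordFil gen wt k := by
  have := Submodule.mul_mem_mul hx hy
  rw [wordFil, wordFil, Submodule.span_mul_span] at this
  refine Submodule.span_mono ?_ this
  rintro _ ⟨_, ⟨w, hw, rfl⟩, _, ⟨w', hw', rfl⟩, rfl⟩
  exact ⟨w ++ w', by rw [wordWt_append]; omega, by simp⟩

/-- Replacing every letter by one that agrees with it up to lower weight changes a product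
only by lower weight. -/
lemma wordProd_sub_wordProd_mem {E : Type*} {g g' : E → A} {ω : E → ℕ}
    (hg : ∀ e, g e ∈ wordFil gen wt (ω e + 1))
    (hgg : ∀ e, g' e - g e ∈ wordFil gen wt (ω e)) (l : List E) :
    wordProd g l ∈ wordFil gen wt (wordWt ω l + 1) ∧
    wordProd g' l - wordProd g l ∈ wordFil gen wt (wordWt ω l) := by
  induction l with
  | nil => simp [one_mem_wordFil]
  | cons a l ih =>
    have h1 := mul_mem_wordFil (k := wordWt ω (a :: l) + 1) (by simp; omega) (hg a) ih.1
    refine ⟨by simpa using h1, ?_⟩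
    -- Telescoping: change the tail first, then the head.
    have e : wordProd g' (a :: l) - wordProd g (a :: l)
        = g' a * (wordProd g' l - wordProd g l) + (g' a - g a) * wordProd g l := by
      simp only [wordProd_cons]; noncomm_ring
    have hg' : g' a ∈ wordFil gen wt (ω a + 1) := by
      rw [← sub_add_cancel (g' a) (g a)]
      exact add_mem (wordFil_mono (Nat.le_succ _) (hgg a)) (hg a)
    rw [e]
    exact add_mem (mul_mem_wordFil (by simp; omega) hg' ih.2)
      (mul_mem_wordFil (by simp; omega) (hgg a) ih.1)

/-- Letters that commute up to lower weight can be permuted up to lower weight. -/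
lemma wordProd_perm_mem {E : Type*} {g : E → A} {ω : E → ℕ}
    (hg : ∀ e, g e ∈ wordFil gen wt (ω e + 1))
    (hcomm : ∀ a b, g a * g b - g b * g a ∈ wordFil gen wt (ω a + ω b)) {l l' : List E}
    (h : l.Perm l') : wordProd g l - wordProd g l' ∈ wordFil gen wt (wordWt ω l) := by
  have hw : ∀ l, wordProd g l ∈ wordFil gen wt (wordWt ω l + 1) := fun l =>
    (wordProd_sub_wordProd_mem (g' := g) hg (by simp) l).1
  induction h with
  | nil => simp
  | cons a h ih =>
    simp only [wordProd_cons, ← mul_sub]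
    exact mul_mem_wordFil (by simp; omega) (hg a) ih
  | swap a b l =>
    have e : wordProd g (b :: a :: l) - wordProd g (a :: b :: l)
        = (g b * g a - g a * g b) * wordProd g l := by
      simp only [wordProd_cons]; noncomm_ring
    rw [e]
    exact mul_mem_wordFil (by simp; omega) (hcomm b a) (hw l)
  | trans h₁ h₂ ih₁ ih₂ =>
    rw [← wordWt_perm ω h₁] at ih₂
    simpa using add_mem ih₁ ih₂

/-- A letter that commutes with the letters of a word up to lower weight commutes with the word
up to lower weight. -/
lemma mul_wordProd_sub_mem {E : Type*} {g : E → A} {ω : E → ℕ}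
    (hg : ∀ e, g e ∈ wordFil gen wt (ω e + 1)) {x : A} {n : ℕ}
    (hcomm : ∀ a, x * g a - g a * x ∈ wordFil gen wt (n + ω a)) (l : List E) :
    x * wordProd g l - wordProd g l * x ∈ wordFil gen wt (n + wordWt ω l) := by
  have hw : ∀ l, wordProd g l ∈ wordFil gen wt (wordWt ω l + 1) := fun l =>
    (wordProd_sub_wordProd_mem (g' := g) hg (by simp) l).1
  induction l with
  | nil => simp
  | cons a l ih =>
    have e : x * wordProd g (a :: l) - wordProd g (a :: l) * x
        = (x * g a - g a * x) * wordProd g l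
          + g a * (x * wordProd g l - wordProd g l * x) := by
      simp only [wordProd_cons]; noncomm_ring
    rw [e]
    exact add_mem (mul_mem_wordFil (by simp; omega) (hcomm a) (hw l))
      (mul_mem_wordFil (by simp; omega) (hg a) ih)

end WordFiltration

/-! ### Normally ordered products -/

section NormalOrder

variable {A : Type*} [Ring A] [Algebra ℂ A] {E O : Type*}
  {Λ : Type*} [Ring Λ] [Algebra ℂ Λ]

/-- The linear map that sends a monomial to the product, in some order, of the elements assigned
to its variables. -/
def monomialProd (g : E → A) : MvPolynomial E ℂ →ₗ[ℂ] A :=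
  (MvPolynomial.basisMonomials E ℂ).constr ℂ fun m => wordProd g (Finsupp.toMultiset m).toList

lemma monomialProd_monomial (g : E → A) (m : E →₀ ℕ) :
    monomialProd g (MvPolynomial.monomial m 1) = wordProd g (Finsupp.toMultiset m).toList := by
  have := (MvPolynomial.basisMonomials E ℂ).constr_basis ℂ
    (fun m => wordProd g (Finsupp.toMultiset m).toList) m
  rwa [MvPolynomial.coe_basisMonomials] at this

/-- The exponent of the product of the letters of a word. -/
def listExp [DecidableEq E] (l : List E) : E →₀ ℕ := Multiset.toFinsupp (l : Multiset E)

lemma toList_listExp_perm [DecidableEq E] (l : List E) :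
    (Finsupp.toMultiset (listExp l)).toList.Perm l := by
  rw [← Multiset.coe_eq_coe]
  simp [listExp]

lemma X_mul_monomial_listExp [DecidableEq E] (e : E) (l : List E) :
    (MvPolynomial.X e * MvPolynomial.monomial (listExp l) 1 : MvPolynomial E ℂ)
      = MvPolynomial.monomial (listExp (e :: l)) 1 := by
  rw [MvPolynomial.X, MvPolynomial.monomial_mul, one_mul]
  congr 1
  rw [listExp, listExp, ← Multiset.cons_coe, ← Multiset.singleton_add, map_add,
    Multiset.toFinsupp_singleton]

variable (gen : E ⊕ O → A) (θ : O → Λ) (q : Λ →ₗ[ℂ] A)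

/-- The letters of the graded algebra. -/
def symbolGen (θ : O → Λ) : E ⊕ O → MvPolynomial E ℂ ⊗[ℂ] Λ :=
  Sum.elim (fun e => MvPolynomial.X e ⊗ₜ 1) (fun o => 1 ⊗ₜ θ o)

/-- The quantization map: even letters to the left, in some order, and the odd part quantized by
the given map `q`. -/
def quantize : MvPolynomial E ℂ ⊗[ℂ] Λ →ₗ[ℂ] A :=
  TensorProduct.lift ((LinearMap.mul ℂ A).compl₁₂ (monomialProd (gen ∘ Sum.inl)) q)

lemma quantize_tmul (p : MvPolynomial E ℂ) (ω : Λ) :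
    quantize gen q (p ⊗ₜ ω) = monomialProd (gen ∘ Sum.inl) p * q ω := by
  simp [quantize]

/-- Even letters are central among the symbols, so they can be gathered on the left without a sign
while the odd letters keep their order. -/
lemma exists_wordProd_symbolGen [DecidableEq E] (wt : E ⊕ O → ℕ) (w : List (E ⊕ O)) :
    ∃ (l : List E) (l' : List O),
      wordProd (symbolGen θ) w = MvPolynomial.monomial (listExp l) 1 ⊗ₜ wordProd θ l' ∧
      wordWt wt w = wordWt (wt ∘ Sum.inl) l + wordWt (wt ∘ Sum.inr) l' ∧
      w.Perm (l.map Sum.inl ++ l'.map Sum.inr) := by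
  induction w with
  | nil => exact ⟨[], [], by simp [listExp, Algebra.TensorProduct.one_def], by simp, by simp⟩
  | cons a w ih =>
    obtain ⟨l, l', h, hw, hp⟩ := ih
    rcases a with e | o
    · refine ⟨e :: l, l', ?_, by simp [hw]; ring, by simpa using hp⟩
      rw [wordProd_cons, h, ← X_mul_monomial_listExp]
      simp [symbolGen]
    · refine ⟨l, o :: l', ?_, by simp [hw]; ring,
        (hp.cons _).trans (by simpa using List.perm_middle.symm)⟩
      rw [wordProd_cons, h]
      simp [symbolGen]

/-- The filtration of the graded algebra by weight. -/
abbrev symbolFil (θ : O → Λ) (wt : E ⊕ O → ℕ) (n : ℕ) : Submodule ℂ (MvPolynomial E ℂ ⊗[ℂ] Λ) :=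
  wordFil (symbolGen θ) wt n

variable {gen θ q} {wt : E ⊕ O → ℕ}

/-- The letters commute up to lower weight, and `q` quantizes the odd part up to lower weight. -/
structure IsAlmostCommutative (gen : E ⊕ O → A) (θ : O → Λ) (q : Λ →ₗ[ℂ] A) (wt : E ⊕ O → ℕ) :
    Prop where
  q_one : q 1 = 1
  even_even : ∀ a b, gen (Sum.inl a) * gen (Sum.inl b) - gen (Sum.inl b) * gen (Sum.inl a)
    ∈ wordFil gen wt (wt (Sum.inl a) + wt (Sum.inl b))
  odd_even : ∀ o a, gen (Sum.inr o) * gen (Sum.inl a) - gen (Sum.inl a) * gen (Sum.inr o)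
    ∈ wordFil gen wt (wt (Sum.inr o) + wt (Sum.inl a))
  odd_q : ∀ o l, gen (Sum.inr o) * q (wordProd θ l) - q (θ o * wordProd θ l)
    ∈ wordFil gen wt (wt (Sum.inr o) + wordWt (wt ∘ Sum.inr) l)

namespace IsAlmostCommutative

lemma q_mem (H : IsAlmostCommutative gen θ q wt) (l : List O) :
    q (wordProd θ l) ∈ wordFil gen wt (wordWt (wt ∘ Sum.inr) l + 1) := by
  induction l with
  | nil => simp [H.q_one, one_mem_wordFil]
  | cons o l ih =>
    have h := H.odd_q o l
    have h2 := mul_mem_wordFil (k := wordWt (wt ∘ Sum.inr) (o :: l) + 1)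
      (by simp; omega) (gen_mem_wordFil (gen := gen) (Nat.lt_succ_self (wt (Sum.inr o)))) ih
    rw [wordProd_cons]
    have := sub_mem h2 (wordFil_mono (n := wordWt (wt ∘ Sum.inr) (o :: l) + 1) (by simp) h)
    simpa using this

/-- The product of a word is the quantization of its symbol, up to lower weight. -/
lemma wordProd_sub_quantize_mem [DecidableEq E] (H : IsAlmostCommutative gen θ q wt)
    (w : List (E ⊕ O)) :
    wordProd gen w - quantize gen q (wordProd (symbolGen θ) w)
      ∈ wordFil gen wt (wordWt wt w) := by
  have hg : ∀ e : E, (gen ∘ Sum.inl) e ∈ wordFil gen wt ((wt ∘ Sum.inl) e + 1) := fun e =>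
    gen_mem_wordFil (Nat.lt_succ_self _)
  have hword : ∀ l : List E, wordProd (gen ∘ Sum.inl) l
      ∈ wordFil gen wt (wordWt (wt ∘ Sum.inl) l + 1) := fun l =>
    (wordProd_sub_wordProd_mem (g' := gen ∘ Sum.inl) hg (by simp) l).1
  have hperm : ∀ l : List E, wordProd (gen ∘ Sum.inl) l
      - monomialProd (gen ∘ Sum.inl) (MvPolynomial.monomial (listExp l) 1)
      ∈ wordFil gen wt (wordWt (wt ∘ Sum.inl) l) := fun l => by
    rw [monomialProd_monomial]
    exact wordProd_perm_mem hg H.even_even (toList_listExp_perm l).symm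
  have hmon : ∀ l : List E, monomialProd (gen ∘ Sum.inl) (MvPolynomial.monomial (listExp l) 1)
      ∈ wordFil gen wt (wordWt (wt ∘ Sum.inl) l + 1) := fun l => by
    have := sub_mem (hword l) (wordFil_mono (Nat.le_succ _) (hperm l))
    simpa using this
  induction w with
  | nil =>
    simp [Algebra.TensorProduct.one_def, quantize_tmul, H.q_one, ← MvPolynomial.C_1,
      ← MvPolynomial.monomial_zero', monomialProd_monomial, -MvPolynomial.monomial_zero]
  | cons a w ih =>
    -- Left multiplication by one letter agrees with multiplication of symbols up to lower weight.
    -- An even letter is merged into the ordered monomial; an odd letter first moves past the even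
    -- part and is then absorbed by `q`.
    have key : gen a * quantize gen q (wordProd (symbolGen θ) w)
        - quantize gen q (wordProd (symbolGen θ) (a :: w))
        ∈ wordFil gen wt (wordWt wt (a :: w)) := by
      obtain ⟨l, l', h, hw, -⟩ := exists_wordProd_symbolGen θ wt w
      rw [wordProd_cons, h, wordWt_cons, hw]
      rcases a with e | o
      · have h1 := hmon l
        have h2 := hperm l
        have h3 := hperm (e :: l)
        simp only [symbolGen, Sum.elim_inl, Algebra.TensorProduct.tmul_mul_tmul, one_mul,
          X_mul_monomial_listExp, quantize_tmul, wordProd_cons, Function.comp_apply] at h3 ⊢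
        rw [← mul_assoc, ← sub_mul]
        refine mul_mem_wordFil
          (m := wt (Sum.inl e) + wordWt (wt ∘ Sum.inl) l) (by omega) ?_ (H.q_mem l')
        have h4 := mul_mem_wordFil (k := wt (Sum.inl e) + wordWt (wt ∘ Sum.inl) l)
          (by simp; omega) (hg e) h2
        simp only [wordWt_cons, Function.comp_apply] at h3 h4
        have := sub_mem h3 h4
        simpa [mul_sub] using this
      · simp only [symbolGen, Sum.elim_inr, Algebra.TensorProduct.tmul_mul_tmul, one_mul,
          quantize_tmul]
        have h1 : gen (Sum.inr o)
            * monomialProd (gen ∘ Sum.inl) (MvPolynomial.monomial (listExp l) 1)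
            - monomialProd (gen ∘ Sum.inl) (MvPolynomial.monomial (listExp l) 1)
              * gen (Sum.inr o)
            ∈ wordFil gen wt (wt (Sum.inr o) + wordWt (wt ∘ Sum.inl) l) := by
          rw [monomialProd_monomial, ← wordWt_perm _ (toList_listExp_perm l)]
          exact mul_wordProd_sub_mem hg (H.odd_even o) _
        have h2 := mul_mem_wordFil
          (k := wt (Sum.inr o) + (wordWt (wt ∘ Sum.inl) l + wordWt (wt ∘ Sum.inr) l'))
          (by omega) h1 (H.q_mem l')
        have h3 := mul_mem_wordFil
          (k := wt (Sum.inr o) + (wordWt (wt ∘ Sum.inl) l + wordWt (wt ∘ Sum.inr) l'))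
          (by omega) (hmon l) (H.odd_q o l')
        convert add_mem h2 h3 using 1
        noncomm_ring
    have h := mul_mem_wordFil (k := wordWt wt (a :: w)) (by simp; omega)
      (gen_mem_wordFil (gen := gen) (Nat.lt_succ_self (wt a))) ih
    convert add_mem h key using 1
    rw [wordProd_cons (gen := gen)]
    noncomm_ring

lemma quantize_mem [DecidableEq E] (H : IsAlmostCommutative gen θ q wt) {n : ℕ}
    {p : MvPolynomial E ℂ ⊗[ℂ] Λ} (hp : p ∈ symbolFil θ wt n) :
    quantize gen q p ∈ wordFil gen wt n := by
  refine Submodule.span_induction ?_ (by simp) (fun x y _ _ hx hy => by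
    rw [map_add]; exact add_mem hx hy) (fun a x _ hx => by
    rw [map_smul]; exact Submodule.smul_mem _ _ hx) hp
  rintro _ ⟨w, hw, rfl⟩
  have := sub_mem (wordProd_mem (gen := gen) hw)
    (wordFil_mono hw.le (H.wordProd_sub_quantize_mem w))
  simpa using this

/-- Each word is the quantization of its symbol plus an error of lower weight, and the error is
treated by induction. The induction starts because `wordFil` at `0` is zero. -/
lemma map_quantize [DecidableEq E] (H : IsAlmostCommutative gen θ q wt) (n : ℕ) :
    (symbolFil θ wt n).map (quantize gen q) = wordFil gen wt n := by
  refine le_antisymm (Submodule.map_le_iff_le_comap.2 fun p hp => H.quantize_mem hp) ?_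
  induction n with
  | zero => simp
  | succ n ih =>
    refine Submodule.span_le.2 ?_
    rintro _ ⟨w, hw, rfl⟩
    have h1 := ih (wordFil_mono (Nat.lt_succ_iff.1 hw) (H.wordProd_sub_quantize_mem w))
    have h2 := Submodule.mem_map_of_mem (f := quantize gen q)
      (wordProd_mem (gen := symbolGen θ) hw)
    have := add_mem (Submodule.map_mono (wordFil_mono (Nat.le_succ n)) h1) h2
    simpa using this

end IsAlmostCommutative

end NormalOrder

end

end FiniteW

namespace FiniteW

noncomputable section

/-! ### The Poincaré–Birkhoff–Witt theorem for linear Lie algebras -/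

attribute [local instance] LieRing.ofAssociativeRing

section Generation

lemma map_mem_of_basis {E V W : Type*} [AddCommGroup V] [Module ℂ V] [AddCommGroup W] [Module ℂ W]
    (e : Module.Basis E ℂ V) (f : V →ₗ[ℂ] W) (S : Submodule ℂ W) (h : ∀ a, f (e a) ∈ S) (x : V) :
    f x ∈ S := by
  have : Submodule.span ℂ (Set.range e) ≤ S.comap f :=
    Submodule.span_le.2 (by rintro _ ⟨a, rfl⟩; exact h a)
  exact this (e.span_eq ▸ Submodule.mem_top)

variable {A : Type*} [Ring A] [Algebra ℂ A] {Γ : Type*} {gen : Γ → A} {wt : Γ → ℕ}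

lemma exists_mem_wordFil (h : Algebra.adjoin ℂ (Set.range gen) = ⊤) (x : A) :
    ∃ n, x ∈ wordFil gen wt n := by
  have hx : x ∈ Submodule.span ℂ (Submonoid.closure (Set.range gen) : Set A) := by
    rw [← Algebra.adjoin_eq_span, h]; trivial
  refine Submodule.span_induction ?_ ⟨0, zero_mem _⟩ ?_ ?_ hx
  · intro y hy
    obtain ⟨l, hl, rfl⟩ := Submonoid.exists_list_of_mem_closure hy
    clear hy hx
    induction l with
    | nil => exact ⟨1, one_mem_wordFil one_pos⟩
    | cons a l ih =>
      obtain ⟨n, hn⟩ := ih fun y hy => hl y (List.mem_cons_of_mem _ hy)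
      obtain ⟨γ, rfl⟩ := hl a List.mem_cons_self
      exact ⟨wt γ + 1 + n, mul_mem_wordFil (Nat.le_succ _)
        (gen_mem_wordFil (Nat.lt_succ_self _)) hn⟩
  · rintro y z - - ⟨m, hm⟩ ⟨n, hn⟩
    exact ⟨max m n, add_mem (wordFil_mono (le_max_left _ _) hm)
      (wordFil_mono (le_max_right _ _) hn)⟩
  · rintro a y - ⟨n, hn⟩
    exact ⟨n, Submodule.smul_mem _ _ hn⟩

variable {L : Type*} [LieRing L] [LieAlgebra ℂ L]

/-- By the universal property the identity of the enveloping algebra factors through the subalgebra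
generated by `L`. -/
lemma adjoin_range_universalEnvelopingAlgebra_ι :
    Algebra.adjoin ℂ (Set.range (UniversalEnvelopingAlgebra.ι ℂ (L := L))) = ⊤ := by
  set S := Algebra.adjoin ℂ (Set.range (UniversalEnvelopingAlgebra.ι ℂ (L := L)))
  let f : L →ₗ⁅ℂ⁆ S :=
    { toFun := fun x => ⟨UniversalEnvelopingAlgebra.ι ℂ x,
        Algebra.subset_adjoin (Set.mem_range_self x)⟩
      map_add' := fun x y => Subtype.ext (map_add _ x y)
      map_smul' := fun a x => Subtype.ext (map_smul _ a x)
      map_lie' := fun {x y} => Subtype.ext (LieHom.map_lie _ x y) }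
  have h : S.val.comp (UniversalEnvelopingAlgebra.lift ℂ f) = AlgHom.id ℂ _ := by
    ext x
    simp [f]
  refine top_le_iff.1 fun x _ => ?_
  have hx := DFunLike.congr_fun h x
  rw [← show S.val (UniversalEnvelopingAlgebra.lift ℂ f x) = x from hx]
  exact Subtype.prop _

lemma adjoin_range_basis {E : Type*} (e : Module.Basis E ℂ L) :
    Algebra.adjoin ℂ (Set.range fun a => UniversalEnvelopingAlgebra.ι ℂ (e a)) = ⊤ := by
  rw [← top_le_iff, ← adjoin_range_universalEnvelopingAlgebra_ι]
  refine Algebra.adjoin_le ?_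
  rintro _ ⟨x, rfl⟩
  exact map_mem_of_basis e (UniversalEnvelopingAlgebra.ι ℂ (L := L)).toLinearMap
    (Subalgebra.toSubmodule (Algebra.adjoin ℂ
      (Set.range fun a => UniversalEnvelopingAlgebra.ι ℂ (e a))))
    (fun a => Algebra.subset_adjoin ⟨a, rfl⟩) x

/-- The spanning half of Poincaré–Birkhoff–Witt, as the case of no odd letters. With all weights
equal to one, a commutator of two letters is a combination of single letters and so has lower
weight. -/
lemma monomialProd_surjective {E : Type*} (e : Module.Basis E ℂ L) :
    Function.Surjective
      (monomialProd fun a => UniversalEnvelopingAlgebra.ι ℂ (e a)) := by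
  classical
  set gen : E ⊕ Empty → UniversalEnvelopingAlgebra ℂ L :=
    Sum.elim (fun a => UniversalEnvelopingAlgebra.ι ℂ (e a)) Empty.elim with hgen
  have hmem : ∀ x : L, UniversalEnvelopingAlgebra.ι ℂ x ∈ wordFil gen (fun _ => 1) 2 := by
    exact map_mem_of_basis e (UniversalEnvelopingAlgebra.ι ℂ (L := L)).toLinearMap _ fun a =>
      gen_mem_wordFil (gen := gen) (a := Sum.inl a) one_lt_two
  have H : IsAlmostCommutative gen (Empty.elim : Empty → ℂ) (Algebra.linearMap ℂ _)
      (fun _ => 1) :=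
    { q_one := by simp
      even_even := fun a b => by
        have := hmem ⁅e a, e b⁆
        rwa [LieHom.map_lie, LieRing.of_associative_ring_bracket] at this
      odd_even := fun o => o.elim
      odd_q := fun o => o.elim }
  intro x
  have htop : Algebra.adjoin ℂ (Set.range gen) = ⊤ := by
    rw [← adjoin_range_basis e]
    congr 1
    ext; simp [hgen]
  obtain ⟨n, hn⟩ := exists_mem_wordFil (wt := fun _ => 1) htop x
  rw [← H.map_quantize] at hn
  obtain ⟨y, -, rfl⟩ := hn
  induction y using TensorProduct.induction_on with
  | zero => exact ⟨0, by simp⟩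
  | add y z hy hz =>
    obtain ⟨p, hp⟩ := hy
    obtain ⟨p', hp'⟩ := hz
    exact ⟨p + p', by rw [map_add, map_add, hp, hp']⟩
  | tmul p c =>
    refine ⟨c • p, ?_⟩
    rw [map_smul, quantize_tmul, Algebra.linearMap_apply, ← Algebra.commutes, ← Algebra.smul_def]
    rfl

end Generation

/-! ### Derivations and orders of vanishing. -/

section DerivationIdeal

variable {R A : Type*} [CommRing R] [CommRing A] [Algebra R A] (D : Derivation R A A)
  {I : Ideal A}

/-- By the Leibniz rule a vector field lowers the order of vanishing by at most one. -/
lemma derivation_mem_pow {j : ℕ} {f : A} (hf : f ∈ I ^ (j + 1)) : D f ∈ I ^ j := by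
  induction j generalizing f with
  | zero => simp
  | succ j ih =>
    rw [pow_succ] at hf
    refine Submodule.mul_induction_on hf (fun a ha b hb => ?_) fun x y hx hy => by
      rw [map_add]; exact add_mem hx hy
    rw [D.leibniz, smul_eq_mul, smul_eq_mul, mul_comm b]
    exact add_mem (Ideal.mul_mem_right _ _ ha)
      (by rw [pow_succ]; exact Ideal.mul_mem_mul (ih ha) hb)

/-- A vector field that vanishes on the zero locus of `I` does not lower the order of vanishing. -/
lemma derivation_mem_pow_of_forall (hD : ∀ f, D f ∈ I) {j : ℕ} {f : A} (hf : f ∈ I ^ j) :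
    D f ∈ I ^ j := by
  induction j generalizing f with
  | zero => simp
  | succ j ih =>
    rw [pow_succ] at hf ⊢
    refine Submodule.mul_induction_on hf (fun a ha b hb => ?_) fun x y hx hy => by
      rw [map_add]; exact add_mem hx hy
    rw [D.leibniz, smul_eq_mul, smul_eq_mul, mul_comm b]
    exact add_mem (Ideal.mul_mem_mul ha (hD b)) (Ideal.mul_mem_mul (ih ha) hb)

end DerivationIdeal

/-! ### Invariant and constant vector fields on matrices. -/

section MatrixVectorFields

variable {n : Type*} [Fintype n]

/-- The left invariant vector field on `GL_n` attached to a matrix, in coordinates centred at the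
identity. -/
def invariantField (x : Matrix n n ℂ) :
    Derivation ℂ (MvPolynomial (n × n) ℂ) (MvPolynomial (n × n) ℂ) :=
  MvPolynomial.mkDerivation ℂ fun ij =>
    MvPolynomial.C (x ij.1 ij.2)
      + ∑ k, MvPolynomial.X (ij.1, k) * MvPolynomial.C (x k ij.2)

/-- The constant vector field attached to a matrix. -/
def constantField (x : Matrix n n ℂ) :
    Derivation ℂ (MvPolynomial (n × n) ℂ) (MvPolynomial (n × n) ℂ) :=
  MvPolynomial.mkDerivation ℂ fun ij => MvPolynomial.C (x ij.1 ij.2)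

lemma invariantField_X (x : Matrix n n ℂ) (i j : n) :
    invariantField x (MvPolynomial.X (i, j)) = MvPolynomial.C (x i j)
      + ∑ k, MvPolynomial.X (i, k) * MvPolynomial.C (x k j) := by
  simp [invariantField]

/-- The ideal of the identity matrix. -/
abbrev originIdeal (n : Type*) : Ideal (MvPolynomial (n × n) ℂ) :=
  RingHom.ker (MvPolynomial.constantCoeff (σ := n × n) (R := ℂ))

/-- The two fields agree at the identity matrix: the coefficients of their difference are linear
forms in the centred coordinates. -/
lemma invariantField_sub_constantField_mem (x : Matrix n n ℂ) (f : MvPolynomial (n × n) ℂ) :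
    (invariantField x - constantField x) f ∈ originIdeal n := by
  induction f using MvPolynomial.induction_on with
  | C a => rw [MvPolynomial.derivation_C]; exact zero_mem _
  | add p q hp hq => rw [map_add]; exact add_mem hp hq
  | mul_X p ij hp =>
    rw [Derivation.leibniz, smul_eq_mul, smul_eq_mul]
    refine add_mem (Ideal.mul_mem_left _ _ ?_) (Ideal.mul_mem_left _ _ hp)
    rw [RingHom.mem_ker, Derivation.sub_apply, invariantField_X]
    simp [constantField]

variable [DecidableEq n]

/-- The left invariant vector fields form a Lie algebra of operators. -/
def invariantFieldHom : Matrix n n ℂ →ₗ⁅ℂ⁆ Module.End ℂ (MvPolynomial (n × n) ℂ) where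
  toFun x := (invariantField x : MvPolynomial (n × n) ℂ →ₗ[ℂ] MvPolynomial (n × n) ℂ)
  map_add' x y := by
    rw [← Derivation.coe_add_linearMap]
    congr 1
    refine MvPolynomial.derivation_ext fun ij => ?_
    rcases ij with ⟨i, j⟩
    simp only [Derivation.add_apply, invariantField_X, Matrix.add_apply, map_add, mul_add,
      Finset.sum_add_distrib]
    ring
  map_smul' a x := by
    rw [RingHom.id_apply, ← Derivation.coe_smul_linearMap]
    congr 1
    refine MvPolynomial.derivation_ext fun ij => ?_
    rcases ij with ⟨i, j⟩
    simp only [Derivation.smul_apply, invariantField_X, Matrix.smul_apply, smul_eq_mul,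
      map_mul, MvPolynomial.smul_eq_C_mul, mul_add, Finset.mul_sum]
    congr 1
    exact Finset.sum_congr rfl fun k _ => by ring
  map_lie' {x y} := by
    rw [← Derivation.commutator_coe_linear_map]
    congr 1
    refine MvPolynomial.derivation_ext fun ij => ?_
    rcases ij with ⟨i, j⟩
    -- In matrix form the field of `x` sends the coordinate matrix `X` to `(1 + X) x`. Applying the
    -- field of `x` after that of `y` yields `(1 + X) x y`, so the commutator is the field of `x y -
    -- y x`.
    have aux : ∀ x y : Matrix n n ℂ, invariantField x (invariantField y (MvPolynomial.X (i, j)))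
        = MvPolynomial.C ((x * y) i j)
          + ∑ k, MvPolynomial.X (i, k) * MvPolynomial.C ((x * y) k j) := by
      intro x y
      rw [invariantField_X, map_add, map_sum, ← MvPolynomial.algebraMap_eq,
        Derivation.map_algebraMap, zero_add]
      simp only [Derivation.leibniz, MvPolynomial.algebraMap_eq, smul_eq_mul, invariantField_X,
        MvPolynomial.derivation_C, mul_zero, zero_add, Matrix.mul_apply, map_sum, map_mul,
        mul_add, Finset.sum_add_distrib, Finset.mul_sum]
      congr 1
      · exact Finset.sum_congr rfl fun k _ => by ring
      · rw [Finset.sum_comm]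
        exact Finset.sum_congr rfl fun k _ => Finset.sum_congr rfl fun l _ => by ring
    rw [Derivation.commutator_apply, aux, aux, invariantField_X,
      LieRing.of_associative_ring_bracket]
    simp only [Matrix.sub_apply, map_sub, mul_sub, Finset.sum_sub_distrib]
    ring

/-- On functions vanishing to order `j`, a product of `r ≤ j` invariant vector fields agrees with
the product of the constant vector fields up to order `j - r + 1`. -/
lemma invariantField_prod_sub_mem {E : Type*} (x : E → Matrix n n ℂ) (l : List E) {j : ℕ}
    {f : MvPolynomial (n × n) ℂ} (hf : f ∈ originIdeal n ^ (j + l.length)) :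
    wordProd (fun a => ((constantField (x a)).toLinearMap :
        Module.End ℂ (MvPolynomial (n × n) ℂ))) l f ∈ originIdeal n ^ j ∧
    wordProd (fun a => invariantFieldHom (x a)) l f
      - wordProd (fun a => ((constantField (x a)).toLinearMap :
        Module.End ℂ (MvPolynomial (n × n) ℂ))) l f ∈ originIdeal n ^ (j + 1) := by
  induction l generalizing j with
  | nil => simpa using hf
  | cons a l ih =>
    obtain ⟨h1, h2⟩ := ih (j := j + 1) (by simpa [add_assoc, add_comm 1] using hf)
    simp only [wordProd_cons, Module.End.mul_apply]
    set P := wordProd (fun a => ((constantField (x a)).toLinearMap :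
        Module.End ℂ (MvPolynomial (n × n) ℂ))) l f
    set R := wordProd (fun a => invariantFieldHom (x a)) l f
    refine ⟨derivation_mem_pow (constantField (x a)) h1, ?_⟩
    -- The error `R - P` vanishes to order `j + 2` and loses at most one order. The main term `P`
    -- has order `j + 1`, which the difference of the two fields preserves.
    have e : invariantFieldHom (x a) R - constantField (x a) P
        = invariantField (x a) (R - P) + (invariantField (x a) - constantField (x a)) P := by
      rw [map_sub, Derivation.sub_apply]
      change invariantField (x a) R - _ = _
      ring
    change invariantFieldHom (x a) R - constantField (x a) P ∈ _
    rw [e]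
    exact add_mem (derivation_mem_pow _ h2)
      (derivation_mem_pow_of_forall _ (invariantField_sub_constantField_mem _) h1)

end MatrixVectorFields

/-! ### Linear independence of ordered monomials. -/

section PBW

variable {L : Type*} [LieRing L] [LieAlgebra ℂ L] {n : Type*} [Fintype n] [DecidableEq n]

/-- Subtraction of exponents is truncated here; when a letter occurs too often the coefficient `b`
absorbs the vanishing, so `b ≠ 0` is claimed only for `listExp l ≤ m`. -/
lemma pderiv_wordProd_monomial {E : Type*} [DecidableEq E] (l : List E) (m : E →₀ ℕ) :
    ∃ b : ℂ, wordProd (fun a => ((MvPolynomial.pderiv a).toLinearMap :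
        Module.End ℂ (MvPolynomial E ℂ))) l (MvPolynomial.monomial m 1)
          = MvPolynomial.monomial (m - listExp l) b ∧ (listExp l ≤ m → b ≠ 0) := by
  induction l with
  | nil => exact ⟨1, by simp [listExp], by simp⟩
  | cons a l ih =>
    obtain ⟨b, hb, hb'⟩ := ih
    refine ⟨b * (m - listExp l) a, ?_, fun h => ?_⟩
    · rw [wordProd_cons, Module.End.mul_apply, hb]
      change MvPolynomial.pderiv a _ = _
      rw [MvPolynomial.pderiv_monomial]
      congr 1
      rw [tsub_tsub]
      congr 1
      simp [listExp, ← Multiset.cons_coe, ← Multiset.singleton_add, add_comm]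
    · have e : listExp (a :: l) = Finsupp.single a 1 + listExp l := by
        simp [listExp, ← Multiset.cons_coe, ← Multiset.singleton_add]
      rw [e] at h
      refine mul_ne_zero (hb' (le_trans (by simp) h)) ?_
      have := h a
      simp only [Finsupp.add_apply, Finsupp.single_eq_same] at this
      simp only [Finsupp.coe_tsub, Pi.sub_apply]
      exact_mod_cast (by omega : m a - listExp l a ≠ 0)

/-- Let the enveloping algebra act by invariant vector fields and evaluate at the identity. Against
a function vanishing to the maximal order that matters, these fields act like constant ones, that
is, like partial derivatives in the coordinates dual to `e`. A suitable test monomial then detects a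
single coefficient of top degree. -/
lemma monomialProd_injective {E : Type*} (e : Module.Basis E ℂ L)
    (ρ : L →ₗ⁅ℂ⁆ Matrix n n ℂ) (hρ : Function.Injective ρ) :
    Function.Injective (monomialProd fun a => UniversalEnvelopingAlgebra.ι ℂ (e a)) := by
  classical
  obtain ⟨φ, hφ⟩ := LinearMap.exists_leftInverse_of_injective (ρ : L →ₗ[ℂ] Matrix n n ℂ)
    (LinearMap.ker_eq_bot.2 hρ)
  have hφ' : ∀ x, φ (ρ x) = x := fun x => DFunLike.congr_fun hφ x
  -- Linear functions on matrices that restrict to the coordinates of `e` on `L`, extended along the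
  -- left inverse `φ`. Substituting them for the variables turns the constant field of `e b` into
  -- `∂_b`.
  let ℓ : E → MvPolynomial (n × n) ℂ := fun a =>
    ∑ ij : n × n, MvPolynomial.C (e.coord a (φ (Matrix.single ij.1 ij.2 1))) * MvPolynomial.X ij
  have hℓ : ∀ (x : Matrix n n ℂ) a, constantField x (ℓ a) = MvPolynomial.C (e.coord a (φ x)) := by
    intro x a
    conv_rhs => rw [Matrix.matrix_eq_sum_single x]
    simp only [ℓ, map_sum, Fintype.sum_prod_type]
    refine Finset.sum_congr rfl fun i _ => Finset.sum_congr rfl fun j _ => ?_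
    rw [show Matrix.single i j (x i j) = (x i j) • Matrix.single i j (1 : ℂ) by simp, map_smul,
      map_smul, smul_eq_mul, Derivation.leibniz, MvPolynomial.derivation_C, MvPolynomial.C_mul]
    simp [constantField]
    ring
  have hℓ0 : ∀ a, ℓ a ∈ originIdeal n := fun a => by
    simp [ℓ, RingHom.mem_ker]
  have hcc : ∀ P : MvPolynomial E ℂ, MvPolynomial.constantCoeff (MvPolynomial.aeval ℓ P)
      = MvPolynomial.constantCoeff P := by
    intro P
    induction P using MvPolynomial.induction_on with
    | C a => simp [MvPolynomial.algebraMap_eq]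
    | add p q hp hq => rw [map_add, map_add, map_add, hp, hq]
    | mul_X p a hp =>
      rw [map_mul, map_mul, map_mul, MvPolynomial.aeval_X, RingHom.mem_ker.1 (hℓ0 a)]
      simp
  have hpd : ∀ b (P : MvPolynomial E ℂ), constantField (ρ (e b)) (MvPolynomial.aeval ℓ P)
      = MvPolynomial.aeval ℓ (MvPolynomial.pderiv b P) := by
    intro b P
    induction P using MvPolynomial.induction_on with
    | C a => rw [MvPolynomial.algHom_C, Derivation.map_algebraMap, MvPolynomial.derivation_C,
        map_zero]
    | add p q hp hq => rw [map_add, map_add, map_add, map_add, hp, hq]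
    | mul_X p a hp =>
      rw [map_mul, Derivation.leibniz, Derivation.leibniz, hp, MvPolynomial.aeval_X, hℓ, hφ']
      simp only [smul_eq_mul, map_add, map_mul, MvPolynomial.aeval_X, MvPolynomial.pderiv_X,
        Module.Basis.coord_apply, Module.Basis.repr_self]
      by_cases hab : b = a
      · subst hab
        simp
      · simp [Ne.symm hab]
  have hpdl : ∀ (l : List E) (P : MvPolynomial E ℂ),
      wordProd (fun a => ((constantField (ρ (e a))).toLinearMap :
        Module.End ℂ (MvPolynomial (n × n) ℂ))) l (MvPolynomial.aeval ℓ P)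
      = MvPolynomial.aeval ℓ (wordProd (fun a => ((MvPolynomial.pderiv a).toLinearMap :
        Module.End ℂ (MvPolynomial E ℂ))) l P) := by
    intro l P
    induction l with
    | nil => simp
    | cons a l ih =>
      rw [wordProd_cons, wordProd_cons, Module.End.mul_apply, Module.End.mul_apply, ih]
      exact hpd _ _
  have hmem : ∀ m : E →₀ ℕ, MvPolynomial.aeval ℓ (MvPolynomial.monomial m (1 : ℂ))
      ∈ originIdeal n ^ (Finsupp.toMultiset m).card := by
    intro m
    induction m using Finsupp.induction_linear with
    | zero => simp
    | add f g hf hg =>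
      rw [map_add, Multiset.card_add, pow_add, ← one_mul (1 : ℂ), ← MvPolynomial.monomial_mul,
        map_mul]
      exact Ideal.mul_mem_mul hf hg
    | single a k =>
      rw [← MvPolynomial.X_pow_eq_monomial, map_pow, MvPolynomial.aeval_X]
      simpa using Ideal.pow_mem_pow (hℓ0 a) k
  let act : UniversalEnvelopingAlgebra ℂ L →ₐ[ℂ] Module.End ℂ (MvPolynomial (n × n) ℂ) :=
    UniversalEnvelopingAlgebra.lift ℂ (invariantFieldHom.comp ρ)
  have hact : ∀ l : List E, act (wordProd (fun a => UniversalEnvelopingAlgebra.ι ℂ (e a)) l)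
      = wordProd (fun a => invariantFieldHom (ρ (e a))) l := by
    intro l
    induction l with
    | nil => simp
    | cons a l ih =>
      rw [wordProd_cons, wordProd_cons, map_mul, ih]
      simp [act]
  rw [injective_iff_map_eq_zero]
  intro p hp
  by_contra hne
  -- The test function is the monomial of top degree `m₀` in the functions `ℓ`; it vanishes to order
  -- `|m₀|`, which is at least the length of every word occurring in `p`.
  obtain ⟨m₀, hm₀, hmax⟩ := Finset.exists_max_image p.support
    (fun m => (Finsupp.toMultiset m).card) (MvPolynomial.support_nonempty.2 hne)
  let Φ : UniversalEnvelopingAlgebra ℂ L →ₗ[ℂ] ℂ :=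
    (MvPolynomial.lcoeff ℂ 0) ∘ₗ
      (LinearMap.applyₗ (MvPolynomial.aeval ℓ (MvPolynomial.monomial m₀ (1 : ℂ))))
        ∘ₗ act.toLinearMap
  have hΦ : ∀ u, Φ u = MvPolynomial.constantCoeff
      (act u (MvPolynomial.aeval ℓ (MvPolynomial.monomial m₀ (1 : ℂ)))) := fun u => rfl
  have key : ∀ m ∈ p.support, (m ≠ m₀ → Φ (wordProd
      (fun a => UniversalEnvelopingAlgebra.ι ℂ (e a)) (Finsupp.toMultiset m).toList) = 0) ∧
      (m = m₀ → Φ (wordProd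
      (fun a => UniversalEnvelopingAlgebra.ι ℂ (e a)) (Finsupp.toMultiset m).toList) ≠ 0) := by
    intro m hm
    set l := (Finsupp.toMultiset m).toList with hl
    have hlm : listExp l = m := by simp [hl, listExp]
    have hlen : l.length = (Finsupp.toMultiset m).card := by simp [hl]
    have hle := hmax m hm
    -- `j` is the order of vanishing left after `|m|` derivatives. Replacing invariant by constant
    -- fields costs only order `j + 1 ≥ 1`, which is invisible at the identity.
    obtain ⟨j, hj⟩ := Nat.exists_eq_add_of_le hle
    obtain ⟨h1, h2⟩ := invariantField_prod_sub_mem (fun a => ρ (e a)) l (j := j)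
      (f := MvPolynomial.aeval ℓ (MvPolynomial.monomial m₀ (1 : ℂ)))
      (by rw [add_comm, hlen, ← hj]; exact hmem m₀)
    have h3 : Φ (wordProd (fun a => UniversalEnvelopingAlgebra.ι ℂ (e a)) l)
        = MvPolynomial.constantCoeff (wordProd (fun a => ((MvPolynomial.pderiv a).toLinearMap :
          Module.End ℂ (MvPolynomial E ℂ))) l (MvPolynomial.monomial m₀ 1)) := by
      rw [← hcc, ← hpdl, hΦ, hact, ← sub_eq_zero, ← map_sub]
      exact RingHom.mem_ker.1 (Ideal.pow_le_self (Nat.succ_ne_zero j) h2)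
    obtain ⟨b, hb, hb'⟩ := pderiv_wordProd_monomial l m₀
    rw [hlm] at hb hb'
    rw [h3, hb]
    refine ⟨fun hne => ?_, ?_⟩
    · rw [MvPolynomial.constantCoeff_monomial, if_neg]
      intro h0
      apply hne
      -- A nonzero constant term needs `m₀ ≤ m`, and `m₀` has maximal degree, so the two exponents
      -- coincide.
      have hle' : m₀ ≤ m := tsub_eq_zero_iff_le.1 h0
      obtain ⟨c, rfl⟩ := exists_add_of_le hle'
      rw [map_add, Multiset.card_add] at hle
      have : (Finsupp.toMultiset c).card = 0 := by omega
      rw [Multiset.card_eq_zero] at this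
      have hc : c = 0 := by rw [← Finsupp.toMultiset_toFinsupp c, this, map_zero]
      rw [hc, add_zero]
    · rintro rfl
      simpa using hb' le_rfl
  have hsum := congrArg Φ hp
  rw [p.as_sum, map_sum, map_sum, map_zero, Finset.sum_eq_single m₀] at hsum
  · rw [← mul_one (MvPolynomial.coeff m₀ p), ← smul_eq_mul, ← MvPolynomial.smul_monomial,
      map_smul, map_smul, monomialProd_monomial, smul_eq_mul] at hsum
    exact (mul_ne_zero (MvPolynomial.mem_support_iff.1 hm₀) ((key m₀ hm₀).2 rfl)) hsum
  · intro m hm hmne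
    rw [← mul_one (MvPolynomial.coeff m p), ← smul_eq_mul, ← MvPolynomial.smul_monomial,
      map_smul, map_smul, monomialProd_monomial, (key m hm).1 hmne, smul_zero]
  · intro h; exact absurd hm₀ h

/-- The Poincaré–Birkhoff–Witt theorem for a Lie algebra of matrices. -/
theorem monomialProd_bijective {E : Type*} (e : Module.Basis E ℂ L)
    (ρ : L →ₗ⁅ℂ⁆ Matrix n n ℂ) (hρ : Function.Injective ρ) :
    Function.Bijective (monomialProd fun a => UniversalEnvelopingAlgebra.ι ℂ (e a)) :=
  ⟨monomialProd_injective e ρ hρ, monomialProd_surjective e⟩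

/-- A finite-dimensional simple Lie algebra has a faithful matrix representation. -/
lemma exists_faithful_matrix_rep (g : Type*) [LieRing g] [LieAlgebra ℂ g]
    [FiniteDimensional ℂ g] [LieAlgebra.IsSimple ℂ g] :
    ∃ ρ : g →ₗ⁅ℂ⁆ Matrix (Fin (Module.finrank ℂ g)) (Fin (Module.finrank ℂ g)) ℂ,
      Function.Injective ρ := by
  let e : Module.End ℂ g ≃ₗ⁅ℂ⁆ Matrix (Fin (Module.finrank ℂ g)) (Fin (Module.finrank ℂ g)) ℂ :=
    (LinearEquiv.lieConj (Module.finBasis ℂ g).equivFun).trans lieEquivMatrix'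
  refine ⟨(e : Module.End ℂ g →ₗ⁅ℂ⁆ _).comp (LieAlgebra.ad ℂ g), ?_⟩
  rw [LieHom.coe_comp]
  refine e.injective.comp ?_
  have h : (LieAlgebra.ad ℂ g).ker = ⊥ := by
    rw [LieAlgebra.ad_ker_eq_self_module_ker, LieAlgebra.self_module_ker_eq_center]
    exact LieAlgebra.center_eq_bot ℂ g
  exact (LieHom.ker_eq_bot _).1 h

end PBW

end

end FiniteW

namespace FiniteW

noncomputable section

/-! ### Cohomology from a triangular Laplacian -/

section Laplacian

open Polynomial

variable {V M B : Type*} [AddCommGroup V] [Module ℂ V]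

/-- The span of the vectors of weight less than `n` and degree `k`. -/
def gradedFil (vec : M → V) (wt : M → ℕ) (dg : M → ℤ) (n : ℕ) (k : ℤ) : Submodule ℂ V :=
  Submodule.span ℂ {x | ∃ m, wt m < n ∧ dg m = k ∧ vec m = x}

lemma gradedFil_mono {vec : M → V} {wt : M → ℕ} {dg : M → ℤ} {m n : ℕ} (h : m ≤ n) (k : ℤ) :
    gradedFil vec wt dg m k ≤ gradedFil vec wt dg n k :=
  Submodule.span_mono fun _ ⟨w, hw, e⟩ => ⟨w, hw.trans_le h, e⟩

/-- A complex `D` with a homotopy `h` whose Laplacian `D h + h D` is triangular, with diagonal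
entries `num`, on a spanning family of vectors filtered by weight, such that the vectors with
diagonal entry zero have degree zero and are linearly independent. -/
structure TriangularLaplacian (D h : Module.End ℂ V) (G : ℤ → Submodule ℂ V) (vec : M → V)
    (wt num : M → ℕ) (dg : M → ℤ) (s : B → V) (r : V →ₗ[ℂ] B →₀ ℂ) (β : M → B) (wB : B → ℕ) :
    Prop where
  D_sq : ∀ x, D (D x) = 0
  D_mem : ∀ {k x}, x ∈ G k → D x ∈ G (k + 1)
  h_mem : ∀ {k x}, x ∈ G k → h x ∈ G (k - 1)
  vec_mem : ∀ m, vec m ∈ G (dg m)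
  exists_mem : ∀ {k x}, x ∈ G k → ∃ n, x ∈ gradedFil vec wt dg n k
  laplacian : ∀ m, (D (h (vec m)) + h (D (vec m))) - (num m : ℂ) • vec m
    ∈ gradedFil vec wt dg (wt m) (dg m)
  num_le : ∀ m, num m ≤ wt m
  dg_eq : ∀ m, num m = 0 → dg m = 0
  vec_eq : ∀ m, num m = 0 → vec m = s (β m)
  wt_eq : ∀ m, num m = 0 → wB (β m) = wt m
  exists_index : ∀ b, ∃ m, num m = 0 ∧ β m = b
  r_vec : ∀ m, num m = 0 → r (vec m) = Finsupp.single (β m) 1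
  r_vec_of_ne : ∀ m, num m ≠ 0 → r (vec m) = 0

/-- The Laplacian. -/
def laplaceOp (D h : Module.End ℂ V) : Module.End ℂ V := D * h + h * D

/-- The polynomial `∏_{i ≤ n} (1 - X / i)`. -/
def projPoly (n : ℕ) : ℂ[X] := ∏ i ∈ Finset.range n, (1 - C ((i + 1 : ℂ)⁻¹) * X)

lemma projPoly_eval_zero (n : ℕ) : (projPoly n).eval 0 = 1 := by
  simp [projPoly, Polynomial.eval_prod]

lemma projPoly_eval (n j : ℕ) (hj : j ≠ 0) (hjn : j ≤ n) : (projPoly n).eval (j : ℂ) = 0 := by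
  obtain ⟨i, rfl⟩ := Nat.exists_eq_succ_of_ne_zero hj
  rw [projPoly, Polynomial.eval_prod]
  refine Finset.prod_eq_zero (i := i) (Finset.mem_range.2 (by omega)) ?_
  have : (i + 1 : ℂ) ≠ 0 := by exact_mod_cast Nat.succ_ne_zero i
  simp [this]

namespace TriangularLaplacian

variable {D h : Module.End ℂ V} {G : ℤ → Submodule ℂ V} {vec : M → V} {wt num : M → ℕ}
  {dg : M → ℤ} {s : B → V} {r : V →ₗ[ℂ] B →₀ ℂ} {β : M → B} {wB : B → ℕ}

local notation "T" => gradedFil vec wt dg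

/-- The operator that projects the part of weight less than `n` onto the generalized kernel of the
Laplacian. -/
def proj (D h : Module.End ℂ V) (n : ℕ) : Module.End ℂ V :=
  aeval (laplaceOp D h) (projPoly n ^ n)

lemma gradedFil_le (H : TriangularLaplacian D h G vec wt num dg s r β wB) (n : ℕ) (k : ℤ) :
    T n k ≤ G k :=
  Submodule.span_le.2 (by rintro _ ⟨m, -, rfl, rfl⟩; exact H.vec_mem m)

/-- Polynomials in a triangular operator are triangular, and their diagonal entries are the values
of the polynomial at the old ones. -/
lemma aeval_vec (H : TriangularLaplacian D h G vec wt num dg s r β wB) (p : ℂ[X]) :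
    (∀ m, aeval (laplaceOp D h) p (vec m) - p.eval (num m : ℂ) • vec m ∈ T (wt m) (dg m)) ∧
    ∀ n k x, x ∈ T n k → aeval (laplaceOp D h) p x ∈ T n k := by
  have aux : ∀ q : ℂ[X],
      (∀ m, aeval (laplaceOp D h) q (vec m) - q.eval (num m : ℂ) • vec m ∈ T (wt m) (dg m)) →
      ∀ n k x, x ∈ T n k → aeval (laplaceOp D h) q x ∈ T n k := by
    intro q hq n k x hx
    refine (show T n k ≤ (T n k).comap (aeval (laplaceOp D h) q) from Submodule.span_le.2 ?_) hx
    rintro _ ⟨m, hm, rfl, rfl⟩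
    have h1 := gradedFil_mono hm.le _ (hq m)
    have h2 : vec m ∈ T n (dg m) := Submodule.subset_span ⟨m, hm, rfl, rfl⟩
    have := add_mem h1 (Submodule.smul_mem _ (q.eval (num m : ℂ)) h2)
    simpa using this
  suffices h : ∀ m, aeval (laplaceOp D h) p (vec m) - p.eval (num m : ℂ) • vec m
      ∈ T (wt m) (dg m) from ⟨h, aux p h⟩
  have hX : ∀ m, aeval (laplaceOp D h) (X : ℂ[X]) (vec m)
      - (X : ℂ[X]).eval (num m : ℂ) • vec m ∈ T (wt m) (dg m) := fun m => by
    simpa [laplaceOp] using H.laplacian m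
  induction p using Polynomial.induction_on with
  | C a => intro m; simp [Module.algebraMap_end_apply]
  | add p q hp hq =>
    intro m
    have := add_mem (hp m) (hq m)
    rw [map_add, eval_add, LinearMap.add_apply, add_smul]
    convert this using 1
    abel
  | monomial n a ih =>
    intro m
    rw [pow_succ', mul_left_comm, map_mul, eval_mul, Module.End.mul_apply]
    have h1 := aux X hX _ _ _ (ih m)
    have h2 := Submodule.smul_mem _ ((C a * X ^ n : ℂ[X]).eval (num m : ℂ)) (hX m)
    convert add_mem h1 h2 using 1
    rw [map_sub, map_smul, smul_sub, smul_smul, mul_comm (eval _ X)]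
    abel

/-- Since `D² = 0`, both `DΔ` and `ΔD` are equal to `DhD`. -/
lemma commute_aeval (H : TriangularLaplacian D h G vec wt num dg s r β wB) (p : ℂ[X]) (x : V) :
    D (aeval (laplaceOp D h) p x) = aeval (laplaceOp D h) p (D x) := by
  have hD : D * D = 0 := LinearMap.ext H.D_sq
  have h1 : Commute D (laplaceOp D h) := by
    rw [commute_iff_eq, laplaceOp, mul_add, add_mul, ← mul_assoc, hD, mul_assoc h D D, hD,
      zero_mul, mul_zero, zero_add, add_zero, mul_assoc]
  have h2 : Commute D (aeval (laplaceOp D h) p) := by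
    induction p using Polynomial.induction_on with
    | C a => rw [aeval_C]; exact (Algebra.commutes a D).symm
    | add p q hp hq => rw [map_add]; exact hp.add_right hq
    | monomial n a ih =>
      rw [pow_succ, ← mul_assoc, map_mul, aeval_X]
      exact ih.mul_right h1
  exact DFunLike.congr_fun h2.eq x

lemma aeval_mem (H : TriangularLaplacian D h G vec wt num dg s r β wB) (p : ℂ[X]) {k : ℤ} {x : V}
    (hx : x ∈ G k) : aeval (laplaceOp D h) p x ∈ G k := by
  obtain ⟨n, hn⟩ := H.exists_mem hx
  exact H.gradedFil_le _ _ ((H.aeval_vec p).2 _ _ _ hn)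

/-- A cocycle is cohomologous to its projection. -/
lemma exists_sub_proj_eq (H : TriangularLaplacian D h G vec wt num dg s r β wB) (n : ℕ) {k : ℤ}
    {x : V} (hx : x ∈ G k) (hDx : D x = 0) : ∃ y ∈ G (k - 1), x - proj D h n x = D y := by
  -- The polynomial takes the value `1` at `0`, so `1 - proj = q(Δ) Δ`. On a cocycle `Δ x = D (h
  -- x)`, and `q(Δ)` commutes with `D`, which exhibits the primitive.
  have hdvd : (X : ℂ[X]) ∣ 1 - projPoly n ^ n := by
    rw [X_dvd_iff, coeff_zero_eq_eval_zero]
    simp [projPoly_eval_zero]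
  obtain ⟨q, hq⟩ := hdvd
  refine ⟨aeval (laplaceOp D h) q (h x), H.aeval_mem q (H.h_mem hx), ?_⟩
  have e : projPoly n ^ n = 1 - X * q := by rw [← hq]; ring
  rw [proj, e, H.commute_aeval, mul_comm, map_sub, map_mul, map_one, aeval_X]
  simp [laplaceOp, hDx]

lemma proj_vec_sub_mem (H : TriangularLaplacian D h G vec wt num dg s r β wB) (n : ℕ) (m : M)
    (hm : num m = 0) : proj D h n (vec m) - vec m ∈ T (wt m) (dg m) := by
  have := (H.aeval_vec (projPoly n ^ n)).1 m
  simpa [hm, projPoly_eval_zero, proj] using this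

/-- The diagonal entry satisfies `1 ≤ num m ≤ wt m < n`, so it is a root of `projPoly n`. -/
lemma proj_vec_mem (H : TriangularLaplacian D h G vec wt num dg s r β wB) {n : ℕ} {m : M}
    (hm : num m ≠ 0) (hmn : wt m < n) : proj D h n (vec m) ∈ T (wt m) (dg m) := by
  have := (H.aeval_vec (projPoly n ^ n)).1 m
  rw [eval_pow, projPoly_eval n _ hm ((H.num_le m).trans hmn.le), zero_pow (by omega), zero_smul,
    sub_zero] at this
  exact this

/-- Outside degree zero every diagonal entry is a root of `projPoly n`, so each factor lowers the
weight bound by one. This is why the exponent in `proj` is `n`: after `n` factors the bound is zero.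
-/
lemma proj_eq_zero (H : TriangularLaplacian D h G vec wt num dg s r β wB) {n : ℕ} {k : ℤ}
    (hk : k ≠ 0) {x : V} (hx : x ∈ T n k) : proj D h n x = 0 := by
  have step : ∀ j < n, ∀ y ∈ T (j + 1) k, aeval (laplaceOp D h) (projPoly n) y ∈ T j k := by
    intro j hj y hy
    refine (show T (j + 1) k ≤ (T j k).comap (aeval (laplaceOp D h) (projPoly n)) from
      Submodule.span_le.2 ?_) hy
    rintro _ ⟨m, hm, rfl, rfl⟩
    have hne : num m ≠ 0 := fun h0 => hk (H.dg_eq m h0)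
    have := (H.aeval_vec (projPoly n)).1 m
    rw [projPoly_eval n _ hne ((H.num_le m).trans (by omega)), zero_smul, sub_zero] at this
    exact gradedFil_mono (by omega) _ this
  have main : ∀ j ≤ n, aeval (laplaceOp D h) (projPoly n ^ j) x ∈ T (n - j) k := by
    intro j hj
    induction j with
    | zero => simpa using hx
    | succ j ih =>
      rw [pow_succ', map_mul, Module.End.mul_apply]
      refine step _ (by omega) _ ?_
      rw [show n - (j + 1) + 1 = n - j by omega]
      exact ih (by omega)
  have h0 := main n le_rfl
  rw [Nat.sub_self] at h0
  simpa [gradedFil, proj] using h0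

/-- The cohomology vanishes outside degree zero. -/
theorem exists_eq_of_ne_zero (H : TriangularLaplacian D h G vec wt num dg s r β wB) {k : ℤ}
    (hk : k ≠ 0) {x : V} (hx : x ∈ G k) (hDx : D x = 0) : ∃ y ∈ G (k - 1), x = D y := by
  obtain ⟨n, hn⟩ := H.exists_mem hx
  obtain ⟨y, hy, e⟩ := H.exists_sub_proj_eq n hx hDx
  exact ⟨y, hy, by rw [← e, H.proj_eq_zero hk hn, sub_zero]⟩

/-- The vectors with diagonal entry zero can be corrected to cocycles that form a basis of the
cohomology in degree zero. -/
theorem exists_cocycles (H : TriangularLaplacian D h G vec wt num dg s r β wB) :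
    ∃ ψ : (B →₀ ℂ) →ₗ[ℂ] V, (∀ c, ψ c ∈ G 0 ∧ D (ψ c) = 0) ∧
      (∀ c, ∀ y ∈ G (-1), ψ c = D y → c = 0) ∧
      (∀ x ∈ G 0, D x = 0 → ∃ c, ∃ y ∈ G (-1), x = ψ c + D y) := by
  classical
  have hsub : ∀ b n, s b ∈ T (wB b + 1) 0 ∧ proj D h n (s b) - s b ∈ T (wB b) 0 := by
    intro b n
    obtain ⟨m, hm, rfl⟩ := H.exists_index b
    rw [← H.vec_eq m hm, H.wt_eq m hm, ← H.dg_eq m hm]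
    exact ⟨Submodule.subset_span ⟨m, Nat.lt_succ_self _, rfl, rfl⟩, H.proj_vec_sub_mem n m hm⟩
  -- `N b` bounds the weight of `D (s b)`. Projecting `s b` with this parameter gives a cocycle,
  -- since `D` commutes with the projection and `D (s b)` has degree one, where the projection
  -- vanishes.
  have hN : ∀ b, ∃ n, D (s b) ∈ T n 1 := fun b =>
    H.exists_mem (by simpa using H.D_mem (H.gradedFil_le _ _ (hsub b 0).1))
  choose N hN using hN
  set z : B → V := fun b => proj D h (N b) (s b) with hz
  have hz1 : ∀ b, z b ∈ G 0 ∧ D (z b) = 0 := fun b =>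
    ⟨H.aeval_mem _ (H.gradedFil_le _ _ (hsub b 0).1), by
      rw [hz]; dsimp only
      rw [proj, H.commute_aeval]
      exact H.proj_eq_zero one_ne_zero (hN b)⟩
  set ψ : (B →₀ ℂ) →ₗ[ℂ] V := Finsupp.linearCombination ℂ z with hψ
  have hψ1 : ∀ c, ψ c ∈ G 0 ∧ D (ψ c) = 0 := by
    intro c
    have : LinearMap.range ψ ≤ G 0 ⊓ LinearMap.ker D := by
      rw [hψ, Finsupp.range_linearCombination, Submodule.span_le]
      rintro _ ⟨b, rfl⟩
      exact hz1 b
    exact this ⟨c, rfl⟩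
  refine ⟨ψ, hψ1, ?_, ?_⟩
  · intro c y hy hc
    by_contra hne
    -- Independence is read off at an index of maximal weight. A projection whose parameter is
    -- fitted to the primitive `y` kills `D y`, but changes each `z b` only by terms of weight below
    -- `wB b ≤ wB b₀`, which the coordinate `b₀` does not see.
    obtain ⟨b₀, hb₀, hmax⟩ := Finset.exists_max_image c.support wB
      (Finsupp.support_nonempty_iff.2 hne)
    obtain ⟨n, hn⟩ := H.exists_mem hy
    have h0 : proj D h n (ψ c) = 0 := by
      rw [hc, proj, ← H.commute_aeval]
      change D (proj D h n y) = 0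
      rw [H.proj_eq_zero (by norm_num) hn, map_zero]
    have hr : ∀ w ≤ wB b₀, ∀ x ∈ T w 0, r x b₀ = 0 := by
      intro w hw x hx
      refine (show T w 0 ≤ LinearMap.ker (Finsupp.lapply b₀ ∘ₗ r) from Submodule.span_le.2 ?_) hx
      rintro _ ⟨m, hm, -, rfl⟩
      by_cases h0 : num m = 0
      · have : β m ≠ b₀ := by
          rintro rfl
          rw [H.wt_eq m h0] at hw
          omega
        simp [H.r_vec m h0, this]
      · simp [H.r_vec_of_ne m h0]
    have hrz : ∀ b, wB b ≤ wB b₀ →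
        r (proj D h n (z b)) b₀ = if b = b₀ then 1 else 0 := by
      intro b hb
      have h1 : proj D h n (z b) - s b ∈ T (wB b) 0 := by
        have h2 := add_mem ((H.aeval_vec (projPoly n ^ n)).2 _ _ _ (hsub b (N b)).2) (hsub b n).2
        rw [map_sub] at h2
        simpa [hz, proj] using h2
      have h3 := hr _ hb _ h1
      rw [map_sub, Finsupp.sub_apply, sub_eq_zero] at h3
      rw [h3]
      obtain ⟨m, hm, rfl⟩ := H.exists_index b
      rw [← H.vec_eq m hm, H.r_vec m hm, Finsupp.single_apply]
    have h4 : r (proj D h n (ψ c)) b₀ = c b₀ := by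
      rw [hψ, Finsupp.linearCombination_apply, Finsupp.sum, map_sum, map_sum,
        Finsupp.finsetSum_apply]
      rw [Finset.sum_congr rfl fun b hb => by
        rw [map_smul, map_smul, Finsupp.smul_apply, hrz b (hmax b hb)]]
      rw [Finset.sum_eq_single b₀]
      · simp
      · intro b _ hb; simp [hb]
      · intro hb; exact absurd hb₀ hb
    rw [h0, map_zero, Finsupp.zero_apply] at h4
    exact Finsupp.mem_support_iff.1 hb₀ h4.symm
  · intro x hx hDx
    obtain ⟨n, hn⟩ := H.exists_mem hx
    clear hx
    induction n generalizing x with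
    | zero =>
      have : x = 0 := by simpa [gradedFil] using hn
      exact ⟨0, 0, zero_mem _, by simp [this]⟩
    | succ n ih =>
      obtain ⟨y, hy, e⟩ := H.exists_sub_proj_eq (n + 1) (H.gradedFil_le _ _ hn) hDx
      -- After projection, the vectors with nonzero diagonal entry drop in weight, and those with
      -- entry zero agree with the cocycles `z` up to lower weight. The remainder `t` is again a
      -- cocycle, so induction on the weight applies to it.
      have hmem : proj D h (n + 1) x ∈ T n 0 ⊔ LinearMap.range ψ := by
        refine (show T (n + 1) 0 ≤ (T n 0 ⊔ LinearMap.range ψ).comap (proj D h (n + 1)) from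
          Submodule.span_le.2 ?_) hn
        rintro _ ⟨m, hm, hd, rfl⟩
        change proj D h (n + 1) (vec m) ∈ T n 0 ⊔ LinearMap.range ψ
        by_cases h0 : num m = 0
        · have h1 := (hsub (β m) (n + 1)).2
          have h2 := (hsub (β m) (N (β m))).2
          rw [H.wt_eq m h0] at h1 h2
          have h3 := gradedFil_mono (Nat.lt_succ_iff.1 hm) 0 (sub_mem h1 h2)
          rw [sub_sub_sub_cancel_right, ← H.vec_eq m h0] at h3
          rw [← sub_add_cancel (proj D h (n + 1) (vec m)) (z (β m))]
          refine Submodule.add_mem_sup ?_ ⟨Finsupp.single (β m) 1, by simp [hψ]⟩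
          simpa [hz, ← H.vec_eq m h0] using h3
        · refine Submodule.mem_sup_left (gradedFil_mono (Nat.lt_succ_iff.1 hm) 0 ?_)
          rw [← hd]
          exact H.proj_vec_mem h0 hm
      obtain ⟨t, ht, _, ⟨c, rfl⟩, e2⟩ := Submodule.mem_sup.1 hmem
      have hDt : D t = 0 := by
        have : D (proj D h (n + 1) x) = 0 := by
          rw [proj, H.commute_aeval, hDx, map_zero]
        rw [← e2, map_add, (hψ1 c).2, add_zero] at this
        exact this
      obtain ⟨c', y', hy', e3⟩ := ih t hDt ht
      refine ⟨c' + c, y' + y, add_mem hy' (by simpa using hy), ?_⟩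
      rw [map_add, map_add, ← e, ← e2, e3]
      abel

end TriangularLaplacian

end Laplacian

end

end FiniteW

namespace FiniteW

noncomputable section

/-! ### The Koszul complex of the symbols -/

section Koszul

variable {S H : Type*}

/-- The letters: even letters `z`, `y` (indexed by `S`) and `η` (indexed by `H`), and odd letters
`b` and `c` (indexed by `S`). -/
abbrev Letter (S H : Type*) : Type _ := (S ⊕ S ⊕ H) ⊕ (S ⊕ S)

/-- The sign of a letter. -/
def letterSign : Letter S H → ℂ := Sum.elim 1 (-1)

/-- The ghost number of a letter. -/
def letterDeg : Letter S H → ℤ := Sum.elim 0 (Sum.elim (-1) 1)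

/-- The letters `z`, `y`, `b`, `c` count, the letters `η` do not. -/
def letterNum : Letter S H → ℕ := Sum.elim (Sum.elim 1 (Sum.elim 1 0)) 1

/-- The exponent of a letter `η`. -/
def letterExp : Letter S H → H →₀ ℕ :=
  Sum.elim (Sum.elim 0 (Sum.elim 0 fun η => Finsupp.single η 1)) 0

/-- The leading part of the differential on letters: `y ↦ c`, `b ↦ z`. -/
def letterD : Letter S H → Option (Letter S H)
  | Sum.inl (Sum.inr (Sum.inl α)) => some (Sum.inr (Sum.inr α))
  | Sum.inr (Sum.inl α) => some (Sum.inl (Sum.inl α))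
  | _ => none

/-- The homotopy on letters: `c ↦ y`, `z ↦ b`. -/
def letterH : Letter S H → Option (Letter S H)
  | Sum.inr (Sum.inr α) => some (Sum.inl (Sum.inr (Sum.inl α)))
  | Sum.inl (Sum.inl α) => some (Sum.inr (Sum.inl α))
  | _ => none

/-- The element attached to a letter, or zero. -/
def optGen {A Γ : Type*} [Zero A] (gen : Γ → A) (v : Option Γ) : A := v.elim 0 gen

/-- An odd derivation that maps letters to letters. -/
structure IsLetterDerivation {A : Type*} [Ring A] [Algebra ℂ A] (gen : Letter S H → A)
    (d : Module.End ℂ A) (f : Letter S H → Option (Letter S H)) : Prop where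
  map_one : d 1 = 0
  map_mul : ∀ v p, d (gen v * p) = optGen gen (f v) * p + letterSign v • (gen v * d p)

section Operators

variable {W : Type*} [AddCommGroup W] [Module ℂ W] (w : S ⊕ S → W)
  (wdual : S ⊕ S → Module.Dual ℂ W)

/-- The algebra of symbols. -/
abbrev Symbols (S H W : Type*) [AddCommGroup W] [Module ℂ W] : Type _ :=
  MvPolynomial (S ⊕ S ⊕ H) ℂ ⊗[ℂ] ExteriorAlgebra ℂ W

/-- The odd letters in the exterior algebra. -/
def extGen (o : S ⊕ S) : ExteriorAlgebra ℂ W := ExteriorAlgebra.ι ℂ (w o)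

/-- The letters in the algebra of symbols. -/
abbrev symLetter (H : Type*) : Letter S H → Symbols S H W := symbolGen (extGen w)

/-- The operator `∂ₑ ⊗ (w ∧ ·)`. -/
def derivWedge (e : S ⊕ S ⊕ H) (o : S ⊕ S) : Module.End ℂ (Symbols S H W) :=
  TensorProduct.map (MvPolynomial.pderiv e).toLinearMap (LinearMap.mulLeft ℂ (extGen w o))

/-- The operator `(e ·) ⊗ (w* ⌋ ·)`. -/
def mulContract (e : S ⊕ S ⊕ H) (o : S ⊕ S) : Module.End ℂ (Symbols S H W) :=
  TensorProduct.map (LinearMap.mulLeft ℂ (MvPolynomial.X e))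
    (CliffordAlgebra.contractLeft (Q := (0 : QuadraticForm ℂ W)) (wdual o))

variable {w wdual} [DecidableEq S] [DecidableEq H]

/-- The partial derivative sees only even letters, and the exterior factor anticommutes with odd
letters, which accounts for `letterSign`. -/
lemma derivWedge_mul (e : S ⊕ S ⊕ H) (o : S ⊕ S) (v : Letter S H) (p : Symbols S H W) :
    derivWedge w e o (symLetter w H v * p)
      = (if v = Sum.inl e then symLetter w H (Sum.inr o) * p else 0)
        + letterSign v • (symLetter w H v * derivWedge w e o p) := by
  induction p using TensorProduct.induction_on with
  | zero => simp
  | add p q hp hq =>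
    simp only [mul_add, map_add, hp, hq, smul_add]
    split_ifs <;> abel
  | tmul a ω =>
    rcases v with e' | o'
    · by_cases h : e' = e
      · subst h
        simp [derivWedge, symbolGen, letterSign, Derivation.leibniz, TensorProduct.add_tmul,
          add_comm]
      · simp [derivWedge, symbolGen, letterSign, Derivation.leibniz, h,
          MvPolynomial.pderiv_X_of_ne h]
    · have := ExteriorAlgebra.ι_add_mul_swap (R := ℂ) (w o) (w o')
      have h : extGen w o * (extGen w o' * ω) = - (extGen w o' * (extGen w o * ω)) := by
        rw [← mul_assoc, ← mul_assoc, extGen, extGen, eq_neg_of_add_eq_zero_left this, neg_mul]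
      simp [derivWedge, symbolGen, letterSign, h, TensorProduct.tmul_neg]
      exact (neg_one_smul ℂ _).symm

/-- Contraction is an antiderivation of the exterior algebra, and by `hdual` it detects exactly one
odd letter. -/
lemma mulContract_mul (hdual : ∀ o o', wdual o (w o') = if o = o' then 1 else 0)
    (e : S ⊕ S ⊕ H) (o : S ⊕ S) (v : Letter S H) (p : Symbols S H W) :
    mulContract wdual e o (symLetter w H v * p)
      = (if v = Sum.inr o then symLetter w H (Sum.inl e) * p else 0)
        + letterSign v • (symLetter w H v * mulContract wdual e o p) := by
  induction p using TensorProduct.induction_on with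
  | zero => simp
  | add p q hp hq =>
    simp only [mul_add, map_add, hp, hq, smul_add]
    split_ifs <;> abel
  | tmul a ω =>
    rcases v with e' | o'
    · simp [mulContract, symbolGen, letterSign, mul_left_comm]
    · have h : CliffordAlgebra.contractLeft (Q := (0 : QuadraticForm ℂ W)) (wdual o)
          (extGen w o' * ω) = (if o' = o then ω else 0) - extGen w o' *
            CliffordAlgebra.contractLeft (Q := (0 : QuadraticForm ℂ W)) (wdual o) ω := by
        rw [extGen, ExteriorAlgebra.ι, CliffordAlgebra.contractLeft_ι_mul, hdual]
        rcases eq_or_ne o' o with h | h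
        · simp [h]
        · simp [h, h.symm]
      by_cases h' : o' = o
      · subst h'
        simp [mulContract, symbolGen, letterSign, h, sub_eq_add_neg, TensorProduct.tmul_add,
          TensorProduct.tmul_neg]
        exact (neg_one_smul ℂ _).symm
      · simp [mulContract, symbolGen, letterSign, h, h', TensorProduct.tmul_neg]
        exact (neg_one_smul ℂ _).symm

variable [Fintype S] (w wdual)

/-- The Koszul differential. -/
def koszulD : Module.End ℂ (Symbols S H W) :=
  ∑ α, derivWedge w (Sum.inr (Sum.inl α)) (Sum.inr α)
    + ∑ α, mulContract wdual (Sum.inl α) (Sum.inl α)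

/-- The Koszul homotopy. -/
def koszulH : Module.End ℂ (Symbols S H W) :=
  ∑ α, mulContract wdual (Sum.inr (Sum.inl α)) (Sum.inr α)
    + ∑ α, derivWedge w (Sum.inl α) (Sum.inl α)

variable {w wdual}

lemma koszulD_isLetterDerivation (hdual : ∀ o o', wdual o (w o') = if o = o' then 1 else 0) :
    IsLetterDerivation (symLetter w H) (koszulD w wdual) letterD where
  map_one := by
    simp [koszulD, derivWedge, mulContract, Algebra.TensorProduct.one_def]
  map_mul v p := by
    simp only [koszulD, LinearMap.add_apply, LinearMap.sum_apply, derivWedge_mul,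
      mulContract_mul hdual, Finset.sum_add_distrib, mul_add, smul_add, Finset.mul_sum,
      Finset.smul_sum]
    rw [add_add_add_comm]
    congr 1
    rcases v with (α | α | η) | (α | α) <;> simp [letterD, optGen]

lemma koszulH_isLetterDerivation (hdual : ∀ o o', wdual o (w o') = if o = o' then 1 else 0) :
    IsLetterDerivation (symLetter w H) (koszulH w wdual) letterH where
  map_one := by
    simp [koszulH, derivWedge, mulContract, Algebra.TensorProduct.one_def]
  map_mul v p := by
    simp only [koszulH, LinearMap.add_apply, LinearMap.sum_apply, derivWedge_mul,
      mulContract_mul hdual, Finset.sum_add_distrib, mul_add, smul_add, Finset.mul_sum,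
      Finset.smul_sum]
    rw [add_add_add_comm]
    congr 1
    rcases v with (α | α | η) | (α | α) <;> simp [letterH, optGen]

end Operators

/-- The ghost number of a word. -/
def wordDeg (l : List (Letter S H)) : ℤ := (l.map letterDeg).sum

/-- The number of letters other than `η`. -/
def wordNum (l : List (Letter S H)) : ℕ := (l.map letterNum).sum

/-- The exponent of the letters `η`. -/
def wordExp (l : List (Letter S H)) : H →₀ ℕ := (l.map letterExp).sum

namespace IsLetterDerivation

variable {A : Type*} [Ring A] [Algebra ℂ A] {gen : Letter S H → A} {d d' : Module.End ℂ A}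

/-- An odd derivation replaces one letter at a time, so a word goes to a combination of words of the
same weight whose degree is shifted uniformly. -/
lemma apply_wordProd_mem {f : Letter S H → Option (Letter S H)} (hd : IsLetterDerivation gen d f)
    {wt : Letter S H → ℕ} (hwt : ∀ v, ∀ u ∈ f v, wt u = wt v) {k : ℤ}
    (hdeg : ∀ v, ∀ u ∈ f v, letterDeg u = letterDeg v + k) (l : List (Letter S H)) :
    d (wordProd gen l) ∈ Submodule.span ℂ {x | ∃ l', wordWt wt l' = wordWt wt l ∧
      wordDeg l' = wordDeg l + k ∧ wordProd gen l' = x} := by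
  induction l with
  | nil => simp [hd.map_one]
  | cons v l ih =>
    rw [wordProd_cons, hd.map_mul]
    refine add_mem ?_ (Submodule.smul_mem _ _ ?_)
    · cases hv : f v with
      | none => simp [optGen]
      | some u =>
        refine Submodule.subset_span ⟨u :: l, ?_, ?_, by simp [optGen]⟩
        · simp [hwt v u hv]
        · simp [wordDeg, hdeg v u hv]; ring
    · rw [← LinearMap.mulLeft_apply (R := ℂ) (gen v), ← Submodule.mem_comap]
      refine (Submodule.span_le.2 ?_ : Submodule.span ℂ _ ≤ _) ih
      rintro _ ⟨l', h1, h2, rfl⟩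
      refine Submodule.subset_span ⟨v :: l', by simp [h1], ?_, by simp⟩
      simp only [wordDeg, List.map_cons, List.sum_cons] at h2 ⊢
      omega

/-- The anticommutator of two odd derivations is an even derivation, because the mixed terms cancel
by sign. On letters it is multiplication by `letterNum`, so on words it counts letters. -/
lemma laplacian_wordProd (hd : IsLetterDerivation gen d letterD)
    (hd' : IsLetterDerivation gen d' letterH) (l : List (Letter S H)) :
    d (d' (wordProd gen l)) + d' (d (wordProd gen l)) = (wordNum l : ℂ) • wordProd gen l := by
  induction l with
  | nil => simp [hd.map_one, hd'.map_one, wordNum]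
  | cons v l ih =>
    have e : (wordNum (v :: l) : ℂ) = letterNum v + wordNum l := by simp [wordNum]
    have key : d (d' (gen v * wordProd gen l)) + d' (d (gen v * wordProd gen l))
        = (letterNum v : ℂ) • (gen v * wordProd gen l)
          + gen v * (d (d' (wordProd gen l)) + d' (d (wordProd gen l))) := by
      rcases v with (α | α | η) | (α | α) <;>
      simp only [hd.map_mul, hd'.map_mul, letterD, letterH, optGen, Option.elim_none,
        Option.elim_some, letterSign, letterNum, Sum.elim_inl, Sum.elim_inr, Pi.one_apply,
        Pi.neg_apply, Pi.zero_apply, zero_mul, map_add, map_neg, one_smul, neg_smul, zero_add,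
        Nat.cast_one, Nat.cast_zero, zero_smul, mul_add] <;> abel
    rw [wordProd_cons, key, ih, e, add_smul, mul_smul_comm]

end IsLetterDerivation

end Koszul

end

end FiniteW

namespace FiniteW

noncomputable section

set_option linter.unusedSectionVars false

/-! ### Quantized Koszul complexes -/

section Projection

/-- In a direct sum, a homogeneous element of the span of homogeneous vectors is in the span of
those of its own degree. -/
lemma mem_span_of_mem_of_isInternal {V M : Type*} [AddCommGroup V] [Module ℂ V]
    {G : ℤ → Submodule ℂ V} (hG : DirectSum.IsInternal G) {vec : M → V} {dg : M → ℤ}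
    (hvec : ∀ m, vec m ∈ G (dg m)) {p : M → Prop} {k : ℤ} {x : V} (hx : x ∈ G k)
    (hxs : x ∈ Submodule.span ℂ {y | ∃ m, p m ∧ vec m = y}) :
    x ∈ Submodule.span ℂ {y | ∃ m, p m ∧ dg m = k ∧ vec m = y} := by
  let _ := hG.chooseDecomposition
  let π : V →ₗ[ℂ] V := (G k).subtype ∘ₗ DirectSum.component ℂ ℤ (fun i => G i) k ∘ₗ
    (DirectSum.decomposeLinearEquiv G).toLinearMap
  have hπ : ∀ y, π y = (DirectSum.decompose G y k : V) := fun y => rfl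
  have hπx : π x = x := by rw [hπ, DirectSum.decompose_of_mem_same G hx]
  rw [← hπx, ← Submodule.mem_comap]
  refine (Submodule.span_le.2 ?_ : Submodule.span ℂ _ ≤ _) hxs
  rintro _ ⟨m, hm, rfl⟩
  rw [SetLike.mem_coe, Submodule.mem_comap]
  by_cases h : dg m = k
  · rw [hπ, DirectSum.decompose_of_mem_same G (h ▸ hvec m)]
    exact Submodule.subset_span ⟨m, hm, h, rfl⟩
  · rw [hπ, DirectSum.decompose_of_mem_ne G (hvec m) h]
    exact zero_mem _

end Projection

section KoszulModel

variable {S H W A : Type*} [AddCommGroup W] [Module ℂ W] [Ring A] [Algebra ℂ A]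
  [Fintype S] [DecidableEq S] [DecidableEq H]

lemma exists_mem_symbolFil {w : S ⊕ S → W} (hw : Submodule.span ℂ (Set.range w) = ⊤)
    (wt : Letter S H → ℕ) (p : Symbols S H W) : ∃ n, p ∈ symbolFil (extGen w) wt n := by
  refine exists_mem_wordFil (top_le_iff.1 fun p _ => ?_) p
  set T := Algebra.adjoin ℂ (Set.range (symLetter w H))
  have h1 : ∀ a : MvPolynomial (S ⊕ S ⊕ H) ℂ, a ⊗ₜ 1 ∈ T := by
    intro a
    have : Algebra.adjoin ℂ (Set.range (MvPolynomial.X : _ → MvPolynomial (S ⊕ S ⊕ H) ℂ))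
        ≤ T.comap Algebra.TensorProduct.includeLeft := by
      refine Algebra.adjoin_le ?_
      rintro _ ⟨e, rfl⟩
      exact Algebra.subset_adjoin ⟨Sum.inl e, rfl⟩
    rw [MvPolynomial.adjoin_range_X] at this
    exact this (Algebra.mem_top (x := a))
  have h2 : ∀ ω : ExteriorAlgebra ℂ W, 1 ⊗ₜ ω ∈ T := by
    intro ω
    have : Algebra.adjoin ℂ (Set.range (ExteriorAlgebra.ι ℂ (M := W)))
        ≤ T.comap Algebra.TensorProduct.includeRight := by
      refine Algebra.adjoin_le ?_
      rintro _ ⟨x, rfl⟩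
      have hx : Submodule.span ℂ (Set.range w)
          ≤ (Subalgebra.toSubmodule (T.comap
            (Algebra.TensorProduct.includeRight : ExteriorAlgebra ℂ W →ₐ[ℂ] Symbols S H W))).comap
              (ExteriorAlgebra.ι ℂ) := by
        refine Submodule.span_le.2 ?_
        rintro _ ⟨o, rfl⟩
        exact Algebra.subset_adjoin ⟨Sum.inr o, rfl⟩
      rw [hw] at hx
      exact hx Submodule.mem_top
    rw [show Algebra.adjoin ℂ (Set.range (ExteriorAlgebra.ι ℂ (M := W))) = ⊤ from
      CliffordAlgebra.adjoin_range_ι] at this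
    exact this (Algebra.mem_top (x := ω))
  induction p using TensorProduct.induction_on with
  | zero => exact zero_mem _
  | add p q hp hq => exact add_mem (hp trivial) (hq trivial)
  | tmul a ω =>
    have := mul_mem (h1 a) (h2 ω)
    simpa using this

/-- A differential `D` on an algebra generated by letters that commute up to lower weight, whose
leading part is the Koszul differential. -/
structure KoszulModel (gen : Letter S H → A) (q : ExteriorAlgebra ℂ W →ₗ[ℂ] A) (w : S ⊕ S → W)
    (wdual : S ⊕ S → Module.Dual ℂ W) (wt : Letter S H → ℕ) (D : Module.End ℂ A)
    (G : ℤ → Submodule ℂ A) : Prop where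
  almostComm : IsAlmostCommutative gen (extGen w) q wt
  bijective : Function.Bijective (quantize gen q)
  span_eq : Submodule.span ℂ (Set.range w) = ⊤
  dual : ∀ o o', wdual o (w o') = if o = o' then 1 else 0
  D_one : D 1 = 0
  D_mul : ∀ v X, D (gen v * X) = D (gen v) * X + letterSign v • (gen v * D X)
  D_gen : ∀ v, D (gen v) - optGen gen (letterD v) ∈ wordFil gen wt (wt v)
  wt_D : ∀ v, ∀ u ∈ letterD v, wt u = wt v
  num_le : ∀ v, letterNum v ≤ wt v
  internal : DirectSum.IsInternal G
  gen_mul_mem : ∀ v {k X}, X ∈ G k → gen v * X ∈ G (letterDeg v + k)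
  q_mem : ∀ l : List (S ⊕ S), q (wordProd (extGen w) l) ∈ G (wordDeg (H := H) (l.map Sum.inr))
  D_mem : ∀ {k X}, X ∈ G k → D X ∈ G (k + 1)
  D_sq : ∀ X, D (D X) = 0

namespace KoszulModel

variable {gen : Letter S H → A} {q : ExteriorAlgebra ℂ W →ₗ[ℂ] A} {w : S ⊕ S → W}
  {wdual : S ⊕ S → Module.Dual ℂ W} {wt : Letter S H → ℕ} {D : Module.End ℂ A}
  {G : ℤ → Submodule ℂ A}

lemma gen_mul_quantize_sub_mem (K : KoszulModel gen q w wdual wt D G) (u : Letter S H) {n : ℕ}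
    {p : Symbols S H W} (hp : p ∈ symbolFil (extGen w) wt (n + 1)) :
    gen u * quantize gen q p - quantize gen q (symLetter w H u * p)
      ∈ wordFil gen wt (wt u + n) := by
  let f : Symbols S H W →ₗ[ℂ] A := LinearMap.mulLeft ℂ (gen u) ∘ₗ quantize gen q
    - quantize gen q ∘ₗ LinearMap.mulLeft ℂ (symLetter w H u)
  change p ∈ (wordFil gen wt (wt u + n)).comap f
  refine (Submodule.span_le.2 ?_ : symbolFil (extGen w) wt (n + 1) ≤ _) hp
  rintro _ ⟨l, hl, rfl⟩
  have h1 := mul_mem_wordFil (k := wt u + n) (by omega)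
    (gen_mem_wordFil (gen := gen) (Nat.lt_succ_self (wt u)))
    (K.almostComm.wordProd_sub_quantize_mem l)
  have h2 := wordFil_mono (n := wt u + n) (by simp; omega)
    (K.almostComm.wordProd_sub_quantize_mem (u :: l))
  have := sub_mem h2 h1
  simp only [wordProd_cons, mul_sub] at this
  simp only [f, SetLike.mem_coe, Submodule.mem_comap, LinearMap.sub_apply, LinearMap.comp_apply,
    LinearMap.mulLeft_apply]
  convert this using 1
  abel

lemma koszulD_mem (K : KoszulModel gen q w wdual wt D G) {n : ℕ} {p : Symbols S H W}
    (hp : p ∈ symbolFil (extGen w) wt n) : koszulD w wdual p ∈ symbolFil (extGen w) wt n := by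
  refine (Submodule.span_le.2 ?_ : symbolFil (extGen w) wt n ≤
    (symbolFil (extGen w) wt n).comap (koszulD w wdual)) hp
  rintro _ ⟨l, hl, rfl⟩
  refine Submodule.span_mono ?_ ((koszulD_isLetterDerivation K.dual).apply_wordProd_mem
    K.wt_D (k := 1) ?_ l)
  · rintro _ ⟨l', h1, -, rfl⟩
    exact ⟨l', by omega, rfl⟩
  · rintro ((α | α | η) | (α | α)) u hu <;> simp [letterD] at hu <;> subst hu <;>
      simp [letterDeg]

lemma wt_H (K : KoszulModel gen q w wdual wt D G) (v : Letter S H) :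
    ∀ u ∈ letterH v, wt u = wt v := by
  rcases v with (α | α | η) | (α | α) <;> intro u hu <;> simp [letterH] at hu <;> subst hu
  · exact (K.wt_D (Sum.inr (Sum.inl α)) _ rfl).symm
  · exact (K.wt_D (Sum.inl (Sum.inr (Sum.inl α))) _ rfl).symm

lemma koszulH_wordProd_mem (K : KoszulModel gen q w wdual wt D G) (l : List (Letter S H)) :
    koszulH w wdual (wordProd (symLetter w H) l) ∈
      Submodule.span ℂ {x | ∃ l', wordWt wt l' = wordWt wt l ∧ wordDeg l' = wordDeg l + (-1) ∧
        wordProd (symLetter w H) l' = x} := by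
  refine (koszulH_isLetterDerivation K.dual).apply_wordProd_mem K.wt_H ?_ l
  rintro ((α | α | η) | (α | α)) u hu <;> simp [letterH] at hu <;> subst hu <;>
    simp [letterDeg]

lemma koszulH_mem (K : KoszulModel gen q w wdual wt D G) {n : ℕ} {p : Symbols S H W}
    (hp : p ∈ symbolFil (extGen w) wt n) : koszulH w wdual p ∈ symbolFil (extGen w) wt n := by
  refine (Submodule.span_le.2 ?_ : symbolFil (extGen w) wt n ≤
    (symbolFil (extGen w) wt n).comap (koszulH w wdual)) hp
  rintro _ ⟨l, hl, rfl⟩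
  refine Submodule.span_mono ?_ (K.koszulH_wordProd_mem l)
  rintro _ ⟨l', h1, -, rfl⟩
  exact ⟨l', by omega, rfl⟩

/-- Both differentials satisfy the same Leibniz rule and agree on letters up to lower weight;
induction on the word propagates this. -/
lemma D_wordProd_sub_mem (K : KoszulModel gen q w wdual wt D G) (l : List (Letter S H)) :
    D (wordProd gen l) - quantize gen q (koszulD w wdual (wordProd (symLetter w H) l))
      ∈ wordFil gen wt (wordWt wt l) := by
  have hd := koszulD_isLetterDerivation (H := H) K.dual
  induction l with
  | nil => simp [K.D_one, hd.map_one]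
  | cons v l ih =>
    rw [wordProd_cons, wordProd_cons, K.D_mul, hd.map_mul, map_add, map_smul]
    have h1 := mul_mem_wordFil (k := wordWt wt (v :: l)) (by simp; omega) (K.D_gen v)
      (wordProd_mem (gen := gen) (Nat.lt_succ_self (wordWt wt l)))
    have h2 : optGen gen (letterD v) * wordProd gen l
        - quantize gen q (optGen (symLetter w H) (letterD v) * wordProd (symLetter w H) l)
        ∈ wordFil gen wt (wordWt wt (v :: l)) := by
      cases hv : letterD v with
      | none => simp [optGen]
      | some u =>
        have := K.almostComm.wordProd_sub_quantize_mem (u :: l)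
        simpa [optGen, K.wt_D v u hv] using this
    have h3 := mul_mem_wordFil (k := wordWt wt (v :: l)) (by simp; omega)
      (gen_mem_wordFil (gen := gen) (Nat.lt_succ_self (wt v))) ih
    have h4 := K.gen_mul_quantize_sub_mem v
      (K.koszulD_mem (wordProd_mem (gen := symLetter w H) (Nat.lt_succ_self (wordWt wt l))))
    rw [← wordWt_cons] at h4
    have h5 := Submodule.smul_mem _ (letterSign v) (add_mem h3 h4)
    convert add_mem (add_mem h1 h2) h5 using 1
    rw [sub_mul, mul_sub, smul_add, smul_sub, smul_sub]
    abel

lemma D_mem_wordFil (K : KoszulModel gen q w wdual wt D G) {n : ℕ} {x : A}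
    (hx : x ∈ wordFil gen wt n) : D x ∈ wordFil gen wt n := by
  refine (Submodule.span_le.2 ?_ : wordFil gen wt n ≤ (wordFil gen wt n).comap D) hx
  rintro _ ⟨l, hl, rfl⟩
  have h1 := wordFil_mono hl.le (K.D_wordProd_sub_mem l)
  have h2 := K.almostComm.quantize_mem (K.koszulD_mem (wordProd_mem (gen := symLetter w H) hl))
  simpa using add_mem h1 h2

/-- A quantized symbol and the corresponding product in `A` differ by lower weight, and `D` does not
raise weight, so the comparison on words carries over to symbols. -/
lemma D_quantize_sub_mem (K : KoszulModel gen q w wdual wt D G) {n : ℕ} {p : Symbols S H W}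
    (hp : p ∈ symbolFil (extGen w) wt (n + 1)) :
    D (quantize gen q p) - quantize gen q (koszulD w wdual p) ∈ wordFil gen wt n := by
  let f : Symbols S H W →ₗ[ℂ] A := D ∘ₗ quantize gen q - quantize gen q ∘ₗ koszulD w wdual
  change p ∈ (wordFil gen wt n).comap f
  refine (Submodule.span_le.2 ?_ : symbolFil (extGen w) wt (n + 1) ≤ _) hp
  rintro _ ⟨l, hl, rfl⟩
  have h1 := K.D_mem_wordFil (K.almostComm.wordProd_sub_quantize_mem l)
  have h2 := sub_mem (K.D_wordProd_sub_mem l) h1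
  rw [map_sub] at h2
  simp only [f, SetLike.mem_coe, Submodule.mem_comap, LinearMap.sub_apply, LinearMap.comp_apply]
  refine wordFil_mono (Nat.lt_succ_iff.1 hl) ?_
  convert h2 using 1
  abel

/-- The even letters have degree zero, so only the quantized odd part contributes. -/
lemma quantize_wordProd_mem (K : KoszulModel gen q w wdual wt D G) (l : List (Letter S H)) :
    quantize gen q (wordProd (symLetter w H) l) ∈ G (wordDeg l) := by
  obtain ⟨m, m', h, -, hp⟩ := exists_wordProd_symbolGen (extGen w) wt l
  rw [symLetter, h, quantize_tmul, monomialProd_monomial]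
  have hdeg : wordDeg l = wordDeg (H := H) (m'.map Sum.inr) := by
    rw [wordDeg, (hp.map letterDeg).sum_eq]
    simp [wordDeg, letterDeg, Function.comp_def]
  rw [hdeg]
  have hz : ∀ (m : List (S ⊕ S ⊕ H)) (X : A) (k : ℤ), X ∈ G k →
      wordProd (gen ∘ Sum.inl) m * X ∈ G k := by
    intro m X k hX
    induction m with
    | nil => simpa using hX
    | cons a m ih =>
      rw [wordProd_cons, mul_assoc]
      have := K.gen_mul_mem (Sum.inl a) ih
      simpa [letterDeg] using this
  exact hz _ _ _ (K.q_mem m')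

/-- The quantization map as a linear equivalence. -/
def quantizeEquiv (K : KoszulModel gen q w wdual wt D G) : Symbols S H W ≃ₗ[ℂ] A :=
  LinearEquiv.ofBijective (quantize gen q) K.bijective

lemma mem_wordFil_iff (K : KoszulModel gen q w wdual wt D G) {n : ℕ} (x : A) :
    x ∈ wordFil gen wt n ↔ K.quantizeEquiv.symm x ∈ symbolFil (extGen w) wt n := by
  rw [← K.almostComm.map_quantize]
  constructor
  · rintro ⟨p, hp, rfl⟩
    rwa [show K.quantizeEquiv.symm (quantize gen q p) = p from
      K.quantizeEquiv.symm_apply_apply p]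
  · intro h
    exact ⟨_, h, K.quantizeEquiv.apply_symm_apply x⟩

/-- The span of words, in terms of the family of quantized words. -/
lemma wordFil_eq_span (K : KoszulModel gen q w wdual wt D G) (n : ℕ) :
    wordFil gen wt n = Submodule.span ℂ {y | ∃ l, wordWt wt l < n ∧
      quantize gen q (wordProd (symLetter w H) l) = y} := by
  rw [← K.almostComm.map_quantize, symbolFil, wordFil, Submodule.map_span]
  congr 1
  ext y
  simp [symLetter]

/-- The homotopy, transported to the algebra. -/
def homotopy (K : KoszulModel gen q w wdual wt D G) : Module.End ℂ A :=
  K.quantizeEquiv.conj (koszulH w wdual)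

lemma homotopy_quantize (K : KoszulModel gen q w wdual wt D G) (p : Symbols S H W) :
    K.homotopy (quantize gen q p) = quantize gen q (koszulH w wdual p) := by
  have : K.quantizeEquiv.symm (quantize gen q p) = p := K.quantizeEquiv.symm_apply_apply p
  rw [homotopy, LinearEquiv.conj_apply, LinearMap.comp_apply, LinearMap.comp_apply,
    LinearEquiv.coe_coe, LinearEquiv.coe_coe, this]
  rfl

/-- The homotopy is transported exactly and preserves weight, so the only discrepancy from the
Laplacian of symbols is that between `D` and the Koszul differential, which is of lower weight. -/
lemma laplacian_sub_mem (K : KoszulModel gen q w wdual wt D G) (l : List (Letter S H)) :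
    D (K.homotopy (quantize gen q (wordProd (symLetter w H) l)))
      + K.homotopy (D (quantize gen q (wordProd (symLetter w H) l)))
      - (wordNum l : ℂ) • quantize gen q (wordProd (symLetter w H) l)
      ∈ wordFil gen wt (wordWt wt l) := by
  set p := wordProd (symLetter w H) l with hp
  have hpm : p ∈ symbolFil (extGen w) wt (wordWt wt l + 1) := wordProd_mem (Nat.lt_succ_self _)
  have h1 := K.D_quantize_sub_mem (K.koszulH_mem hpm)
  have h2 := K.D_quantize_sub_mem hpm
  have h3 : K.homotopy (D (quantize gen q p) - quantize gen q (koszulD w wdual p))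
      ∈ wordFil gen wt (wordWt wt l) := by
    rw [← K.almostComm.map_quantize] at h2
    obtain ⟨p', hp', e⟩ := h2
    rw [← e, homotopy_quantize]
    exact K.almostComm.quantize_mem (K.koszulH_mem hp')
  have h4 := (koszulD_isLetterDerivation (H := H) K.dual).laplacian_wordProd
    (koszulH_isLetterDerivation K.dual) l
  rw [← hp] at h4
  rw [← map_smul, ← h4, map_add, homotopy_quantize]
  rw [map_sub, homotopy_quantize] at h3
  convert add_mem h1 h3 using 1
  abel

/-- The projection of the symbols onto the polynomials in the letters `η`. -/
def symbolProj (S H W : Type*) [AddCommGroup W] [Module ℂ W] :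
    Symbols S H W →ₐ[ℂ] MvPolynomial H ℂ :=
  Algebra.TensorProduct.lift
    (MvPolynomial.aeval (Sum.elim 0 (Sum.elim 0 MvPolynomial.X)))
    ((Algebra.ofId ℂ _).comp ExteriorAlgebra.algebraMapInv) (fun _ _ => Commute.all _ _)

/-- Provides the functionals that separate the monomials in `η` and vanish on every word containing
another letter. -/
lemma symbolProj_wordProd (w : S ⊕ S → W) (l : List (Letter S H)) :
    symbolProj S H W (wordProd (symLetter w H) l)
      = if wordNum l = 0 then MvPolynomial.monomial (wordExp l) 1 else 0 := by
  induction l with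
  | nil => simp [wordNum, wordExp]
  | cons v l ih =>
    rw [wordProd_cons, map_mul, ih]
    rcases v with (α | α | η) | o
    · simp [wordNum, letterNum, symbolProj, symbolGen]
    · simp [wordNum, letterNum, symbolProj, symbolGen]
    · have h1 : symbolProj S H W (symLetter w H (Sum.inl (Sum.inr (Sum.inr η))))
          = MvPolynomial.X η := by simp [symbolProj, symbolGen]
      have h2 : wordNum (Sum.inl (Sum.inr (Sum.inr η)) :: l) = wordNum l := by
        simp [wordNum, letterNum]
      have h3 : wordExp (Sum.inl (Sum.inr (Sum.inr η)) :: l)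
          = Finsupp.single η 1 + wordExp l := by simp [wordExp, letterExp]
      rw [h1, h2, h3, mul_ite, mul_zero, MvPolynomial.X, MvPolynomial.monomial_mul, one_mul]
    · have h1 : symbolProj S H W (symLetter w H (Sum.inr o)) = 0 := by
        simp [symbolProj, symbolGen, extGen, ExteriorAlgebra.algebraMapInv, Algebra.ofId_apply]
      simp [wordNum, letterNum, h1]

lemma wordProd_symLetter_of_wordNum_eq_zero (w : S ⊕ S → W) (l : List (Letter S H))
    (hl : wordNum l = 0) :
    wordProd (symLetter w H) l
      = MvPolynomial.rename (Sum.inr ∘ Sum.inr) (MvPolynomial.monomial (wordExp l) (1 : ℂ)) ⊗ₜ 1 := by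
  induction l with
  | nil => simp [wordExp, Algebra.TensorProduct.one_def]
  | cons v l ih =>
    simp only [wordNum, List.map_cons, List.sum_cons, Nat.add_eq_zero_iff] at hl
    rw [wordProd_cons, ih hl.2]
    rcases v with (α | α | η) | o
    · simp [letterNum] at hl
    · simp [letterNum] at hl
    · have e : (MvPolynomial.monomial (wordExp (Sum.inl (Sum.inr (Sum.inr η)) :: l)) (1 : ℂ))
          = MvPolynomial.X η * MvPolynomial.monomial (wordExp l) 1 := by
        rw [MvPolynomial.X, MvPolynomial.monomial_mul, one_mul]
        simp [wordExp, letterExp]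
      rw [e, map_mul, MvPolynomial.rename_X]
      simp [symbolGen]
    · simp [letterNum] at hl

/-- The weight of a monomial in the letters `η`. -/
def expWt (wt : Letter S H → ℕ) : (H →₀ ℕ) →+ ℕ :=
  Finsupp.liftAddHom fun η => AddMonoidHom.mulRight (wt (Sum.inl (Sum.inr (Sum.inr η))))

lemma expWt_wordExp (wt : Letter S H → ℕ) (l : List (Letter S H)) (hl : wordNum l = 0) :
    expWt wt (wordExp l) = wordWt wt l := by
  induction l with
  | nil => simp [wordExp]
  | cons v l ih =>
    simp only [wordNum, List.map_cons, List.sum_cons, Nat.add_eq_zero_iff] at hl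
    rcases v with (α | α | η) | o
    · simp [letterNum] at hl
    · simp [letterNum] at hl
    · have : wordExp (Sum.inl (Sum.inr (Sum.inr η)) :: l)
          = Finsupp.single η 1 + wordExp l := by simp [wordExp, letterExp]
      rw [this, map_add, ih hl.2, wordWt_cons]
      simp [expWt]
    · simp [letterNum] at hl

lemma exists_wordExp_eq (b : H →₀ ℕ) : ∃ l : List (Letter S H), wordNum l = 0 ∧ wordExp l = b := by
  induction b using Finsupp.induction_linear with
  | zero => exact ⟨[], rfl, rfl⟩
  | add f g hf hg =>
    obtain ⟨l, h1, h2⟩ := hf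
    obtain ⟨l', h1', h2'⟩ := hg
    refine ⟨l ++ l', ?_, ?_⟩
    · simp only [wordNum, List.map_append, List.sum_append] at *; omega
    · simp only [wordExp, List.map_append, List.sum_append] at *; rw [h2, h2']
  | single η k =>
    refine ⟨List.replicate k (Sum.inl (Sum.inr (Sum.inr η))), ?_, ?_⟩
    · simp [wordNum, letterNum]
    · simp [wordExp, letterExp]

/-- The differential and the homotopy of a Koszul model have a triangular Laplacian. -/
theorem triangularLaplacian (K : KoszulModel gen q w wdual wt D G) :
    TriangularLaplacian D K.homotopy G
      (fun l => quantize gen q (wordProd (symLetter w H) l)) (wordWt wt) wordNum wordDeg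
      (fun b => quantize gen q
        (MvPolynomial.rename (Sum.inr ∘ Sum.inr) (MvPolynomial.monomial b (1 : ℂ)) ⊗ₜ 1))
      ((MvPolynomial.basisMonomials H ℂ).repr.toLinearMap ∘ₗ
        (symbolProj S H W).toLinearMap ∘ₗ K.quantizeEquiv.symm.toLinearMap)
      wordExp (expWt wt) := by
  have hexists : ∀ {k x}, x ∈ G k → ∃ n, x ∈ gradedFil
      (fun l => quantize gen q (wordProd (symLetter w H) l)) (wordWt wt) wordDeg n k := by
    intro k x hx
    obtain ⟨n, hn⟩ := exists_mem_symbolFil (H := H) K.span_eq wt (K.quantizeEquiv.symm x)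
    rw [← K.mem_wordFil_iff, K.wordFil_eq_span] at hn
    -- The filtration by weight ignores degree; the direct sum decomposition selects the words of
    -- degree `k`.
    exact ⟨n, mem_span_of_mem_of_isInternal K.internal K.quantize_wordProd_mem hx hn⟩
  have hh : ∀ {k x}, x ∈ G k → K.homotopy x ∈ G (k - 1) := by
    intro k x hx
    obtain ⟨n, hn⟩ := hexists hx
    refine (Submodule.span_le.2 ?_ : gradedFil _ _ _ n k ≤ (G (k - 1)).comap K.homotopy) hn
    rintro _ ⟨l, -, rfl, rfl⟩
    rw [SetLike.mem_coe, Submodule.mem_comap, homotopy_quantize, ← Submodule.mem_comap]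
    refine (Submodule.span_le.2 ?_ : Submodule.span ℂ _ ≤ _) (K.koszulH_wordProd_mem l)
    rintro _ ⟨l', -, h, rfl⟩
    rw [sub_eq_add_neg, ← h]
    exact K.quantize_wordProd_mem l'
  have hr : ∀ l : List (Letter S H), ((MvPolynomial.basisMonomials H ℂ).repr.toLinearMap ∘ₗ
        (symbolProj S H W).toLinearMap ∘ₗ K.quantizeEquiv.symm.toLinearMap)
        (quantize gen q (wordProd (symLetter w H) l))
      = (MvPolynomial.basisMonomials H ℂ).repr
          (if wordNum l = 0 then MvPolynomial.monomial (wordExp l) 1 else 0) := by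
    intro l
    rw [← symbolProj_wordProd w]
    have : K.quantizeEquiv.symm (quantize gen q (wordProd (symLetter w H) l))
        = wordProd (symLetter w H) l := K.quantizeEquiv.symm_apply_apply _
    simp [this]
  exact
    { D_sq := K.D_sq
      D_mem := K.D_mem
      h_mem := hh
      vec_mem := K.quantize_wordProd_mem
      exists_mem := hexists
      laplacian := fun l => by
        have h1 := K.laplacian_sub_mem l
        rw [K.wordFil_eq_span] at h1
        refine mem_span_of_mem_of_isInternal K.internal K.quantize_wordProd_mem ?_ h1
        have h2 := K.quantize_wordProd_mem l
        refine sub_mem (add_mem ?_ ?_) (Submodule.smul_mem _ _ h2)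
        · simpa using K.D_mem (hh h2)
        · simpa using hh (K.D_mem h2)
      num_le := fun l => List.sum_le_sum fun v _ => K.num_le v
      dg_eq := fun l hl => by
        induction l with
        | nil => rfl
        | cons v l ih =>
          simp only [wordNum, List.map_cons, List.sum_cons, Nat.add_eq_zero_iff] at hl
          have := ih hl.2
          simp only [wordDeg, List.map_cons, List.sum_cons] at this ⊢
          rw [this]
          rcases v with v | o
          · simp [letterDeg]
          · simp [letterNum] at hl
      vec_eq := fun l hl => by
        simp only [wordProd_symLetter_of_wordNum_eq_zero w l hl]
      wt_eq := fun l hl => expWt_wordExp wt l hl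
      exists_index := exists_wordExp_eq
      r_vec := fun l hl => by
        rw [hr, if_pos hl]
        have := (MvPolynomial.basisMonomials H ℂ).repr_self (wordExp l)
        rwa [MvPolynomial.coe_basisMonomials] at this
      r_vec_of_ne := fun l hl => by
        rw [hr, if_neg hl, map_zero] }

end KoszulModel

end KoszulModel

end

end FiniteW

namespace FiniteW

noncomputable section

set_option linter.unusedSectionVars false

/-! ### Gradings, the invariant form, and adapted bases -/

section Grading

variable {g : Type*} [LieRing g] [LieAlgebra ℂ g]

/-- The elements of degree `k`. -/
def degSub (δ : g) (k : ℤ) : Submodule ℂ g :=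
  Module.End.eigenspace (LieAlgebra.ad ℂ g δ) (k : ℂ)

lemma mem_degSub {δ : g} {k : ℤ} {x : g} : x ∈ degSub δ k ↔ ⁅δ, x⁆ = (k : ℂ) • x := by
  rw [degSub, Module.End.mem_eigenspace_iff, LieAlgebra.ad_apply]

lemma lie_mem_degSub {δ : g} {j k : ℤ} {x y : g} (hx : x ∈ degSub δ j) (hy : y ∈ degSub δ k) :
    ⁅x, y⁆ ∈ degSub δ (j + k) := by
  rw [mem_degSub] at *
  rw [leibniz_lie, hx, hy, smul_lie, lie_smul, ← add_smul]
  push_cast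
  rfl

variable {δ : g} {I : Type*}

lemma HomogeneousBasis.basis_mem (t : HomogeneousBasis δ I) (a : I) :
    t.basis a ∈ degSub δ (t.deg a) :=
  mem_degSub.2 (t.lie_basis a)

variable [Fintype I] [DecidableEq I]

lemma HomogeneousBasis.repr_lie (t : HomogeneousBasis δ I) (x : g) (a : I) :
    t.basis.repr ⁅δ, x⁆ a = t.deg a * t.basis.repr x a := by
  have : (t.basis.coord a) ∘ₗ (LieAlgebra.ad ℂ g δ : g →ₗ[ℂ] g)
      = (t.deg a : ℂ) • t.basis.coord a := by
    refine t.basis.ext fun b => ?_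
    simp only [LinearMap.comp_apply, LieAlgebra.ad_apply, t.lie_basis, map_smul,
      LinearMap.smul_apply, Module.Basis.coord_apply, Module.Basis.repr_self,
      Finsupp.single_apply, smul_eq_mul]
    split_ifs with h <;> simp [h]
  exact DFunLike.congr_fun this x

lemma HomogeneousBasis.repr_eq_zero (t : HomogeneousBasis δ I) {k : ℤ} {x : g}
    (hx : x ∈ degSub δ k) {a : I} (ha : t.deg a ≠ k) : t.basis.repr x a = 0 := by
  have h := t.repr_lie x a
  rw [mem_degSub.1 hx, map_smul, Finsupp.smul_apply, smul_eq_mul, ← sub_eq_zero, ← sub_mul,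
    mul_eq_zero, sub_eq_zero] at h
  exact h.resolve_left fun h => ha (by exact_mod_cast h.symm)

/-- The component of degree `k`. -/
def HomogeneousBasis.component (t : HomogeneousBasis δ I) (k : ℤ) : g →ₗ[ℂ] g :=
  t.basis.constr ℂ fun a => if t.deg a = k then t.basis a else 0

lemma HomogeneousBasis.component_basis (t : HomogeneousBasis δ I) (k : ℤ) (a : I) :
    t.component k (t.basis a) = if t.deg a = k then t.basis a else 0 :=
  t.basis.constr_basis ℂ _ a

lemma HomogeneousBasis.component_mem (t : HomogeneousBasis δ I) (k : ℤ) (x : g) :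
    t.component k x ∈ degSub δ k := by
  refine map_mem_of_basis t.basis (t.component k) _ (fun a => ?_) x
  rw [t.component_basis]
  split_ifs with h
  · exact h ▸ t.basis_mem a
  · exact zero_mem _

lemma HomogeneousBasis.component_of_mem (t : HomogeneousBasis δ I) {j : ℤ} {x : g}
    (hx : x ∈ degSub δ j) (k : ℤ) : t.component k x = if j = k then x else 0 := by
  conv_lhs => rw [← t.basis.sum_repr x]
  rw [map_sum]
  simp only [map_smul, t.component_basis]
  by_cases h : j = k
  · rw [if_pos h]
    conv_rhs => rw [← t.basis.sum_repr x]
    refine Finset.sum_congr rfl fun a _ => ?_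
    by_cases ha : t.deg a = k
    · rw [if_pos ha]
    · rw [t.repr_eq_zero hx (h ▸ ha), zero_smul, zero_smul]
  · rw [if_neg h]
    refine Finset.sum_eq_zero fun a _ => ?_
    by_cases ha : t.deg a = k
    · rw [t.repr_eq_zero hx (fun h' => h (h'.symm.trans ha)), zero_smul]
    · rw [if_neg ha, smul_zero]

lemma HomogeneousBasis.sum_component (t : HomogeneousBasis δ I) (x : g) :
    ∑ k ∈ Finset.univ.image t.deg, t.component k x = x := by
  have : ∑ k ∈ Finset.univ.image t.deg, t.component k = LinearMap.id := by
    refine t.basis.ext fun a => ?_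
    rw [LinearMap.sum_apply]
    simp only [t.component_basis]
    rw [Finset.sum_ite_eq, if_pos (Finset.mem_image_of_mem _ (Finset.mem_univ a))]
    rfl
  rw [← LinearMap.sum_apply, this, LinearMap.id_apply]

lemma HomogeneousBasis.lie_component (t : HomogeneousBasis δ I) {e : g} {j : ℤ}
    (he : e ∈ degSub δ j) (k : ℤ) (x : g) :
    ⁅e, t.component k x⁆ = t.component (j + k) ⁅e, x⁆ := by
  have : (LieAlgebra.ad ℂ g e : g →ₗ[ℂ] g) ∘ₗ t.component k
      = t.component (j + k) ∘ₗ (LieAlgebra.ad ℂ g e : g →ₗ[ℂ] g) := by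
    refine t.basis.ext fun a => ?_
    simp only [LinearMap.comp_apply, LieAlgebra.ad_apply, t.component_basis]
    rw [t.component_of_mem (lie_mem_degSub he (t.basis_mem a))]
    by_cases h : t.deg a = k
    · rw [if_pos h, if_pos (by omega)]
    · rw [if_neg h, if_neg (by omega), lie_zero]
  exact DFunLike.congr_fun this x

/-! ### Duality under the invariant form and adapted bases. -/

section Form

variable (K : LinearMap.BilinForm ℂ g) (hK : K.Nondegenerate) (hsymm : K.IsSymm)
  (hinv : ∀ x y z : g, K ⁅x, y⁆ z = K x ⁅y, z⁆)

include hinv in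
lemma form_lie_left (x y z : g) : K ⁅x, y⁆ z = -K y ⁅x, z⁆ := by
  rw [← lie_skew, map_neg, LinearMap.neg_apply, hinv]

include hinv in
-- Invariance under `ad δ` gives `(j + k) K x y = 0`.
lemma form_eq_zero {j k : ℤ} (h : j + k ≠ 0) {x y : g} (hx : x ∈ degSub δ j)
    (hy : y ∈ degSub δ k) : K x y = 0 := by
  have h1 := form_lie_left K hinv δ x y
  rw [mem_degSub.1 hx, mem_degSub.1 hy, map_smul, LinearMap.smul_apply, map_smul, smul_eq_mul,
    smul_eq_mul, ← sub_eq_zero, sub_neg_eq_add, ← add_mul, mul_eq_zero] at h1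
  exact h1.resolve_left (by exact_mod_cast h)

lemma form_upper_basis (t : HomogeneousBasis δ I) (a b : I) :
    K (upper K hK t a) (t.basis b) = if b = a then 1 else 0 :=
  LinearMap.BilinForm.apply_dualBasis_left hK t.basis a b

include hinv in
lemma upper_mem (t : HomogeneousBasis δ I) (a : I) : upper K hK t a ∈ degSub δ (-t.deg a) := by
  rw [mem_degSub]
  refine LinearMap.ker_eq_bot.1 hK.ker_eq_bot (t.basis.ext fun b => ?_)
  rw [form_lie_left K hinv, t.lie_basis, map_smul, map_smul, LinearMap.smul_apply,
    form_upper_basis]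
  split_ifs with h <;> simp [h]

lemma sum_form_basis_smul_upper (t : HomogeneousBasis δ I) (x : g) :
    ∑ a, K x (t.basis a) • upper K hK t a = x := by
  conv_rhs => rw [← (upper K hK t).sum_repr x]
  exact Finset.sum_congr rfl fun a _ => by
    rw [upper, LinearMap.BilinForm.dualBasis_repr_apply]

lemma repr_eq_form_upper (t : HomogeneousBasis δ I) (x : g) (a : I) :
    t.basis.repr x a = K (upper K hK t a) x := by
  have : t.basis.coord a = K (upper K hK t a) := by
    refine t.basis.ext fun b => ?_
    rw [form_upper_basis, Module.Basis.coord_apply, Module.Basis.repr_self, Finsupp.single_apply]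
  exact DFunLike.congr_fun this x

lemma sum_form_upper_smul_basis (t : HomogeneousBasis δ I) (x : g) :
    ∑ a, K (upper K hK t a) x • t.basis a = x := by
  conv_rhs => rw [← t.basis.sum_repr x]
  exact Finset.sum_congr rfl fun a _ => by rw [repr_eq_form_upper K hK]

include hK hinv in
/-- If `ad e` is injective in negative degrees then it is surjective onto positive degrees. -/
lemma exists_lie_eq_basis [FiniteDimensional ℂ g] (t : HomogeneousBasis δ I) {e : g} (he : e ∈ degSub δ 1)
    (hinj : ∀ k : ℤ, k < 0 → ∀ x ∈ degSub δ k, ⁅e, x⁆ = 0 → x = 0) (α : t.Pos) :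
    ∃ y ∈ degSub δ (t.deg α - 1), ⁅y, e⁆ = t.basis α := by
  set m := t.deg α
  set R : Submodule ℂ g := (degSub δ (m - 1)).map (LieAlgebra.ad ℂ g e : g →ₗ[ℂ] g)
  suffices h : t.basis α ∈ R by
    obtain ⟨y, hy, h⟩ := h
    refine ⟨-y, neg_mem hy, ?_⟩
    rw [neg_lie, lie_skew]
    exact h
  by_contra hα
  -- A functional that vanishes on the image of `ad e` but not on `t_α` is represented through `K`
  -- by some `z`. Only the component `z'` of degree `-m` is seen on degree `m`.
  obtain ⟨f, hf, hfR⟩ := Submodule.exists_dual_map_eq_bot_of_notMem hα inferInstance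
  obtain ⟨z, hz⟩ : ∃ z, K z = f := ⟨(K.toDual hK).symm f, by
    ext x; exact LinearMap.BilinForm.apply_toDual_symm_apply f x⟩
  set z' := t.component (-m) z with hz'
  have hzz : ∀ x ∈ degSub δ m, K z' x = K z x := by
    intro x hx
    have : (K.flip x) ∘ₗ t.component (-m) = K.flip x := by
      refine t.basis.ext fun b => ?_
      rw [LinearMap.comp_apply, t.component_basis]
      split_ifs with h
      · rfl
      · rw [map_zero]
        exact (form_eq_zero K hinv (by omega) (t.basis_mem b) hx).symm
    exact DFunLike.congr_fun this z
  have hzm : z' ∈ degSub δ (-m) := t.component_mem _ _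
  -- By invariance `K([e, z'], x) = -K(z', [e, x])`, and this vanishes because `f` kills the image.
  -- So `[e, z'] = 0`, and injectivity in negative degree applies.
  have hz0 : z' = 0 := by
    refine hinj (-m) (by have := α.2; omega) z' hzm ?_
    refine LinearMap.ker_eq_bot.1 hK.ker_eq_bot (t.basis.ext fun b => ?_)
    rw [map_zero, LinearMap.zero_apply]
    by_cases hb : t.deg b = m - 1
    · have hmem : ⁅e, t.basis b⁆ ∈ degSub δ m := by
        have := lie_mem_degSub he (t.basis_mem b)
        rwa [hb, add_sub_cancel] at this
      rw [form_lie_left K hinv, hzz _ hmem, hz, neg_eq_zero]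
      have : f ⁅e, t.basis b⁆ ∈ R.map f :=
        Submodule.mem_map_of_mem ⟨t.basis b, hb ▸ t.basis_mem b, rfl⟩
      rwa [hfR, Submodule.mem_bot] at this
    · exact form_eq_zero K hinv (by omega) (lie_mem_degSub he hzm) (t.basis_mem b)
  apply hf
  rw [← hz, ← hzz _ (t.basis_mem α), hz0, map_zero, LinearMap.zero_apply]

/-- The centralizer of a homogeneous element has a homogeneous basis. -/
lemma exists_homogeneous_basis_ker [FiniteDimensional ℂ g] (t : HomogeneousBasis δ I) {e : g}
    {j : ℤ} (he : e ∈ degSub δ j) :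
    ∃ b : Module.Basis (Fin (Module.finrank ℂ (LinearMap.ker (LieAlgebra.ad ℂ g e : g →ₗ[ℂ] g)))) ℂ
        (LinearMap.ker (LieAlgebra.ad ℂ g e : g →ₗ[ℂ] g)),
      ∀ a, ∃ k : ℤ, (b a : g) ∈ degSub δ k := by
  set Z := LinearMap.ker (LieAlgebra.ad ℂ g e : g →ₗ[ℂ] g)
  have hspan : ⊤ ≤ Submodule.span ℂ {z : Z | ∃ k : ℤ, (z : g) ∈ degSub δ k} := by
    rintro ⟨x, hx⟩ -
    have hc : ∀ k, t.component k x ∈ Z := fun k => by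
      change ⁅e, x⁆ = 0 at hx
      change ⁅e, t.component k x⁆ = 0
      rw [t.lie_component he, hx, map_zero]
    have : (⟨x, hx⟩ : Z) = ∑ k ∈ Finset.univ.image t.deg, ⟨t.component k x, hc k⟩ := by
      refine Subtype.ext ?_
      rw [AddSubmonoidClass.coe_finsetSum]
      exact (t.sum_component x).symm
    rw [this]
    exact sum_mem fun k _ => Submodule.subset_span ⟨k, t.component_mem k x⟩
  let b := Module.Basis.ofSpan hspan
  let _ := Module.Basis.fintypeIndexOfRankLtAleph0 b (Module.rank_lt_aleph0 ℂ Z)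
  have hcard := Module.finrank_eq_card_basis b
  refine ⟨b.reindex (Fintype.equivFinOfCardEq hcard.symm), fun a => ?_⟩
  rw [Module.Basis.reindex_apply]
  exact Module.Basis.ofSpan_subset hspan ⟨_, rfl⟩

include hsymm hinv in
/-- A basis of `g` made of the `t^α` spanning the negative part, elements that `ad e` maps to the
basis vectors of the positive part, and a homogeneous basis of the centralizer of `e`. -/
lemma exists_adapted_basis [FiniteDimensional ℂ g] (t : HomogeneousBasis δ I) {e : g}
    (he : e ∈ degSub δ 1)
    (hinj : ∀ k : ℤ, k < 0 → ∀ x ∈ degSub δ k, ⁅e, x⁆ = 0 → x = 0) :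
    ∃ (b : HomogeneousBasis δ (t.Pos ⊕ t.Pos ⊕
        Fin (Module.finrank ℂ (LinearMap.ker (LieAlgebra.ad ℂ g e : g →ₗ[ℂ] g))))),
      (∀ α, b.basis (Sum.inl α) = upper K hK t α ∧ b.deg (Sum.inl α) = -t.deg α) ∧
      (∀ α, ⁅b.basis (Sum.inr (Sum.inl α)), e⁆ = t.basis α ∧
        b.deg (Sum.inr (Sum.inl α)) = t.deg α - 1) ∧
      (∀ η, ⁅b.basis (Sum.inr (Sum.inr η)), e⁆ = 0 ∧ 0 ≤ b.deg (Sum.inr (Sum.inr η))) := by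
  choose y hy hye using exists_lie_eq_basis K hK hinv t he hinj
  obtain ⟨z, hz⟩ := exists_homogeneous_basis_ker t he
  choose k hk using hz
  have hz0 : ∀ η, ⁅(z η : g), e⁆ = 0 := fun η => by
    rw [← lie_skew, neg_eq_zero]; exact (z η).2
  have hk0 : ∀ η, 0 ≤ k η := by
    intro η
    by_contra hlt
    have h1 : (z η : g) = 0 := hinj (k η) (by omega) _ (hk η) (z η).2
    exact z.ne_zero η (Subtype.ext h1)
  set v : t.Pos ⊕ t.Pos ⊕
      Fin (Module.finrank ℂ (LinearMap.ker (LieAlgebra.ad ℂ g e : g →ₗ[ℂ] g))) → g :=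
    Sum.elim (fun α => upper K hK t α) (Sum.elim y fun η => z η) with hv
  have hu := upper_mem K hK hinv t
  have hform1 : ∀ α β : t.Pos, K (upper K hK t α) (t.basis β) = if β = α then 1 else 0 :=
    fun α β => by rw [form_upper_basis]; simp [Subtype.ext_iff]
  -- For `deg α > 0` the bracket of `t^α` with `e` has degree at most zero, while `t^β` pairs only
  -- with degree `deg β > 0`.
  have hform2 : ∀ (β : t.Pos) α, K (upper K hK t β) ⁅upper K hK t α, e⁆ = 0 ∨ t.deg α ≤ 0 := by
    intro β α
    by_cases h : t.deg α ≤ 0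
    · exact Or.inr h
    · refine Or.inl (form_eq_zero K hinv ?_ (hu β) (lie_mem_degSub (hu α) he))
      have := β.2
      omega
  -- Bracketing with `e` and pairing with `t^β` isolates the coefficient of `y β`. Pairing the rest
  -- with `t_β` isolates that of `t^β`, since the centralizer part has nonnegative degree and is
  -- orthogonal to `t_β`.
  have hli : LinearIndependent ℂ v := by
    rw [Fintype.linearIndependent_iff]
    intro c hc
    simp only [Fintype.sum_sum_type, hv, Sum.elim_inl, Sum.elim_inr] at hc
    have h1 : ∀ β, c (Sum.inr (Sum.inl β)) = 0 := by
      intro β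
      have := congrArg (fun x => K (upper K hK t β) ⁅x, e⁆) hc
      simp only [add_lie, sum_lie, smul_lie, hye, hz0, smul_zero, Finset.sum_const_zero, map_add,
        map_sum, map_smul, hform1, zero_lie, map_zero, add_zero, smul_eq_mul] at this
      rw [Finset.sum_eq_zero, zero_add, Finset.sum_eq_single β] at this
      · simpa using this
      · intro α _ hα; simp [hα]
      · simp
      · intro α _
        rcases hform2 β α with h | h
        · rw [h, mul_zero]
        · exact absurd α.2 (by omega)
    have h2 : ∀ β, c (Sum.inl β) = 0 := by
      intro β
      have := congrArg (fun x => K x (t.basis β)) hc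
      simp only [h1, zero_smul, Finset.sum_const_zero, zero_add, map_add, map_sum, map_smul,
        LinearMap.add_apply, LinearMap.sum_apply, LinearMap.smul_apply, hform1, map_zero,
        LinearMap.zero_apply, smul_eq_mul] at this
      rw [Finset.sum_eq_single β, Finset.sum_eq_zero, add_zero] at this
      · simpa using this
      · intro η _
        rw [form_eq_zero K hinv _ (hk η) (t.basis_mem β), mul_zero]
        have := hk0 η
        have := β.2
        omega
      · intro α _ hα; simp [hα.symm]
      · simp
    simp only [h1, h2, zero_smul, Finset.sum_const_zero, zero_add] at hc
    have h3 : ∑ η, c (Sum.inr (Sum.inr η)) • z η = 0 := Subtype.ext (by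
      rw [AddSubmonoidClass.coe_finsetSum]; simpa using hc)
    have h4 := Fintype.linearIndependent_iff.1 z.linearIndependent _ h3
    rintro (α | α | η)
    · exact h2 α
    · exact h1 α
    · exact h4 η
  -- Subtract from `x` its `y` part, read off from the positive part of `[x, e]`, and then its
  -- negative part. What remains is shown to centralize `e`.
  have hsp : ⊤ ≤ Submodule.span ℂ (Set.range v) := by
    intro x _
    have hvm : ∀ s, v s ∈ Submodule.span ℂ (Set.range v) := fun s => Submodule.subset_span ⟨s, rfl⟩
    set x₁ := x - ∑ β : t.Pos, K (upper K hK t β) ⁅x, e⁆ • y β with hx₁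
    set x₂ := x₁ - ∑ β : t.Pos, K x₁ (t.basis β) • upper K hK t β with hx₂
    have hx₁e : ∀ β : t.Pos, K (upper K hK t β) ⁅x₁, e⁆ = 0 := by
      intro β
      rw [hx₁, sub_lie, sum_lie]
      simp only [smul_lie, hye, map_sub, map_sum, map_smul, hform1, smul_eq_mul]
      rw [Finset.sum_eq_single β]
      · simp
      · intro α _ hα; simp [hα]
      · simp
    have hx₂b : ∀ a, 0 < t.deg a → K x₂ (t.basis a) = 0 := by
      intro a ha
      rw [hx₂]
      simp only [map_sub, map_sum, map_smul, LinearMap.sub_apply, LinearMap.sum_apply,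
        LinearMap.smul_apply, smul_eq_mul]
      rw [Finset.sum_eq_single ⟨a, ha⟩]
      · simp [form_upper_basis]
      · intro β _ hβ
        rw [form_upper_basis, if_neg (fun h => hβ (Subtype.ext h.symm)), mul_zero]
      · simp
    -- The positive components vanish by the choice of `x₁`. After the second subtraction `x₂` lives
    -- in degrees at least zero, so `[x₂, e]` lives in degrees at least one and has no other
    -- components.
    have hx₂e : ⁅x₂, e⁆ = 0 := by
      rw [← sum_form_upper_smul_basis K hK t ⁅x₂, e⁆]
      refine Finset.sum_eq_zero fun a _ => ?_
      suffices h : K (upper K hK t a) ⁅x₂, e⁆ = 0 by rw [h, zero_smul]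
      by_cases ha : 0 < t.deg a
      · rw [hx₂, sub_lie, map_sub, hx₁e ⟨a, ha⟩, zero_sub, sum_lie, map_sum, neg_eq_zero]
        refine Finset.sum_eq_zero fun β _ => ?_
        rw [smul_lie, map_smul]
        rcases hform2 ⟨a, ha⟩ β with h | h
        · rw [h, smul_zero]
        · exact absurd β.2 (by omega)
      · rw [← sum_form_basis_smul_upper K hK t x₂, sum_lie, map_sum]
        refine Finset.sum_eq_zero fun c _ => ?_
        rw [smul_lie, map_smul]
        by_cases hc : 0 < t.deg c
        · rw [hx₂b c hc, zero_smul]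
        · rw [form_eq_zero K hinv _ (hu a) (lie_mem_degSub (hu c) he), smul_zero]
          omega
    have hx₂s : x₂ ∈ Submodule.span ℂ (Set.range v) := by
      have hm : x₂ ∈ LinearMap.ker (LieAlgebra.ad ℂ g e : g →ₗ[ℂ] g) := by
        change ⁅e, x₂⁆ = 0
        rw [← lie_skew, hx₂e, neg_zero]
      have h := congrArg (Subtype.val) (z.sum_repr ⟨x₂, hm⟩)
      rw [AddSubmonoidClass.coe_finsetSum] at h
      rw [← show _ = x₂ from h]
      exact sum_mem fun η _ => Submodule.smul_mem _ _ (hvm (Sum.inr (Sum.inr η)))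
    have e2 : x = x₂ + ∑ β : t.Pos, K x₁ (t.basis β) • upper K hK t β
        + ∑ β : t.Pos, K (upper K hK t β) ⁅x, e⁆ • y β := by
      rw [hx₂, sub_add_cancel, hx₁, sub_add_cancel]
    rw [e2]
    exact add_mem (add_mem hx₂s (sum_mem fun β _ => Submodule.smul_mem _ _ (hvm (Sum.inl β))))
      (sum_mem fun β _ => Submodule.smul_mem _ _ (hvm (Sum.inr (Sum.inl β))))
  refine ⟨⟨Module.Basis.mk hli hsp,
    Sum.elim (fun α => -t.deg α) (Sum.elim (fun α => t.deg α - 1) k), ?_⟩, ?_, ?_, ?_⟩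
  · intro s
    rw [Module.Basis.mk_apply]
    rcases s with α | α | η
    · exact mem_degSub.1 (hu α)
    · exact mem_degSub.1 (hy α)
    · exact mem_degSub.1 (hk η)
  · intro α
    simp [hv]
  · intro α
    simp [hv, hye]
  · intro η
    simp [hv, hz0, hk0]

include hK hsymm hinv in
-- Counts the adapted basis: each positive index contributes one lowering vector and one `y`.
lemma finrank_ker_add [FiniteDimensional ℂ g] (t : HomogeneousBasis δ I) {e : g}
    (he : e ∈ degSub δ 1)
    (hinj : ∀ k : ℤ, k < 0 → ∀ x ∈ degSub δ k, ⁅e, x⁆ = 0 → x = 0) :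
    Fintype.card t.Pos + (Fintype.card t.Pos
      + Module.finrank ℂ (LinearMap.ker (LieAlgebra.ad ℂ g e : g →ₗ[ℂ] g)))
      = Module.finrank ℂ g := by
  obtain ⟨b, -⟩ := exists_adapted_basis K hK hsymm hinv t he hinj
  rw [Module.finrank_eq_card_basis b.basis]
  simp

include hK hsymm hinv in
/-- The centralizers of the raising and of the lowering element have the same dimension. -/
lemma finrank_ker_eq [FiniteDimensional ℂ g] (t : HomogeneousBasis δ I) {e f : g}
    (he : e ∈ degSub δ 1) (hf : f ∈ degSub δ (-1))
    (hinj : ∀ k : ℤ, k < 0 → ∀ x ∈ degSub δ k, ⁅e, x⁆ = 0 → x = 0)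
    (hinj' : ∀ k : ℤ, 0 < k → ∀ x ∈ degSub δ k, ⁅f, x⁆ = 0 → x = 0) :
    Module.finrank ℂ (LinearMap.ker (LieAlgebra.ad ℂ g e : g →ₗ[ℂ] g))
      = Module.finrank ℂ (LinearMap.ker (LieAlgebra.ad ℂ g f : g →ₗ[ℂ] g)) := by
  have hneg : ∀ k x, x ∈ degSub (-δ) k ↔ x ∈ degSub δ (-k) := by
    intro k x
    rw [mem_degSub, mem_degSub, neg_lie, neg_eq_iff_eq_neg]
    push_cast
    rw [neg_smul]
  -- For `-δ` the element `f` has degree one. The dual basis, with the same degree function, is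
  -- homogeneous for `-δ`, so the count for `f` involves the same set of positive indices.
  let t' : HomogeneousBasis (-δ) I := ⟨upper K hK t, t.deg, fun a =>
    mem_degSub.1 ((hneg _ _).2 (upper_mem K hK hinv t a))⟩
  have h1 := finrank_ker_add K hK hsymm hinv t he hinj
  have h2 := finrank_ker_add K hK hsymm hinv t' (e := f) ((hneg _ _).2 hf)
    (fun k hk x hx => hinj' (-k) (by omega) x ((hneg _ _).1 hx))
  have h3 : Fintype.card t.Pos = Fintype.card t'.Pos := rfl
  omega

end Form

end Grading

end

end FiniteW

namespace FiniteW

noncomputable section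

/-! ### Grading elements are good -/

section Good

variable {g : Type*} [LieRing g] [LieAlgebra ℂ g]

/-- `t₊` and `t₋` have degrees `1` and `-1`, and their adjoint actions are injective in negative
and positive degrees respectively. -/
structure IsGoodGrading (i : Sl2Embedding g) (δ : g) : Prop where
  plus_mem : i.tplus ∈ degSub δ 1
  minus_mem : i.tminus ∈ degSub δ (-1)
  plus_injective : ∀ k : ℤ, k < 0 → ∀ x ∈ degSub δ k, ⁅i.tplus, x⁆ = 0 → x = 0
  minus_injective : ∀ k : ℤ, 0 < k → ∀ x ∈ degSub δ k, ⁅i.tminus, x⁆ = 0 → x = 0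

/-- A vector killed by `t₊` is primitive for the triple with `h = 2 t₀`, and weights of primitive
vectors are natural numbers; the opposite triple handles `t₋`. The case `t₀ = 0` is separate because
an `sl₂` triple requires `h ≠ 0`. -/
lemma isGoodGrading_tzero [FiniteDimensional ℂ g] (i : Sl2Embedding g) :
    IsGoodGrading i i.tzero := by
  by_cases h0 : i.tzero = 0
  · refine ⟨mem_degSub.2 (by simp [i.lie_zero_plus]), mem_degSub.2 (by simp [i.lie_zero_minus]),
      fun k hk x hx _ => ?_, fun k hk x hx _ => ?_⟩ <;>
    · rw [mem_degSub, h0, zero_lie, eq_comm, smul_eq_zero] at hx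
      exact hx.resolve_left (by exact_mod_cast (by omega : k ≠ 0))
  have ht : IsSl2Triple ((2 : ℂ) • i.tzero) i.tplus i.tminus :=
    { h_ne_zero := by simpa using h0
      lie_e_f := i.lie_plus_minus
      lie_h_e_nsmul := by rw [smul_lie, i.lie_zero_plus, two_smul, two_nsmul]
      lie_h_f_nsmul := by rw [smul_lie, i.lie_zero_minus, two_smul, two_nsmul, neg_add] }
  refine ⟨mem_degSub.2 (by simp [i.lie_zero_plus]), mem_degSub.2 (by simp [i.lie_zero_minus]),
    fun k hk x hx hx0 => ?_, fun k hk x hx hx0 => ?_⟩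
  · by_contra hne
    have hP : ht.HasPrimitiveVectorWith x (2 * k : ℂ) :=
      ⟨hne, by rw [smul_lie, mem_degSub.1 hx, smul_smul], hx0⟩
    obtain ⟨n, hn⟩ := hP.exists_nat
    have : 2 * k = n := by exact_mod_cast hn
    omega
  · by_contra hne
    have hP : ht.symm.HasPrimitiveVectorWith x (-(2 * k) : ℂ) :=
      ⟨hne, by rw [neg_lie, smul_lie, mem_degSub.1 hx, smul_smul, neg_smul], hx0⟩
    obtain ⟨n, hn⟩ := hP.exists_nat
    have : -(2 * k) = n := by exact_mod_cast hn
    omega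

variable {r : ℕ} {p : Fin r → ℕ}

/-- A matrix of degree `k` for `stdDelta` is supported on the entries that raise the column
number by `k`. -/
lemma apply_eq_zero_of_lie_stdDelta {X : Matrix (Box p) (Box p) ℂ} {k : ℤ}
    (hX : stdDelta p * X - X * stdDelta p = (k : ℂ) • X) {x y : Box p}
    (hxy : ((y.2 : ℕ) : ℤ) - ((x.2 : ℕ) : ℤ) ≠ k) : X x y = 0 := by
  have h := congrFun (congrFun hX x) y
  rw [Matrix.sub_apply, stdDelta, Matrix.diagonal_mul, Matrix.mul_diagonal, Matrix.smul_apply,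
    smul_eq_mul] at h
  have h2 : (((((y.2 : ℕ) : ℤ) - ((x.2 : ℕ) : ℤ) - k : ℤ)) : ℂ) * X x y = 0 := by
    push_cast
    linear_combination h
  rw [mul_eq_zero] at h2
  exact h2.resolve_left (Int.cast_ne_zero.2 (sub_ne_zero.2 hxy))

lemma lie_stdDelta_stdPlus :
    stdDelta p * stdPlus p - stdPlus p * stdDelta p = ((1 : ℤ) : ℂ) • stdPlus p := by
  ext x y
  rw [Matrix.sub_apply, stdDelta, Matrix.diagonal_mul, Matrix.mul_diagonal, Matrix.smul_apply,
    smul_eq_mul, stdPlus, Matrix.of_apply]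
  split_ifs with h
  · rw [h.2]; push_cast; ring
  · simp

lemma lie_stdDelta_stdMinus :
    stdDelta p * stdMinus p - stdMinus p * stdDelta p = ((-1 : ℤ) : ℂ) • stdMinus p := by
  ext x y
  rw [Matrix.sub_apply, stdDelta, Matrix.diagonal_mul, Matrix.mul_diagonal, Matrix.smul_apply,
    smul_eq_mul, stdMinus, Matrix.of_apply]
  split_ifs with h
  · rw [h.2]; push_cast; ring
  · simp

/-- The box to the left. -/
def boxPred (x : Box p) : Box p := ⟨x.1, ⟨x.2 - 1, by have := x.2.2; omega⟩⟩

lemma box_ext {x y : Box p} (h1 : x.1 = y.1) (h2 : (x.2 : ℕ) = y.2) : x = y := by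
  obtain ⟨l, k⟩ := x
  obtain ⟨l', k'⟩ := y
  obtain rfl : l = l' := h1
  exact congrArg _ (Fin.ext h2)

lemma stdPlus_mul_apply (X : Matrix (Box p) (Box p) ℂ) (x y : Box p) (hx : 0 < (x.2 : ℕ)) :
    (stdPlus p * X) (boxPred x) y = X x y := by
  rw [Matrix.mul_apply, Finset.sum_eq_single x]
  · rw [stdPlus, Matrix.of_apply, if_pos, one_mul]
    exact ⟨rfl, by simp only [boxPred]; omega⟩
  · intro z _ hz
    rw [stdPlus, Matrix.of_apply, if_neg, zero_mul]
    rintro ⟨h1, h2⟩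
    exact hz (box_ext h1.symm (by simp only [boxPred] at h2; omega))
  · simp

lemma mul_stdPlus_apply (X : Matrix (Box p) (Box p) ℂ) (x y : Box p) :
    (X * stdPlus p) x y = if 0 < (y.2 : ℕ) then X x (boxPred y) else 0 := by
  rw [Matrix.mul_apply]
  split_ifs with hy
  · rw [Finset.sum_eq_single (boxPred y)]
    · rw [stdPlus, Matrix.of_apply, if_pos, mul_one]
      exact ⟨rfl, by simp only [boxPred]; omega⟩
    · intro z _ hz
      rw [stdPlus, Matrix.of_apply, if_neg, mul_zero]
      rintro ⟨h1, h2⟩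
      exact hz (box_ext h1 (by simp only [boxPred]; omega))
    · simp
  · refine Finset.sum_eq_zero fun z _ => ?_
    rw [stdPlus, Matrix.of_apply, if_neg, mul_zero]
    rintro ⟨-, h2⟩
    omega

/-- The constant is `k (p_l - k)` with `1 ≤ k < p_l`, the entry of `t₋` from the box left of `y` to
`y`, hence nonzero. -/
lemma mul_stdMinus_apply (X : Matrix (Box p) (Box p) ℂ) (x y : Box p) (hy : 0 < (y.2 : ℕ)) :
    ∃ c : ℂ, c ≠ 0 ∧ (X * stdMinus p) x (boxPred y) = X x y * c := by
  refine ⟨stdMinus p y (boxPred y), ?_, ?_⟩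
  · have h : y.1 = (boxPred y).1 ∧ (y.2 : ℕ) = (boxPred y).2 + 1 :=
      ⟨rfl, by simp only [boxPred]; omega⟩
    rw [stdMinus, Matrix.of_apply, if_pos h]
    have h2 := y.2.2
    have h3 : (((boxPred y).2 : ℕ) : ℂ) + 1 = ((y.2 : ℕ) : ℂ) := by exact_mod_cast h.2.symm
    rw [h3]
    refine mul_ne_zero (by exact_mod_cast hy.ne') (sub_ne_zero.2 ?_)
    exact_mod_cast (show p y.1 ≠ y.2 by omega)
  · rw [Matrix.mul_apply, Finset.sum_eq_single y]
    · intro z _ hz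
      rw [stdMinus, Matrix.of_apply, if_neg, mul_zero]
      rintro ⟨h1, h2⟩
      exact hz (box_ext h1 (by simp only [boxPred] at h2; omega))
    · simp

lemma stdMinus_mul_apply (X : Matrix (Box p) (Box p) ℂ) (x y : Box p)
    (h : (x.2 : ℕ) = 0 ∨ X (boxPred x) y = 0) : (stdMinus p * X) x y = 0 := by
  rw [Matrix.mul_apply]
  refine Finset.sum_eq_zero fun z _ => ?_
  by_cases hz : x.1 = z.1 ∧ (x.2 : ℕ) = z.2 + 1
  · have : z = boxPred x := box_ext hz.1.symm (by simp only [boxPred]; omega)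
    rcases h with h | h
    · omega
    · rw [this, h, mul_zero]
  · rw [stdMinus, Matrix.of_apply, if_neg hz, zero_mul]

/-- Commuting with `t₊` carries the entry at `(x, y)` to the entry one column to the left in both
indices. Since `k < 0`, the column of `x` exceeds that of `y`, so `y` reaches the first column first
and the entry is zero. -/
lemma eq_zero_of_commute_stdPlus {X : Matrix (Box p) (Box p) ℂ} {k : ℤ} (hk : k < 0)
    (hX : stdDelta p * X - X * stdDelta p = (k : ℂ) • X)
    (hc : stdPlus p * X = X * stdPlus p) : X = 0 := by
  have key : ∀ (n : ℕ) (x y : Box p), (y.2 : ℕ) = n → X x y = 0 := by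
    intro n
    induction n with
    | zero =>
      intro x y hy
      by_cases hxy : ((y.2 : ℕ) : ℤ) - ((x.2 : ℕ) : ℤ) = k
      · rw [← stdPlus_mul_apply X x y (by omega), hc, mul_stdPlus_apply, if_neg (by omega)]
      · exact apply_eq_zero_of_lie_stdDelta hX hxy
    | succ n ih =>
      intro x y hy
      by_cases hxy : ((y.2 : ℕ) : ℤ) - ((x.2 : ℕ) : ℤ) = k
      · rw [← stdPlus_mul_apply X x y (by omega), hc, mul_stdPlus_apply, if_pos (by omega)]
        exact ih _ _ (by simp only [boxPred]; omega)
      · exact apply_eq_zero_of_lie_stdDelta hX hxy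
  ext x y
  exact key _ x y rfl

/-- The mirror argument: for `k > 0` the column of `y` exceeds that of `x`, so the shift to the left
ends with `x` in the first column, up to nonzero factors. -/
lemma eq_zero_of_commute_stdMinus {X : Matrix (Box p) (Box p) ℂ} {k : ℤ} (hk : 0 < k)
    (hX : stdDelta p * X - X * stdDelta p = (k : ℂ) • X)
    (hc : stdMinus p * X = X * stdMinus p) : X = 0 := by
  have key : ∀ (n : ℕ) (x y : Box p), (x.2 : ℕ) = n → X x y = 0 := by
    intro n
    induction n with
    | zero =>
      intro x y hx
      by_cases hxy : ((y.2 : ℕ) : ℤ) - ((x.2 : ℕ) : ℤ) = k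
      · obtain ⟨c, hc0, h⟩ := mul_stdMinus_apply X x y (by omega)
        rw [← hc, stdMinus_mul_apply X x _ (Or.inl hx), eq_comm, mul_eq_zero] at h
        exact h.resolve_right hc0
      · exact apply_eq_zero_of_lie_stdDelta hX hxy
    | succ n ih =>
      intro x y hx
      by_cases hxy : ((y.2 : ℕ) : ℤ) - ((x.2 : ℕ) : ℤ) = k
      · obtain ⟨c, hc0, h⟩ := mul_stdMinus_apply X x y (by omega)
        rw [← hc, stdMinus_mul_apply X x _ (Or.inr (ih _ _ (by simp only [boxPred]; omega))),
          eq_comm, mul_eq_zero] at h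
        exact h.resolve_right hc0
      · exact apply_eq_zero_of_lie_stdDelta hX hxy
  ext x y
  exact key _ x y rfl

/-- Every grading element is good. -/
lemma IsGradingElement.isGoodGrading [FiniteDimensional ℂ g] {i : Sl2Embedding g} {δ : g}
    (h : IsGradingElement i δ) : IsGoodGrading i δ := by
  rcases h with _ | ⟨p, e, δ, -, h_plus, h_minus, h_delta⟩
  · exact isGoodGrading_tzero i
  · have hlie : ∀ x y : g, (e ⁅x, y⁆ : Matrix (Box p) (Box p) ℂ)
        = (e x : Matrix (Box p) (Box p) ℂ) * e y - (e y : Matrix (Box p) (Box p) ℂ) * e x := by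
      intro x y
      rw [LieEquiv.map_lie]
      rfl
    have hinj : ∀ x y : g, (e x : Matrix (Box p) (Box p) ℂ) = e y → x = y := fun x y h =>
      e.injective (Subtype.ext h)
    have hsmul : ∀ (c : ℂ) (x : g), (e (c • x) : Matrix (Box p) (Box p) ℂ)
        = c • (e x : Matrix (Box p) (Box p) ℂ) := fun c x => by rw [map_smul]; rfl
    have hzero : ((e (0 : g) : LieAlgebra.SpecialLinear.sl (Box p) ℂ) :
        Matrix (Box p) (Box p) ℂ) = 0 := by rw [map_zero]; rfl
    have hdeg : ∀ {k : ℤ} {x : g}, x ∈ degSub δ k →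
        stdDelta p * (e x : Matrix (Box p) (Box p) ℂ)
          - (e x : Matrix (Box p) (Box p) ℂ) * stdDelta p
          = (k : ℂ) • (e x : Matrix (Box p) (Box p) ℂ) := by
      intro k x hx
      rw [← h_delta, ← hlie, mem_degSub.1 hx, hsmul]
    refine ⟨mem_degSub.2 (hinj _ _ ?_), mem_degSub.2 (hinj _ _ ?_), fun k hk x hx h0 => hinj _ _ ?_,
      fun k hk x hx h0 => hinj _ _ ?_⟩
    · rw [hlie, h_delta, h_plus, hsmul, h_plus, lie_stdDelta_stdPlus]
    · rw [hlie, h_delta, h_minus, hsmul, h_minus, lie_stdDelta_stdMinus]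
    · rw [hzero]
      refine eq_zero_of_commute_stdPlus hk (hdeg hx) ?_
      rw [← sub_eq_zero, ← h_plus, ← hlie, h0, hzero]
    · rw [hzero]
      refine eq_zero_of_commute_stdMinus hk (hdeg hx) ?_
      rw [← sub_eq_zero, ← h_minus, ← hlie, h0, hzero]

end Good

end

end FiniteW

namespace FiniteW

noncomputable section

/-! ### Ghost systems -/

section GhostSystem

variable {g : Type*} [LieRing g] [LieAlgebra ℂ g] {S A : Type*} [Fintype S] [Ring A] [Algebra ℂ A]

/-- The projection of `g` to the span of the `u α`, where `v` is dual to `u`. -/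
def lowerProj (K : LinearMap.BilinForm ℂ g) (u v : S → g) : g →ₗ[ℂ] g :=
  ∑ α, (K.flip (v α)).smulRight (u α)

lemma lowerProj_apply (K : LinearMap.BilinForm ℂ g) (u v : S → g) (x : g) :
    lowerProj K u v x = ∑ α, K x (v α) • u α := by
  simp [lowerProj]

/-- Currents `J`, antighosts `b` and ghosts `c` in an algebra; `b` and `c` are extended by zero to
linear maps on `g`. -/
structure GhostSystem (K : LinearMap.BilinForm ℂ g) (e : g) (u v : S → g) (J b c : g →ₗ[ℂ] A) :
    Prop where
  symm : ∀ x y, K x y = K y x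
  inv : ∀ x y z : g, K ⁅x, y⁆ z = K x ⁅y, z⁆
  proj_lie : ∀ α β, lowerProj K u v ⁅u α, u β⁆ = ⁅u α, u β⁆
  form_proj : ∀ x, K e (lowerProj K u v x) = K e x
  form_lie : ∀ α β, K e ⁅u α, u β⁆ = 0
  J_lie : ∀ x y, J ⁅x, y⁆ = J x * J y - J y * J x
  J_b : ∀ x y, J x * b y = b y * J x
  J_c : ∀ x y, J x * c y = c y * J x
  b_b : ∀ x y, b x * b y = -(b y * b x)
  c_c : ∀ x y, c x * c y = -(c y * c x)
  b_c : ∀ x α, b x * c (v α) + c (v α) * b x = algebraMap ℂ A (K x (v α))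
  b_proj : ∀ x, b (lowerProj K u v x) = b x
  c_eq : ∀ z, c z = ∑ α, K (u α) z • c (v α)

/-- The currents corrected by a ghost term. -/
def ghostCurrent (u v : S → g) (J b c : g →ₗ[ℂ] A) : g →ₗ[ℂ] A :=
  J - ∑ β, LinearMap.mulRight ℂ (c (v β)) ∘ₗ b ∘ₗ (LieAlgebra.ad ℂ g (u β) : g →ₗ[ℂ] g)

/-- The BRST charge of a ghost system. -/
def ghostCharge (K : LinearMap.BilinForm ℂ g) (e : g) (u v : S → g) (J b c : g →ₗ[ℂ] A) : A :=
  ∑ α, (J (u α) - algebraMap ℂ A (K e (u α))) * c (v α)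
    - (1 / 2 : ℂ) • ∑ α, ∑ β, b ⁅u α, u β⁆ * (c (v α) * c (v β))

variable {K : LinearMap.BilinForm ℂ g} {e : g} {u v : S → g} {J b c : g →ₗ[ℂ] A}

lemma ghostCurrent_apply (y : g) :
    ghostCurrent u v J b c y = J y + ∑ β, b ⁅y, u β⁆ * c (v β) := by
  simp only [← lie_skew y, map_neg, neg_mul, Finset.sum_neg_distrib, ← sub_eq_add_neg]
  simp [ghostCurrent]

lemma sum_form_smul_map {M : Type*} [AddCommGroup M] [Module ℂ M] (f : g →ₗ[ℂ] M) (x : g) :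
    ∑ α, K x (v α) • f (u α) = f (lowerProj K u v x) := by
  simp [lowerProj_apply]

namespace GhostSystem

variable (H : GhostSystem K e u v J b c)
include H

lemma form_lie_right (x y z : g) : K x ⁅y, z⁆ = -K ⁅y, x⁆ z := by
  rw [← H.inv, ← lie_skew, map_neg, LinearMap.neg_apply]

lemma c_mul_b (x : g) (α : S) :
    c (v α) * b x = algebraMap ℂ A (K x (v α)) - b x * c (v α) := by
  rw [← H.b_c]; abel

/-- The anticommutator of an antighost and a ghost. -/
lemma b_mul_c_add (x z : g) :
    b x * c z + c z * b x = algebraMap ℂ A (K (lowerProj K u v x) z) := by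
  rw [H.c_eq z, Finset.mul_sum, Finset.sum_mul, ← Finset.sum_add_distrib, lowerProj_apply]
  simp only [mul_smul_comm, smul_mul_assoc, ← smul_add, H.b_c, map_sum, LinearMap.sum_apply,
    map_smul, LinearMap.smul_apply, smul_eq_mul, Algebra.algebraMap_eq_smul_one, smul_smul]
  exact Finset.sum_congr rfl fun α _ => by rw [mul_comm]

/-- The ghost bilinear in the corrected current makes antighosts transform by the adjoint action,
after projection to the negative part. -/
lemma ghostCurrent_lie_b (y x : g) :
    ghostCurrent u v J b c y * b x - b x * ghostCurrent u v J b c y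
      = b ⁅y, lowerProj K u v x⁆ := by
  have h1 : ∀ β, b ⁅y, u β⁆ * c (v β) * b x - b x * (b ⁅y, u β⁆ * c (v β))
      = K x (v β) • b ⁅y, u β⁆ := by
    intro β
    rw [mul_assoc, H.c_mul_b, mul_sub, ← Algebra.commutes, ← Algebra.smul_def,
      ← mul_assoc (b x), H.b_b x, neg_mul, mul_assoc]
    abel
  rw [ghostCurrent_apply, add_mul, mul_add, H.J_b, Finset.sum_mul, Finset.mul_sum,
    add_sub_add_left_eq_sub, ← Finset.sum_sub_distrib, Finset.sum_congr rfl fun β _ => h1 β]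
  exact sum_form_smul_map (b ∘ₗ (LieAlgebra.ad ℂ g y : g →ₗ[ℂ] g)) x

lemma ghostCurrent_lie_c (y : g) (α : S) :
    ghostCurrent u v J b c y * c (v α) - c (v α) * ghostCurrent u v J b c y = c ⁅y, v α⁆ := by
  have h1 : ∀ β, b ⁅y, u β⁆ * c (v β) * c (v α) - c (v α) * (b ⁅y, u β⁆ * c (v β))
      = K (u β) ⁅y, v α⁆ • c (v β) := by
    intro β
    rw [mul_assoc, H.c_c (v β), ← mul_assoc (c (v α)), H.c_mul_b, sub_mul, ← Algebra.smul_def,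
      H.form_lie_right, mul_assoc, neg_smul, mul_neg]
    abel
  rw [ghostCurrent_apply, add_mul, mul_add, H.J_c, Finset.sum_mul, Finset.mul_sum,
    add_sub_add_left_eq_sub, ← Finset.sum_sub_distrib, Finset.sum_congr rfl fun β _ => h1 β,
    ← H.c_eq]

/-- Summation by parts: invariance of `K` moves `ad y` from the ghosts to the antighosts, with a
sign. -/
lemma sum_b_mul_c (y y' : g) :
    ∑ β, b ⁅y', u β⁆ * c ⁅y, v β⁆ = -∑ β, b ⁅y', lowerProj K u v ⁅y, u β⁆⁆ * c (v β) := by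
  have h1 : ∀ γ, b ⁅y', lowerProj K u v ⁅y, u γ⁆⁆ = ∑ β, K ⁅y, u γ⁆ (v β) • b ⁅y', u β⁆ :=
    fun γ => (sum_form_smul_map (b ∘ₗ (LieAlgebra.ad ℂ g y' : g →ₗ[ℂ] g)) ⁅y, u γ⁆).symm
  have h2 : ∀ β, c ⁅y, v β⁆ = -∑ γ, K ⁅y, u γ⁆ (v β) • c (v γ) := by
    intro β
    rw [H.c_eq, ← Finset.sum_neg_distrib]
    exact Finset.sum_congr rfl fun γ _ => by rw [H.form_lie_right, neg_smul]
  simp only [h1, h2, mul_neg, Finset.sum_neg_distrib, Finset.mul_sum, Finset.sum_mul,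
    mul_smul_comm, smul_mul_assoc]
  rw [Finset.sum_comm]

/-- The corrected currents represent `g` up to an anomaly coming from the part of `[y, u β]` that
leaves the negative subspace; it will have lower weight. -/
lemma ghostCurrent_lie (y y' : g) :
    ghostCurrent u v J b c y * ghostCurrent u v J b c y'
        - ghostCurrent u v J b c y' * ghostCurrent u v J b c y
      = ghostCurrent u v J b c ⁅y, y'⁆
        + ∑ β, (b ⁅y', ⁅y, u β⁆ - lowerProj K u v ⁅y, u β⁆⁆
          - b ⁅y, ⁅y', u β⁆ - lowerProj K u v ⁅y', u β⁆⁆) * c (v β) := by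
  have hJ : ghostCurrent u v J b c y * J y' - J y' * ghostCurrent u v J b c y = J ⁅y, y'⁆ := by
    have h1 : ∀ β, b ⁅y, u β⁆ * c (v β) * J y' - J y' * (b ⁅y, u β⁆ * c (v β)) = 0 := by
      intro β
      rw [mul_assoc, ← H.J_c, ← mul_assoc, ← H.J_b, mul_assoc, sub_self]
    rw [ghostCurrent_apply, add_mul, mul_add, H.J_lie, Finset.sum_mul, Finset.mul_sum,
      add_sub_add_comm, ← Finset.sum_sub_distrib, Finset.sum_congr rfl fun β _ => h1 β]
    simp
  have hbc : ∀ β, ghostCurrent u v J b c y * (b ⁅y', u β⁆ * c (v β))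
      - b ⁅y', u β⁆ * c (v β) * ghostCurrent u v J b c y
      = b ⁅y, lowerProj K u v ⁅y', u β⁆⁆ * c (v β) + b ⁅y', u β⁆ * c ⁅y, v β⁆ := by
    intro β
    rw [← H.ghostCurrent_lie_b, ← H.ghostCurrent_lie_c]
    noncomm_ring
  rw [ghostCurrent_apply y', mul_add, add_mul, add_sub_add_comm, hJ, Finset.mul_sum,
    Finset.sum_mul, ← Finset.sum_sub_distrib, Finset.sum_congr rfl fun β _ => hbc β,
    Finset.sum_add_distrib, H.sum_b_mul_c, ghostCurrent_apply, add_assoc,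
    ← Finset.sum_add_distrib, ← sub_eq_add_neg, ← Finset.sum_sub_distrib]
  congr 1
  refine Finset.sum_congr rfl fun β _ => ?_
  rw [← sub_mul, ← add_mul, lie_lie]
  simp only [lie_sub, map_sub]
  congr 1
  abel

end GhostSystem

end GhostSystem

end

end FiniteW

namespace FiniteW

noncomputable section

/-! ### The differential of a ghost system -/

section GhostSystem

variable {g : Type*} [LieRing g] [LieAlgebra ℂ g] {S A : Type*} [Fintype S] [Ring A] [Algebra ℂ A]
  {K : LinearMap.BilinForm ℂ g} {e : g} {u v : S → g} {J b c : g →ₗ[ℂ] A}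

namespace GhostSystem

variable (H : GhostSystem K e u v J b c)
include H

lemma sum_swap_mul_c_c (F : S → S → A) :
    ∑ α, ∑ β, F β α * (c (v α) * c (v β)) = -∑ α, ∑ β, F α β * (c (v α) * c (v β)) := by
  rw [Finset.sum_comm, ← Finset.sum_neg_distrib]
  refine Finset.sum_congr rfl fun α _ => ?_
  rw [← Finset.sum_neg_distrib]
  exact Finset.sum_congr rfl fun β _ => by rw [H.c_c, mul_neg]

/-- The differential of an antighost. -/
lemma charge_mul_b (x : g) :
    ghostCharge K e u v J b c * b x + b x * ghostCharge K e u v J b c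
      = ghostCurrent u v J b c (lowerProj K u v x) - algebraMap ℂ A (K e x) := by
  have h1 : ∀ α, (J (u α) - algebraMap ℂ A (K e (u α))) * c (v α) * b x
      + b x * ((J (u α) - algebraMap ℂ A (K e (u α))) * c (v α))
      = K x (v α) • (J (u α) - algebraMap ℂ A (K e (u α))) := by
    intro α
    rw [mul_assoc, H.c_mul_b, ← mul_assoc (b x), mul_sub (b x), ← H.J_b, ← Algebra.commutes,
      Algebra.smul_def, Algebra.commutes (K x (v α))]
    noncomm_ring
  have h2 : ∀ α β, b ⁅u α, u β⁆ * (c (v α) * c (v β)) * b x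
      + b x * (b ⁅u α, u β⁆ * (c (v α) * c (v β)))
      = K x (v β) • b ⁅u α, u β⁆ * c (v α) - K x (v α) • b ⁅u α, u β⁆ * c (v β) := by
    intro α β
    rw [← mul_assoc (b x), H.b_b x, mul_assoc, mul_assoc, H.c_mul_b, mul_sub, ← mul_assoc (c (v α)),
      H.c_mul_b, ← Algebra.commutes, ← Algebra.smul_def, sub_mul, ← Algebra.smul_def]
    simp only [mul_sub, mul_smul_comm, smul_mul_assoc, neg_mul, mul_assoc]
    abel
  have h3 : ∑ α, ∑ β, K x (v β) • b ⁅u α, u β⁆ * c (v α)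
      = -∑ β, b ⁅lowerProj K u v x, u β⁆ * c (v β) := by
    rw [← Finset.sum_neg_distrib]
    refine Finset.sum_congr rfl fun α _ => ?_
    rw [← Finset.sum_mul, ← neg_mul, ← map_neg, lie_skew]
    congr 1
    exact sum_form_smul_map (b ∘ₗ (LieAlgebra.ad ℂ g (u α) : g →ₗ[ℂ] g)) x
  have h4 : ∑ α, ∑ β, K x (v α) • b ⁅u α, u β⁆ * c (v β)
      = ∑ β, b ⁅lowerProj K u v x, u β⁆ * c (v β) := by
    rw [Finset.sum_comm]
    refine Finset.sum_congr rfl fun β _ => ?_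
    rw [← Finset.sum_mul, lowerProj_apply]
    simp only [sum_lie, smul_lie, map_sum, map_smul]
  have h5 : ghostCharge K e u v J b c * b x + b x * ghostCharge K e u v J b c
      = ∑ α, ((J (u α) - algebraMap ℂ A (K e (u α))) * c (v α) * b x
      + b x * ((J (u α) - algebraMap ℂ A (K e (u α))) * c (v α)))
      - (1 / 2 : ℂ) • ∑ α, ∑ β, (b ⁅u α, u β⁆ * (c (v α) * c (v β)) * b x
      + b x * (b ⁅u α, u β⁆ * (c (v α) * c (v β)))) := by
    simp only [ghostCharge, sub_mul, mul_sub, Finset.sum_mul, Finset.mul_sum,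
      Finset.sum_add_distrib, smul_mul_assoc, mul_smul_comm, smul_add, Finset.sum_sub_distrib]
    abel
  have h6 : ∑ α, K x (v α) • J (u α) = J (lowerProj K u v x) := sum_form_smul_map J x
  have h7 : ∑ α, K x (v α) • algebraMap ℂ A (K e (u α)) = algebraMap ℂ A (K e x) := by
    rw [← H.form_proj x]
    exact sum_form_smul_map ((Algebra.linearMap ℂ A) ∘ₗ K e) x
  simp only [h5, h1, h2, Finset.sum_sub_distrib, h3, h4, smul_sub, h6, h7]
  rw [ghostCurrent_apply, smul_neg, ← neg_add', ← add_smul]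
  norm_num
  abel

/-- The differential of a ghost. -/
lemma charge_mul_c (z : g) :
    ghostCharge K e u v J b c * c z + c z * ghostCharge K e u v J b c
      = -((1 / 2 : ℂ) • ∑ α, ∑ β, K ⁅u α, u β⁆ z • (c (v α) * c (v β))) := by
  have h1 : ∀ α, (J (u α) - algebraMap ℂ A (K e (u α))) * c (v α) * c z
      + c z * ((J (u α) - algebraMap ℂ A (K e (u α))) * c (v α)) = 0 := by
    intro α
    rw [mul_assoc, H.c_c (v α), ← mul_assoc (c z), mul_sub, ← H.J_c, ← Algebra.commutes,
      ← sub_mul, mul_neg, mul_assoc, neg_add_cancel]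
  have h2 : ∀ α β, b ⁅u α, u β⁆ * (c (v α) * c (v β)) * c z
      + c z * (b ⁅u α, u β⁆ * (c (v α) * c (v β))) = K ⁅u α, u β⁆ z • (c (v α) * c (v β)) := by
    intro α β
    have h := H.b_mul_c_add ⁅u α, u β⁆ z
    rw [H.proj_lie] at h
    rw [Algebra.smul_def, ← h, mul_assoc, mul_assoc, H.c_c (v β), mul_neg, ← mul_assoc (c (v α)),
      H.c_c (v α)]
    noncomm_ring
  have h5 : ghostCharge K e u v J b c * c z + c z * ghostCharge K e u v J b c
      = ∑ α, ((J (u α) - algebraMap ℂ A (K e (u α))) * c (v α) * c z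
      + c z * ((J (u α) - algebraMap ℂ A (K e (u α))) * c (v α)))
      - (1 / 2 : ℂ) • ∑ α, ∑ β, (b ⁅u α, u β⁆ * (c (v α) * c (v β)) * c z
      + c z * (b ⁅u α, u β⁆ * (c (v α) * c (v β)))) := by
    simp only [ghostCharge, sub_mul, mul_sub, Finset.sum_mul, Finset.mul_sum,
      Finset.sum_add_distrib, smul_mul_assoc, mul_smul_comm, smul_add, Finset.sum_sub_distrib]
    abel
  simp only [h5, h1, h2, Finset.sum_const_zero, zero_sub]

/-- The differential of an uncorrected current. -/
lemma charge_lie_J (y : g) :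
    ghostCharge K e u v J b c * J y - J y * ghostCharge K e u v J b c
      = ∑ α, J ⁅u α, y⁆ * c (v α) := by
  have h1 : ∀ α, (J (u α) - algebraMap ℂ A (K e (u α))) * c (v α) * J y
      - J y * ((J (u α) - algebraMap ℂ A (K e (u α))) * c (v α)) = J ⁅u α, y⁆ * c (v α) := by
    intro α
    rw [mul_assoc, ← H.J_c, ← mul_assoc, ← mul_assoc, ← sub_mul, sub_mul (J (u α)), mul_sub (J y),
      ← Algebra.commutes, sub_sub_sub_cancel_right, H.J_lie]
  have h2 : ∀ α β, b ⁅u α, u β⁆ * (c (v α) * c (v β)) * J y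
      - J y * (b ⁅u α, u β⁆ * (c (v α) * c (v β))) = 0 := by
    intro α β
    rw [← mul_assoc (J y), H.J_b, mul_assoc, mul_assoc, mul_assoc, ← H.J_c, ← mul_assoc (c (v α)),
      ← H.J_c, mul_assoc, sub_self]
  have h5 : ghostCharge K e u v J b c * J y - J y * ghostCharge K e u v J b c
      = ∑ α, ((J (u α) - algebraMap ℂ A (K e (u α))) * c (v α) * J y
      - J y * ((J (u α) - algebraMap ℂ A (K e (u α))) * c (v α)))
      - (1 / 2 : ℂ) • ∑ α, ∑ β, (b ⁅u α, u β⁆ * (c (v α) * c (v β)) * J y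
      - J y * (b ⁅u α, u β⁆ * (c (v α) * c (v β)))) := by
    simp only [ghostCharge, sub_mul, mul_sub, Finset.sum_mul, Finset.mul_sum,
      smul_mul_assoc, mul_smul_comm, smul_sub, Finset.sum_sub_distrib]
    abel
  simp only [h5, h1, h2, Finset.sum_const_zero, smul_zero, sub_zero]

/-- Against the antisymmetric product of two ghosts, the two terms of the Jacobi identity contribute
equally; hence the factor `1/2`. -/
lemma sum_ghostCurrent_lie_mul_c (y : g) :
    ∑ β, (∑ γ, b ⁅⁅y, u β⁆, u γ⁆ * c (v γ)) * c (v β)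
      = -((1 / 2 : ℂ) • ∑ α, ∑ β, b ⁅y, ⁅u α, u β⁆⁆ * (c (v α) * c (v β))) := by
  have h1 : ∀ α β, b ⁅y, ⁅u α, u β⁆⁆ = b ⁅⁅y, u α⁆, u β⁆ - b ⁅⁅y, u β⁆, u α⁆ := by
    intro α β
    rw [leibniz_lie, ← lie_skew (u α), map_add, map_neg, sub_eq_add_neg]
  simp only [h1, sub_mul, Finset.sum_sub_distrib, Finset.sum_mul, mul_assoc]
  rw [H.sum_swap_mul_c_c fun α β => b ⁅⁅y, u α⁆, u β⁆, Finset.sum_comm,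
    H.sum_swap_mul_c_c fun α β => b ⁅⁅y, u α⁆, u β⁆, sub_neg_eq_add, ← two_smul ℂ, smul_smul]
  norm_num

/-- The differential of a corrected current. -/
lemma charge_lie_ghostCurrent (y : g) :
    ghostCharge K e u v J b c * ghostCurrent u v J b c y
        - ghostCurrent u v J b c y * ghostCharge K e u v J b c
      = ∑ α, ghostCurrent u v J b c (⁅u α, y⁆ - lowerProj K u v ⁅u α, y⁆) * c (v α)
        + c ⁅y, e⁆ := by
  set Q := ghostCharge K e u v J b c with hQ
  -- Leibniz rule for an odd derivation: `[Q, b c] = {Q, b} c - b {Q, c}`.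
  have h1 : ∀ β, Q * (b ⁅y, u β⁆ * c (v β)) - b ⁅y, u β⁆ * c (v β) * Q
      = (ghostCurrent u v J b c (lowerProj K u v ⁅y, u β⁆)
        - algebraMap ℂ A (K e ⁅y, u β⁆)) * c (v β)
      + b ⁅y, u β⁆ * ((1 / 2 : ℂ) • ∑ α, ∑ γ, K ⁅u α, u γ⁆ (v β) • (c (v α) * c (v γ))) := by
    intro β
    rw [← H.charge_mul_b, ← neg_neg ((1 / 2 : ℂ) • _), ← H.charge_mul_c]
    noncomm_ring
  have h2 : ∑ β, b ⁅y, u β⁆ * ((1 / 2 : ℂ) • ∑ α, ∑ γ, K ⁅u α, u γ⁆ (v β) • (c (v α) * c (v γ)))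
      = (1 / 2 : ℂ) • ∑ α, ∑ β, b ⁅y, ⁅u α, u β⁆⁆ * (c (v α) * c (v β)) := by
    simp only [mul_smul_comm, ← Finset.smul_sum, Finset.mul_sum]
    congr 1
    rw [Finset.sum_comm]
    refine Finset.sum_congr rfl fun α _ => ?_
    rw [Finset.sum_comm]
    refine Finset.sum_congr rfl fun γ _ => ?_
    rw [← H.proj_lie α γ]
    simp only [← smul_mul_assoc, ← Finset.sum_mul]
    rw [H.proj_lie]
    congr 1
    have := sum_form_smul_map (K := K) (u := u) (v := v)
      (b ∘ₗ (LieAlgebra.ad ℂ g y : g →ₗ[ℂ] g)) ⁅u α, u γ⁆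
    rw [H.proj_lie] at this
    exact this
  have h3 : ∑ β, algebraMap ℂ A (K e ⁅y, u β⁆) * c (v β) = -c ⁅y, e⁆ := by
    rw [H.c_eq, ← Finset.sum_neg_distrib]
    refine Finset.sum_congr rfl fun β _ => ?_
    rw [← Algebra.smul_def, H.form_lie_right, H.symm ⁅y, e⁆, neg_smul]
  have h4 : ∀ α, ghostCurrent u v J b c (⁅u α, y⁆ - lowerProj K u v ⁅u α, y⁆) * c (v α)
      = J ⁅u α, y⁆ * c (v α) - (∑ γ, b ⁅⁅y, u α⁆, u γ⁆ * c (v γ)) * c (v α)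
        + ghostCurrent u v J b c (lowerProj K u v ⁅y, u α⁆) * c (v α) := by
    intro α
    rw [← lie_skew (u α) y, map_neg, map_sub, map_neg, map_neg, ghostCurrent_apply ⁅y, u α⁆,
      map_neg]
    noncomm_ring
  have h5 : Q * ghostCurrent u v J b c y - ghostCurrent u v J b c y * Q
      = (Q * J y - J y * Q) + ∑ β, (Q * (b ⁅y, u β⁆ * c (v β)) - b ⁅y, u β⁆ * c (v β) * Q) := by
    rw [ghostCurrent_apply, mul_add, add_mul, Finset.mul_sum, Finset.sum_mul,
      Finset.sum_sub_distrib]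
    abel
  rw [h5, hQ, H.charge_lie_J, ← hQ]
  simp only [h1, h4, Finset.sum_add_distrib, h2, sub_mul, Finset.sum_sub_distrib, h3,
    H.sum_ghostCurrent_lie_mul_c]
  abel

end GhostSystem

end GhostSystem

end

end FiniteW

namespace FiniteW

noncomputable section

/-! ### The square of the charge is central -/

section GhostSystem

variable {g : Type*} [LieRing g] [LieAlgebra ℂ g] {S A : Type*} [Fintype S] [Ring A] [Algebra ℂ A]
  {K : LinearMap.BilinForm ℂ g} {e : g} {u v : S → g} {J b c : g →ₗ[ℂ] A}

namespace GhostSystem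

variable (H : GhostSystem K e u v J b c)
include H

lemma proj_lie_lowerProj (α : S) (x : g) :
    lowerProj K u v ⁅u α, lowerProj K u v x⁆ = ⁅u α, lowerProj K u v x⁆ := by
  conv_rhs => rw [lowerProj_apply K u v x]
  conv_lhs => rw [lowerProj_apply K u v x]
  simp only [lie_sum, lie_smul, map_sum, map_smul, H.proj_lie]

/-- By invariance the coefficients are values of `K e` on brackets of negative elements, and these
vanish: `χ` is a character of the negative part. -/
lemma c_lie_lowerProj (x : g) : c ⁅lowerProj K u v x, e⁆ = 0 := by
  have h : ∀ α, c ⁅u α, e⁆ = 0 := by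
    intro α
    rw [H.c_eq]
    refine Finset.sum_eq_zero fun β _ => ?_
    rw [← H.inv, H.symm, H.form_lie, zero_smul]
  simp only [lowerProj_apply, sum_lie, smul_lie, map_sum, map_smul, h, smul_zero,
    Finset.sum_const_zero]

/-- The corrected currents of negative degree are closed. -/
lemma charge_lie_ghostCurrent_lowerProj (x : g) :
    ghostCharge K e u v J b c * ghostCurrent u v J b c (lowerProj K u v x)
      - ghostCurrent u v J b c (lowerProj K u v x) * ghostCharge K e u v J b c = 0 := by
  rw [H.charge_lie_ghostCurrent, H.c_lie_lowerProj, add_zero]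
  refine Finset.sum_eq_zero fun α _ => ?_
  rw [H.proj_lie_lowerProj, sub_self, map_zero, zero_mul]

/-- `[Q², b] = [Q, {Q, b}]`, and `{Q, b}` is a closed current minus a scalar. -/
lemma charge_sq_commute_b (x : g) :
    ghostCharge K e u v J b c * ghostCharge K e u v J b c * b x
      = b x * (ghostCharge K e u v J b c * ghostCharge K e u v J b c) := by
  have h1 := H.charge_lie_ghostCurrent_lowerProj x
  rw [← sub_add_cancel (ghostCurrent u v J b c (lowerProj K u v x)) (algebraMap ℂ A (K e x)),
    ← H.charge_mul_b, mul_add, add_mul, ← Algebra.commutes, add_sub_add_right_eq_sub] at h1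
  rw [← sub_eq_zero, ← h1]
  noncomm_ring

/-- A cyclic permutation of three anticommuting ghosts is even, so three times the sum equals the
sum of the cyclically symmetrized coefficients. -/
lemma sum_cyclic_eq_zero (F : S → S → S → ℂ) (hF : ∀ α β γ, F α β γ + F β γ α + F γ α β = 0) :
    ∑ α, ∑ β, ∑ γ, F α β γ • (c (v α) * (c (v β) * c (v γ))) = 0 := by
  set T := ∑ α, ∑ β, ∑ γ, F α β γ • (c (v α) * (c (v β) * c (v γ)))
  have hc : ∀ x y z, c y * (c z * c x) = c x * (c y * c z) := by
    intro x y z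
    rw [H.c_c z, mul_neg, ← mul_assoc, H.c_c y, neg_mul, neg_neg, mul_assoc]
  have hrot : ∀ G : S → S → S → A, ∑ α, ∑ β, ∑ γ, G β γ α = ∑ α, ∑ β, ∑ γ, G α β γ := by
    intro G
    rw [Finset.sum_comm]
    exact Finset.sum_congr rfl fun β _ => Finset.sum_comm
  have h1 : ∑ α, ∑ β, ∑ γ, F β γ α • (c (v α) * (c (v β) * c (v γ))) = T := by
    rw [show T = _ from (hrot fun α β γ => F α β γ • (c (v α) * (c (v β) * c (v γ)))).symm]
    exact Finset.sum_congr rfl fun α _ => Finset.sum_congr rfl fun β _ =>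
      Finset.sum_congr rfl fun γ _ => by rw [hc (v α)]
  have h2 : ∑ α, ∑ β, ∑ γ, F γ α β • (c (v α) * (c (v β) * c (v γ))) = T := by
    rw [← h1, ← hrot fun α β γ => F β γ α • (c (v α) * (c (v β) * c (v γ)))]
    exact Finset.sum_congr rfl fun α _ => Finset.sum_congr rfl fun β _ =>
      Finset.sum_congr rfl fun γ _ => by rw [← hc (v α)]
  have h3 : T + T + T = 0 := by
    nth_rewrite 2 [← h1]
    nth_rewrite 2 [← h2]
    simp only [T, ← Finset.sum_add_distrib, ← add_smul, hF, zero_smul, Finset.sum_const_zero]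
  have h4 : (3 : ℂ) • T = 0 := by rw [← h3]; module
  exact (smul_eq_zero.1 h4).resolve_left (by norm_num)

/-- Jacobi identity. -/
lemma sum_form_lie_lie_eq_zero (z : g) :
    ∑ α, ∑ β, ∑ γ, K ⁅u α, ⁅u β, u γ⁆⁆ z • (c (v α) * (c (v β) * c (v γ))) = 0 := by
  refine H.sum_cyclic_eq_zero _ fun α β γ => ?_
  rw [← LinearMap.add_apply, ← LinearMap.add_apply, ← map_add, ← map_add, lie_jacobi]
  simp

lemma charge_lie_c_mul_c (x y : g) :
    ghostCharge K e u v J b c * (c x * c y) - c x * c y * ghostCharge K e u v J b c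
      = c x * ((1 / 2 : ℂ) • ∑ α, ∑ β, K ⁅u α, u β⁆ y • (c (v α) * c (v β)))
        - c y * ((1 / 2 : ℂ) • ∑ α, ∑ β, K ⁅u α, u β⁆ x • (c (v α) * c (v β))) := by
  have hcc : ∀ x' y' z, c x' * c y' * c z = c z * (c x' * c y') := by
    intro x' y' z
    rw [mul_assoc, H.c_c y', mul_neg, ← mul_assoc, H.c_c x', neg_mul, neg_neg, mul_assoc]
  have h : ((1 / 2 : ℂ) • ∑ α, ∑ β, K ⁅u α, u β⁆ x • (c (v α) * c (v β))) * c y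
      = c y * ((1 / 2 : ℂ) • ∑ α, ∑ β, K ⁅u α, u β⁆ x • (c (v α) * c (v β))) := by
    simp only [smul_mul_assoc, mul_smul_comm, Finset.sum_mul, Finset.mul_sum, hcc]
  rw [← h, ← neg_neg (((1 / 2 : ℂ) • ∑ α, ∑ β, K ⁅u α, u β⁆ y • _)),
    ← neg_neg (((1 / 2 : ℂ) • ∑ α, ∑ β, K ⁅u α, u β⁆ x • _)), ← H.charge_mul_c, ← H.charge_mul_c]
  noncomm_ring

/-- `[Q², c] = [Q, {Q, c}]` is cubic in the ghosts, with coefficients that cancel by the Jacobi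
identity. -/
lemma charge_sq_commute_c (z : g) :
    ghostCharge K e u v J b c * ghostCharge K e u v J b c * c z
      = c z * (ghostCharge K e u v J b c * ghostCharge K e u v J b c) := by
  have h1 : ghostCharge K e u v J b c * ghostCharge K e u v J b c * c z
      - c z * (ghostCharge K e u v J b c * ghostCharge K e u v J b c)
      = ghostCharge K e u v J b c * (ghostCharge K e u v J b c * c z
          + c z * ghostCharge K e u v J b c) - (ghostCharge K e u v J b c * c z
          + c z * ghostCharge K e u v J b c) * ghostCharge K e u v J b c := by
    noncomm_ring
  have h2 : ∀ α, ∑ β, K ⁅u α, u β⁆ z •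
      ((1 / 2 : ℂ) • ∑ γ, ∑ ε, K ⁅u γ, u ε⁆ (v β) • (c (v γ) * c (v ε)))
      = (1 / 2 : ℂ) • ∑ γ, ∑ ε, K ⁅u α, ⁅u γ, u ε⁆⁆ z • (c (v γ) * c (v ε)) := by
    intro α
    simp only [smul_comm _ (1 / 2 : ℂ), ← Finset.smul_sum]
    congr 1
    simp only [Finset.smul_sum, smul_smul]
    rw [Finset.sum_comm]
    refine Finset.sum_congr rfl fun γ _ => ?_
    rw [Finset.sum_comm]
    refine Finset.sum_congr rfl fun ε _ => ?_
    rw [← Finset.sum_smul]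
    congr 1
    have h := sum_form_smul_map (K := K) (u := u) (v := v)
      (K.flip z ∘ₗ (LieAlgebra.ad ℂ g (u α) : g →ₗ[ℂ] g)) ⁅u γ, u ε⁆
    rw [H.proj_lie] at h
    rw [← LinearMap.flip_apply, ← LieAlgebra.ad_apply ℂ, ← LinearMap.comp_apply]
    refine Eq.trans (Finset.sum_congr rfl fun β _ => ?_) h
    rw [mul_comm, smul_eq_mul]
    rfl
  have h3 : ∑ α, c (v α) * ∑ β, K ⁅u α, u β⁆ z •
      ((1 / 2 : ℂ) • ∑ γ, ∑ ε, K ⁅u γ, u ε⁆ (v β) • (c (v γ) * c (v ε))) = 0 := by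
    simp only [h2, mul_smul_comm, ← Finset.smul_sum, Finset.mul_sum]
    rw [H.sum_form_lie_lie_eq_zero, smul_zero]
  have h4 : ∑ α, ∑ β, K ⁅u α, u β⁆ z • (ghostCharge K e u v J b c * (c (v α) * c (v β))
      - c (v α) * c (v β) * ghostCharge K e u v J b c) = 0 := by
    simp only [H.charge_lie_c_mul_c]
    obtain ⟨E, hE⟩ : ∃ E : S → A, ∀ β, (1 / 2 : ℂ) • ∑ γ, ∑ ε, K ⁅u γ, u ε⁆ (v β)
        • (c (v γ) * c (v ε)) = E β := ⟨_, fun β => rfl⟩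
    simp only [hE] at h3 ⊢
    have h6 : ∑ α, ∑ β, K ⁅u α, u β⁆ z • (c (v α) * E β) = 0 := by
      simpa only [mul_smul_comm, Finset.mul_sum] using h3
    have h7 : ∑ α, ∑ β, K ⁅u α, u β⁆ z • (c (v β) * E α) = 0 := by
      rw [← neg_zero, ← h6, Finset.sum_comm]
      simp only [← Finset.sum_neg_distrib]
      refine Finset.sum_congr rfl fun α _ => Finset.sum_congr rfl fun β _ => ?_
      rw [← lie_skew, map_neg, LinearMap.neg_apply, neg_smul]
    simp only [smul_sub, Finset.sum_sub_distrib, h6, h7, sub_zero]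
  have h5 : ghostCharge K e u v J b c * (∑ α, ∑ β, K ⁅u α, u β⁆ z • (c (v α) * c (v β)))
      - (∑ α, ∑ β, K ⁅u α, u β⁆ z • (c (v α) * c (v β))) * ghostCharge K e u v J b c = 0 := by
    rw [← h4]
    simp only [Finset.mul_sum, Finset.sum_mul, mul_smul_comm, smul_mul_assoc, smul_sub,
      Finset.sum_sub_distrib]
  rw [← sub_eq_zero, h1, H.charge_mul_c, mul_neg, neg_mul, mul_smul_comm, smul_mul_assoc,
    ← neg_sub', ← smul_sub, h5, smul_zero, neg_zero]

/-- `[Q², J] = {Q, [Q, J]}`. The term with two nested brackets, antisymmetrized in the ghosts,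
cancels the one coming from the ghost differential. -/
lemma charge_sq_commute_J (y : g) :
    ghostCharge K e u v J b c * ghostCharge K e u v J b c * J y
      = J y * (ghostCharge K e u v J b c * ghostCharge K e u v J b c) := by
  have h1 : ghostCharge K e u v J b c * ghostCharge K e u v J b c * J y
      - J y * (ghostCharge K e u v J b c * ghostCharge K e u v J b c)
      = ghostCharge K e u v J b c * (ghostCharge K e u v J b c * J y
          - J y * ghostCharge K e u v J b c) + (ghostCharge K e u v J b c * J y
          - J y * ghostCharge K e u v J b c) * ghostCharge K e u v J b c := by
    noncomm_ring
  have h2 : ∀ α, ghostCharge K e u v J b c * (J ⁅u α, y⁆ * c (v α))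
      + J ⁅u α, y⁆ * c (v α) * ghostCharge K e u v J b c
      = ∑ β, J ⁅u β, ⁅u α, y⁆⁆ * (c (v β) * c (v α))
        - J ⁅u α, y⁆ * ((1 / 2 : ℂ) • ∑ β, ∑ γ, K ⁅u β, u γ⁆ (v α) • (c (v β) * c (v γ))) := by
    intro α
    rw [sub_eq_add_neg, ← mul_neg, ← H.charge_mul_c]
    simp only [← mul_assoc, ← Finset.sum_mul]
    rw [← H.charge_lie_J]
    noncomm_ring
  have h3 : ∑ α, J ⁅u α, y⁆ * ((1 / 2 : ℂ) • ∑ β, ∑ γ, K ⁅u β, u γ⁆ (v α) • (c (v β) * c (v γ)))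
      = (1 / 2 : ℂ) • ∑ β, ∑ γ, J ⁅⁅u β, u γ⁆, y⁆ * (c (v β) * c (v γ)) := by
    simp only [mul_smul_comm, ← Finset.smul_sum, Finset.mul_sum]
    congr 1
    rw [Finset.sum_comm]
    refine Finset.sum_congr rfl fun β _ => ?_
    rw [Finset.sum_comm]
    refine Finset.sum_congr rfl fun γ _ => ?_
    simp only [← smul_mul_assoc, ← Finset.sum_mul]
    congr 1
    have h := sum_form_smul_map (K := K) (u := u) (v := v)
      (J ∘ₗ (-(LieAlgebra.ad ℂ g y : g →ₗ[ℂ] g))) ⁅u β, u γ⁆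
    rw [H.proj_lie] at h
    simpa only [LinearMap.comp_apply, LinearMap.neg_apply, LieHom.coe_toLinearMap,
      LieAlgebra.ad_apply, lie_skew] using h
  have h4 : ∑ β, ∑ γ, J ⁅⁅u β, u γ⁆, y⁆ * (c (v β) * c (v γ))
      = (2 : ℂ) • ∑ β, ∑ γ, J ⁅u β, ⁅u γ, y⁆⁆ * (c (v β) * c (v γ)) := by
    simp only [lie_lie, map_sub, sub_mul, Finset.sum_sub_distrib]
    rw [H.sum_swap_mul_c_c fun α β => J ⁅u α, ⁅u β, y⁆⁆, two_smul, sub_neg_eq_add]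
  rw [← sub_eq_zero, h1, H.charge_lie_J, Finset.mul_sum, Finset.sum_mul, ← Finset.sum_add_distrib]
  simp only [h2, Finset.sum_sub_distrib, h3, h4]
  rw [Finset.sum_comm, smul_smul]
  norm_num

end GhostSystem

end GhostSystem

end

end FiniteW

namespace FiniteW

noncomputable section

set_option linter.unusedSectionVars false

attribute [local instance] LieRing.ofAssociativeRing

/-! ### The ghost system of the BRST complex -/

variable {g : Type*} [LieRing g] [LieAlgebra ℂ g] {δ : g} {I : Type*}

lemma ghost_mul_self_swap (v w : gPlus δ) : ghost v * ghost w = -(ghost w * ghost v) := by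
  rw [eq_neg_iff_add_eq_zero, ghost, ghost, CliffordAlgebra.ι_mul_ι_add_swap]
  simp [QuadraticMap.polar]

lemma antighost_mul_self_swap (φ ψ : Module.Dual ℂ (gPlus δ)) :
    antighost φ * antighost ψ = -(antighost ψ * antighost φ) := by
  rw [eq_neg_iff_add_eq_zero, antighost, antighost, CliffordAlgebra.ι_mul_ι_add_swap]
  simp [QuadraticMap.polar]

lemma antighost_mul_ghost_add (φ : Module.Dual ℂ (gPlus δ)) (v : gPlus δ) :
    antighost φ * ghost v + ghost v * antighost φ = algebraMap ℂ (Ghosts δ) (φ v) := by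
  rw [ghost, antighost, CliffordAlgebra.ι_mul_ι_add_swap]
  simp [QuadraticMap.polar]

variable [Fintype I] [DecidableEq I]

lemma gPlus_eq_span (t : HomogeneousBasis δ I) :
    gPlus δ = Submodule.span ℂ (Set.range fun α : t.Pos => t.basis α) := by
  apply le_antisymm
  · refine iSup_le fun k => iSup_le fun hk x hx => ?_
    rw [← t.basis.sum_repr x]
    refine sum_mem fun a _ => ?_
    by_cases ha : t.deg a = k
    · exact Submodule.smul_mem _ _ (Submodule.subset_span ⟨⟨a, by omega⟩, rfl⟩)
    · rw [t.repr_eq_zero hx ha, zero_smul]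
      exact zero_mem _
  · rw [Submodule.span_le]
    rintro _ ⟨α, rfl⟩
    exact t.mem_gPlus α.2

lemma sum_pos_eq {M : Type*} [AddCommMonoid M] (t : HomogeneousBasis δ I) (f : I → M)
    (hf : ∀ a, ¬ 0 < t.deg a → f a = 0) : ∑ α : t.Pos, f α = ∑ a, f a :=
  (Finset.sum_subtype (Finset.univ.filter fun a => 0 < t.deg a) (by simp) f).symm.trans
    (Finset.sum_filter_of_ne fun a _ ha => by_contra fun h => ha (hf a h))

/-- The currents in `Ω`. -/
def currentMap (δ : g) : g →ₗ[ℂ] Omega δ :=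
  (Algebra.TensorProduct.includeLeft : UniversalEnvelopingAlgebra ℂ g →ₐ[ℂ] Omega δ).toLinearMap ∘ₗ
    (UniversalEnvelopingAlgebra.ι ℂ : g →ₗ⁅ℂ⁆ UniversalEnvelopingAlgebra ℂ g)

lemma currentMap_apply (x : g) :
    currentMap δ x = UniversalEnvelopingAlgebra.ι ℂ x ⊗ₜ[ℂ] (1 : Ghosts δ) := rfl

/-- The antighosts in `Ω`, indexed by elements of `g` via the form. -/
def antighostMap (δ : g) (K : LinearMap.BilinForm ℂ g) : g →ₗ[ℂ] Omega δ :=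
  (Algebra.TensorProduct.includeRight : Ghosts δ →ₐ[ℂ] Omega δ).toLinearMap ∘ₗ
    CliffordAlgebra.ι (QuadraticForm.dualProd ℂ (gPlus δ)) ∘ₗ
    LinearMap.inl ℂ (Module.Dual ℂ (gPlus δ)) (gPlus δ) ∘ₗ
    (gPlus δ).subtype.dualMap ∘ₗ K

lemma antighostMap_apply (K : LinearMap.BilinForm ℂ g) (x : g) :
    antighostMap δ K x = (1 : UniversalEnvelopingAlgebra ℂ g) ⊗ₜ[ℂ]
      antighost ((K x).comp (gPlus δ).subtype) := rfl

/-- The ghosts in `Ω`, extended by zero to `g`. -/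
def ghostMap (t : HomogeneousBasis δ I) : g →ₗ[ℂ] Omega δ :=
  ∑ α : t.Pos, (t.basis.coord α).smulRight
    ((1 : UniversalEnvelopingAlgebra ℂ g) ⊗ₜ[ℂ] ghostC t α)

lemma ghostMap_apply (t : HomogeneousBasis δ I) (z : g) :
    ghostMap t z = ∑ α : t.Pos, t.basis.repr z α •
      ((1 : UniversalEnvelopingAlgebra ℂ g) ⊗ₜ[ℂ] ghostC t α) := by
  simp [ghostMap]

lemma ghostMap_basis (t : HomogeneousBasis δ I) (α : t.Pos) :
    ghostMap t (t.basis α) = (1 : UniversalEnvelopingAlgebra ℂ g) ⊗ₜ[ℂ] ghostC t α := by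
  rw [ghostMap_apply, Finset.sum_eq_single α]
  · simp
  · intro β _ hβ
    rw [Module.Basis.repr_self, Finsupp.single_eq_of_ne (fun h => hβ (Subtype.ext h)), zero_smul]
  · simp

lemma ghostMap_mem (t : HomogeneousBasis δ I) (z : g) :
    ∃ v : gPlus δ, ghostMap t z = (1 : UniversalEnvelopingAlgebra ℂ g) ⊗ₜ[ℂ] ghost v := by
  refine ⟨∑ α : t.Pos, t.basis.repr z α • ⟨t.basis α, t.mem_gPlus α.2⟩, ?_⟩
  rw [ghostMap_apply]
  simp only [← TensorProduct.tmul_smul, ← TensorProduct.tmul_sum]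
  congr 1
  have h : ∀ v : gPlus δ, ghost v = (CliffordAlgebra.ι (QuadraticForm.dualProd ℂ (gPlus δ)) ∘ₗ
    LinearMap.inr ℂ (Module.Dual ℂ (gPlus δ)) (gPlus δ)) v := fun v => rfl
  rw [h, map_sum]
  exact Finset.sum_congr rfl fun α _ => by rw [map_smul, ← h]; rfl

section Form

variable (K : LinearMap.BilinForm ℂ g) (hK : K.Nondegenerate) (hsymm : K.IsSymm)
  (hinv : ∀ x y z : g, K ⁅x, y⁆ z = K x ⁅y, z⁆) (t : HomogeneousBasis δ I)

/-- The projection to the part of negative degree. -/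
abbrev negProj : g →ₗ[ℂ] g :=
  lowerProj K (fun α : t.Pos => upper K hK t α) (fun α : t.Pos => t.basis α)

include hinv in
-- An element of degree `k < 0` pairs only with basis vectors of degree `-k > 0`, so restricting the
-- dual expansion to positive indices loses nothing.
lemma negProj_of_neg {k : ℤ} (hk : k < 0) {x : g} (hx : x ∈ degSub δ k) :
    negProj K hK t x = x := by
  conv_rhs => rw [← sum_form_basis_smul_upper K hK t x]
  rw [negProj, lowerProj_apply]
  refine sum_pos_eq t (fun a => K x (t.basis a) • upper K hK t a) fun a ha => ?_
  rw [form_eq_zero K hinv (by omega) hx (t.basis_mem a), zero_smul]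

lemma form_negProj_gPlus (x : g) {v : g} (hv : v ∈ gPlus δ) : K (negProj K hK t x) v = K x v := by
  rw [gPlus_eq_span t] at hv
  have h : Submodule.span ℂ (Set.range fun α : t.Pos => t.basis α)
      ≤ LinearMap.ker (K (negProj K hK t x) - K x) := by
    rw [Submodule.span_le]
    rintro _ ⟨α, rfl⟩
    rw [SetLike.mem_coe, LinearMap.mem_ker, LinearMap.sub_apply, sub_eq_zero, negProj,
      lowerProj_apply, map_sum, LinearMap.sum_apply, Finset.sum_eq_single α]
    · simp [form_upper_basis]
    · intro β _ hβ
      rw [map_smul, LinearMap.smul_apply, form_upper_basis,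
        if_neg fun h => hβ (Subtype.ext h).symm, smul_zero]
    · simp
  have := h hv
  rwa [LinearMap.mem_ker, LinearMap.sub_apply, sub_eq_zero] at this

include hsymm hinv in
/-- The BRST complex is a ghost system. -/
lemma ghostSystem (i : Sl2Embedding g) (hi : i.tplus ∈ degSub δ 1) :
    GhostSystem K i.tplus (fun α : t.Pos => upper K hK t α) (fun α : t.Pos => t.basis α)
      (currentMap δ) (antighostMap δ K) (ghostMap t) where
  symm := fun x y => hsymm.eq x y
  inv := hinv
  proj_lie α β := by
    have := α.2
    have := β.2
    exact negProj_of_neg K hK hinv t (k := -t.deg α + -t.deg β) (by omega)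
      (lie_mem_degSub (upper_mem K hK hinv t α) (upper_mem K hK hinv t β))
  form_proj x := by
    conv_rhs => rw [← sum_form_basis_smul_upper K hK t x]
    rw [lowerProj_apply, map_sum, map_sum]
    refine sum_pos_eq t (fun a => K i.tplus (K x (t.basis a) • upper K hK t a)) fun a ha => ?_
    rw [map_smul, form_eq_zero K hinv (by omega) hi (upper_mem K hK hinv t a), smul_zero]
  form_lie α β := by
    have := α.2
    have := β.2
    exact form_eq_zero K hinv (by omega) hi
      (lie_mem_degSub (upper_mem K hK hinv t α) (upper_mem K hK hinv t β))
  J_lie x y := by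
    simp only [currentMap_apply, Algebra.TensorProduct.tmul_mul_tmul, LieHom.map_lie,
      LieRing.of_associative_ring_bracket, TensorProduct.sub_tmul, mul_one]
  J_b x y := by
    simp only [currentMap_apply, antighostMap_apply, Algebra.TensorProduct.tmul_mul_tmul, mul_one,
      one_mul]
  J_c x y := by
    obtain ⟨v, hv⟩ := ghostMap_mem t y
    simp only [currentMap_apply, hv, Algebra.TensorProduct.tmul_mul_tmul, mul_one, one_mul]
  b_b x y := by
    simp only [antighostMap_apply, Algebra.TensorProduct.tmul_mul_tmul, mul_one]
    rw [antighost_mul_self_swap, TensorProduct.tmul_neg]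
  c_c x y := by
    obtain ⟨v, hv⟩ := ghostMap_mem t x
    obtain ⟨w, hw⟩ := ghostMap_mem t y
    simp only [hv, hw, Algebra.TensorProduct.tmul_mul_tmul, mul_one]
    rw [ghost_mul_self_swap, TensorProduct.tmul_neg]
  b_c x α := by
    rw [ghostMap_basis, antighostMap_apply, Algebra.TensorProduct.tmul_mul_tmul,
      Algebra.TensorProduct.tmul_mul_tmul, ← TensorProduct.tmul_add, mul_one, ghostC,
      antighost_mul_ghost_add, Algebra.algebraMap_eq_smul_one, TensorProduct.tmul_smul,
      ← Algebra.TensorProduct.one_def, ← Algebra.algebraMap_eq_smul_one]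
    rfl
  b_proj x := by
    rw [antighostMap_apply, antighostMap_apply]
    congr 2
    ext v
    exact form_negProj_gPlus K hK t x v.2
  c_eq z := by
    rw [ghostMap_apply]
    exact Finset.sum_congr rfl fun α _ => by rw [ghostMap_basis, repr_eq_form_upper K hK]

lemma antighostMap_upper (α : t.Pos) :
    antighostMap δ K (upper K hK t α)
      = (1 : UniversalEnvelopingAlgebra ℂ g) ⊗ₜ[ℂ] antighostB t α := by
  rw [antighostMap_apply, antighostB]
  congr 2
  ext v
  exact (repr_eq_form_upper K hK t v α).symm

include hsymm hinv in
-- `χ(J^α)` equals `K(t₊, t^α)`, and the sum over `γ` of `f^{αβ}_γ b^γ` is the antighost of `[t^α,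
-- t^β]`, because antighosts see only the negative part.
lemma charge_eq_ghostCharge (i : Sl2Embedding g) (hi : i.tplus ∈ degSub δ 1) :
    charge i K hK t = ghostCharge K i.tplus (fun α : t.Pos => upper K hK t α)
      (fun α : t.Pos => t.basis α) (currentMap δ) (antighostMap δ K) (ghostMap t) := by
  have H := ghostSystem K hK hsymm hinv t i hi
  rw [charge, ghostCharge]
  congr 1
  · refine Finset.sum_congr rfl fun α _ => ?_
    rw [ghostMap_basis, currentMap_apply, current, chi, repr_eq_form_upper K hK, hsymm.eq,
      Algebra.TensorProduct.algebraMap_apply, ← TensorProduct.sub_tmul,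
      Algebra.TensorProduct.tmul_mul_tmul, mul_one, one_mul]
  · congr 1
    refine Finset.sum_congr rfl fun α _ => Finset.sum_congr rfl fun β _ => ?_
    rw [← H.b_proj, lowerProj_apply, map_sum, Finset.sum_mul]
    refine Finset.sum_congr rfl fun γ _ => ?_
    rw [map_smul, antighostMap_upper, ghostMap_basis, ghostMap_basis, smul_mul_assoc,
      structureConst]
    congr 1
    · exact LinearMap.BilinForm.dualBasis_repr_apply ..
    · simp only [Algebra.TensorProduct.tmul_mul_tmul, mul_one, mul_assoc]

end Form

end

end FiniteW

namespace FiniteW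

noncomputable section

/-! ### Weights in a ghost system -/

set_option linter.unusedSectionVars false

section GhostSystem

variable {g : Type*} [LieRing g] [LieAlgebra ℂ g] {S A : Type*} [Fintype S] [Ring A] [Algebra ℂ A]
  {K : LinearMap.BilinForm ℂ g} {e : g} {u v : S → g} {J b c : g →ₗ[ℂ] A} {δ : g}
  {E : Type*} [Fintype E] [DecidableEq E]

/-- The generators of a ghost system: corrected currents attached to a basis and shifted by
scalars `s`, antighosts and ghosts. -/
def ghostGen (u v : S → g) (J b c : g →ₗ[ℂ] A) (t : HomogeneousBasis δ E) (s : E → ℂ) :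
    E ⊕ (S ⊕ S) → A :=
  Sum.elim (fun a => ghostCurrent u v J b c (t.basis a) - algebraMap ℂ A (s a))
    (Sum.elim (fun α => b (u α)) (fun α => c (v α)))

/-- The weights of the generators of a ghost system. -/
def ghostWt (t : HomogeneousBasis δ E) (m : S → ℤ) : E ⊕ (S ⊕ S) → ℕ :=
  Sum.elim (fun a => 2 * (t.deg a).toNat + 1)
    (Sum.elim (fun _ => 1) (fun α => 2 * (m α).toNat - 1))

namespace GhostSystem

variable (H : GhostSystem K e u v J b c) (t : HomogeneousBasis δ E) (s : E → ℂ) {m : S → ℤ}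
  (hm : ∀ α, 0 < m α) (hu : ∀ α, u α ∈ degSub δ (-m α)) (hv : ∀ α, v α ∈ degSub δ (m α))
  (hproj : ∀ k < 0, ∀ x ∈ degSub δ k, lowerProj K u v x = x)

include H in
lemma b_mem_wordFil (x : g) : b x ∈ wordFil (ghostGen u v J b c t s) (ghostWt t m) 2 := by
  rw [← H.b_proj, lowerProj_apply, map_sum]
  refine sum_mem fun α _ => ?_
  rw [map_smul]
  exact Submodule.smul_mem _ _ (gen_mem_wordFil (gen := ghostGen u v J b c t s)
    (a := Sum.inr (Sum.inl α)) (by simp [ghostWt]))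

include H hm hu in
-- A ghost of degree `k > 0` has weight `2k - 1`. For `k ≤ 0` the bound is `0`, which says that `c
-- z` vanishes.
lemma c_mem_wordFil {k : ℤ} {z : g} (hz : z ∈ degSub δ k) :
    c z ∈ wordFil (ghostGen u v J b c t s) (ghostWt t m) (2 * k.toNat) := by
  rw [H.c_eq]
  refine sum_mem fun α _ => ?_
  by_cases hk : m α = k
  · have := hm α
    exact Submodule.smul_mem _ _ (gen_mem_wordFil (gen := ghostGen u v J b c t s)
      (a := Sum.inr (Sum.inr α)) (by simp only [ghostWt, Sum.elim_inr, hk]; omega))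
  · rw [form_eq_zero K H.inv (by omega) (hu α) hz, zero_smul]
    exact zero_mem _

lemma ghostCurrent_mem_wordFil {k : ℤ} {y : g} (hy : y ∈ degSub δ k) :
    ghostCurrent u v J b c y
      ∈ wordFil (ghostGen u v J b c t s) (ghostWt t m) (2 * k.toNat + 2) := by
  rw [← t.basis.sum_repr y, map_sum]
  refine sum_mem fun a _ => ?_
  by_cases ha : t.deg a = k
  · rw [map_smul, ← sub_add_cancel (ghostCurrent u v J b c (t.basis a)) (algebraMap ℂ A (s a))]
    exact Submodule.smul_mem _ _ (add_mem (gen_mem_wordFil (gen := ghostGen u v J b c t s)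
      (a := Sum.inl a) (by simp [ghostWt, ha])) (algebraMap_mem_wordFil _ (Nat.succ_pos _)))
  · rw [t.repr_eq_zero hy ha, zero_smul, map_zero]
    exact zero_mem _

include H hm hv in
lemma sub_lowerProj_eq {k : ℤ} (hk : 0 ≤ k) {x : g} (hx : x ∈ degSub δ k) :
    x - lowerProj K u v x = x := by
  rw [sub_eq_self, lowerProj_apply]
  refine Finset.sum_eq_zero fun α _ => ?_
  have := hm α
  rw [form_eq_zero K H.inv (by omega) hx (hv α), zero_smul]

include H hm hu hv hproj in
-- The term is present only if `j ≥ m β`, and then its weight is at most `1 + (2 m β - 1) = 2 m β ≤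
-- 2j`.
lemma b_mul_c_mem {j : ℤ} {y : g} (hy : y ∈ degSub δ j) (y' : g) (β : S) :
    b ⁅y', ⁅y, u β⁆ - lowerProj K u v ⁅y, u β⁆⁆ * c (v β)
      ∈ wordFil (ghostGen u v J b c t s) (ghostWt t m) (2 * j.toNat + 1) := by
  have := hm β
  by_cases hj : 0 ≤ j - m β
  · refine mul_mem_wordFil ?_ (H.b_mem_wordFil t s _) (H.c_mem_wordFil t s hm hu (hv β))
    omega
  · rw [hproj _ (by omega) _ (lie_mem_degSub hy (hu β)), sub_self, lie_zero, map_zero, zero_mul]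
    exact zero_mem _

include H hm hu hv hproj in
-- The summand `1` in the weight `2 max(k, 0) + 1` provides the slack: the bracket has weight at
-- most `2 max(j, 0) + 2 max(j', 0) + 1`, one less than the product.
lemma ghostCurrent_lie_mem {j j' : ℤ} {y y' : g} (hy : y ∈ degSub δ j) (hy' : y' ∈ degSub δ j') :
    ghostCurrent u v J b c y * ghostCurrent u v J b c y'
        - ghostCurrent u v J b c y' * ghostCurrent u v J b c y
      ∈ wordFil (ghostGen u v J b c t s) (ghostWt t m) (2 * j.toNat + 1 + (2 * j'.toNat + 1)) := by
  rw [H.ghostCurrent_lie]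
  refine add_mem (wordFil_mono (by omega)
    (ghostCurrent_mem_wordFil t s (lie_mem_degSub hy hy'))) (sum_mem fun β _ => ?_)
  rw [sub_mul]
  exact sub_mem (wordFil_mono (by omega) (H.b_mul_c_mem t s hm hu hv hproj hy y' β))
    (wordFil_mono (by omega) (H.b_mul_c_mem t s hm hu hv hproj hy' y β))

include H hm hu hv hproj in
lemma ghostGen_even_even (a a' : E) :
    ghostGen u v J b c t s (Sum.inl a) * ghostGen u v J b c t s (Sum.inl a')
        - ghostGen u v J b c t s (Sum.inl a') * ghostGen u v J b c t s (Sum.inl a)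
      ∈ wordFil (ghostGen u v J b c t s) (ghostWt t m)
        (ghostWt t m (Sum.inl a) + ghostWt t m (Sum.inl a')) := by
  have h := H.ghostCurrent_lie_mem t s hm hu hv hproj (t.basis_mem a) (t.basis_mem a')
  have h0 : ∀ (x y : A) (r q : ℂ), (x - algebraMap ℂ A r) * (y - algebraMap ℂ A q)
      - (y - algebraMap ℂ A q) * (x - algebraMap ℂ A r) = x * y - y * x := by
    intro x y r q
    simp only [sub_mul, mul_sub]
    rw [Algebra.commutes r y, Algebra.commutes q x, Algebra.commutes r]
    abel
  simp only [ghostGen, Sum.elim_inl]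
  rw [h0]
  exact h

include H hm hu hv in
lemma ghostGen_odd_even (o : S ⊕ S) (a : E) :
    ghostGen u v J b c t s (Sum.inr o) * ghostGen u v J b c t s (Sum.inl a)
        - ghostGen u v J b c t s (Sum.inl a) * ghostGen u v J b c t s (Sum.inr o)
      ∈ wordFil (ghostGen u v J b c t s) (ghostWt t m)
        (ghostWt t m (Sum.inr o) + ghostWt t m (Sum.inl a)) := by
  have h0 : ∀ x y z : A, x * (y - algebraMap ℂ A (s a)) - (y - algebraMap ℂ A (s a)) * x
      = -(y * x - x * y) := by
    intro x y z
    rw [mul_sub, sub_mul, Algebra.commutes]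
    abel
  rcases o with α | α
  · simp only [ghostGen, Sum.elim_inl, Sum.elim_inr]
    rw [h0 _ _ 0, H.ghostCurrent_lie_b]
    exact neg_mem (wordFil_mono (by simp only [ghostWt, Sum.elim_inl, Sum.elim_inr]; omega)
      (H.b_mem_wordFil t s _))
  · simp only [ghostGen, Sum.elim_inl, Sum.elim_inr]
    rw [h0 _ _ 0, H.ghostCurrent_lie_c]
    have := hm α
    exact neg_mem (wordFil_mono (by simp only [ghostWt, Sum.elim_inl, Sum.elim_inr]; omega)
      (H.c_mem_wordFil t s hm hu (lie_mem_degSub (t.basis_mem a) (hv α))))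

include H hm hu hv hproj in
/-- The differential of a corrected current, up to lower weight. -/
lemma charge_lie_ghostCurrent_sub_mem {j : ℤ} {y : g} (hy : y ∈ degSub δ j) :
    ghostCharge K e u v J b c * ghostCurrent u v J b c y
        - ghostCurrent u v J b c y * ghostCharge K e u v J b c - c ⁅y, e⁆
      ∈ wordFil (ghostGen u v J b c t s) (ghostWt t m) (2 * j.toNat + 1) := by
  rw [H.charge_lie_ghostCurrent, add_sub_cancel_right]
  refine sum_mem fun α _ => ?_
  have := hm α
  have h1 := lie_mem_degSub (hu α) hy
  -- If `j ≥ m α` the product has weight at most `2 (j - m α) + 1 + (2 m α - 1) = 2j`. Otherwise the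
  -- bracket is negative and is removed by the projection.
  by_cases hj : 0 ≤ -m α + j
  · rw [H.sub_lowerProj_eq hm hv hj h1]
    refine mul_mem_wordFil ?_ (ghostCurrent_mem_wordFil t s h1) (H.c_mem_wordFil t s hm hu (hv α))
    omega
  · rw [hproj _ (by omega) _ h1, sub_self, map_zero, zero_mul]
    exact zero_mem _

include H hm hu hv in
/-- The differential of a ghost is of lower weight. -/
lemma charge_mul_c_mem (α : S) :
    ghostCharge K e u v J b c * c (v α) + c (v α) * ghostCharge K e u v J b c
      ∈ wordFil (ghostGen u v J b c t s) (ghostWt t m) (2 * (m α).toNat - 1) := by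
  rw [H.charge_mul_c]
  refine neg_mem (Submodule.smul_mem _ _ (sum_mem fun β _ => sum_mem fun γ _ => ?_))
  have := hm β
  have := hm γ
  -- The weight of the two ghosts is `(2 m β - 1) + (2 m γ - 1) = 2 m α - 2`, one below that of `c
  -- (v α)`.
  by_cases h : m β + m γ = m α
  · refine Submodule.smul_mem _ _ (mul_mem_wordFil ?_ (H.c_mem_wordFil t s hm hu (hv β))
      (H.c_mem_wordFil t s hm hu (hv γ)))
    omega
  · rw [form_eq_zero K H.inv (by omega) (lie_mem_degSub (hu β) (hu γ)) (hv α), zero_smul]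
    exact zero_mem _

end GhostSystem

end GhostSystem

end

end FiniteW

namespace FiniteW

noncomputable section

set_option linter.unusedSectionVars false

attribute [local instance] LieRing.ofAssociativeRing

/-! ### Bijectivity of quantization -/

section Bijective

variable {A : Type*} [Ring A] [Algebra ℂ A] {E O : Type*} {Λ : Type*} [Ring Λ] [Algebra ℂ Λ]

lemma monomialProd_map {B : Type*} [Ring B] [Algebra ℂ B] (f : A →ₐ[ℂ] B) (g : E → A)
    (p : MvPolynomial E ℂ) : monomialProd (f ∘ g) p = f (monomialProd g p) := by
  have : monomialProd (f ∘ g) = f.toLinearMap ∘ₗ monomialProd g := by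
    refine (MvPolynomial.basisMonomials E ℂ).ext fun m => ?_
    rw [MvPolynomial.coe_basisMonomials, monomialProd_monomial, LinearMap.comp_apply,
      monomialProd_monomial, wordProd, wordProd, AlgHom.toLinearMap_apply, map_list_prod,
      List.map_map]
  rw [this]
  rfl

/-- A perturbation of a linear bijection by lower order terms for an exhaustive filtration that
starts at zero is bijective. -/
lemma bijective_of_sub_mem {P V : Type*} [AddCommGroup P] [Module ℂ P] [AddCommGroup V]
    [Module ℂ V] {f f' : P →ₗ[ℂ] V} {F : ℕ → Submodule ℂ P} (hf' : Function.Bijective f')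
    (h0 : F 0 = ⊥) (hF : ∀ p, ∃ n, p ∈ F n)
    (h : ∀ n, ∀ p ∈ F (n + 1), f p - f' p ∈ (F n).map f') : Function.Bijective f := by
  constructor
  · rw [← LinearMap.ker_eq_bot, LinearMap.ker_eq_bot']
    intro p hp
    have key : ∀ n, p ∈ F n → p = 0 := by
      intro n
      induction n with
      | zero => intro hn; simpa [h0] using hn
      | succ n ih =>
        intro hn
        obtain ⟨r, hr, hrp⟩ := h n p hn
        rw [hp, zero_sub, ← map_neg] at hrp
        have := hf'.1 hrp
        exact ih (by rw [← neg_mem_iff, ← this]; exact hr)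
    obtain ⟨n, hn⟩ := hF p
    exact key n hn
  · have key : ∀ n, ∀ p ∈ F n, f' p ∈ LinearMap.range f := by
      intro n
      induction n with
      | zero => intro p hn; simp [h0] at hn; simp [hn]
      | succ n ih =>
        intro p hn
        obtain ⟨r, hr, hrp⟩ := h n p hn
        have := sub_mem (LinearMap.mem_range_self f p) (hrp ▸ ih r hr)
        simpa using this
    intro x
    obtain ⟨p, rfl⟩ := hf'.2 x
    obtain ⟨n, hn⟩ := hF p
    exact key n p hn

/-- Changing the even letters by lower order terms preserves the bijectivity of quantization. -/
lemma IsAlmostCommutative.quantize_bijective [DecidableEq E] {gen gen' : E ⊕ O → A} {θ : O → Λ}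
    {q : Λ →ₗ[ℂ] A} {wt : E ⊕ O → ℕ} (H : IsAlmostCommutative gen' θ q wt)
    (hgen : ∀ a, gen (Sum.inl a) - gen' (Sum.inl a) ∈ wordFil gen' wt (wt (Sum.inl a)))
    (hbij : Function.Bijective (quantize gen' q)) (hex : ∀ p, ∃ n, p ∈ symbolFil θ wt n) :
    Function.Bijective (quantize gen q) := by
  refine bijective_of_sub_mem (F := symbolFil θ wt) hbij wordFil_zero hex fun n p hp => ?_
  rw [H.map_quantize]
  refine Submodule.span_induction (p := fun p _ => quantize gen q p - quantize gen' q p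
    ∈ wordFil gen' wt n) ?_ (by simp) (fun x y _ _ hx hy => ?_) (fun c x _ hx => ?_) hp
  rotate_left
  · rw [map_add, map_add, add_sub_add_comm]
    exact add_mem hx hy
  · rw [map_smul, map_smul, ← smul_sub]
    exact Submodule.smul_mem _ _ hx
  rintro _ ⟨w, hw, rfl⟩
  obtain ⟨l, l', h, hwt, -⟩ := exists_wordProd_symbolGen θ wt w
  rw [h, quantize_tmul, quantize_tmul, ← sub_mul, monomialProd_monomial, monomialProd_monomial]
  have h1 := (wordProd_sub_wordProd_mem (gen := gen') (wt := wt) (g := gen' ∘ Sum.inl)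
    (g' := gen ∘ Sum.inl) (ω := wt ∘ Sum.inl)
    (fun a => gen_mem_wordFil (Nat.lt_succ_self _)) hgen
    (Finsupp.toMultiset (listExp l)).toList).2
  rw [wordWt_perm _ (toList_listExp_perm l)] at h1
  exact mul_mem_wordFil (by omega) h1 (H.q_mem l')

end Bijective

/-! ### Quantization of the exterior algebra -/

section Contraction

variable {W O : Type*} [AddCommGroup W] [Module ℂ W]

/-- Contraction removes one letter, and only letters on which `d` does not vanish can be removed. -/
lemma contractLeft_wordProd_mem (w : O → W) (d : Module.Dual ℂ W) (l : List O) :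
    CliffordAlgebra.contractLeft (Q := (0 : QuadraticForm ℂ W)) d
        (wordProd (fun o => ExteriorAlgebra.ι ℂ (w o)) l)
      ∈ Submodule.span ℂ {x | ∃ (o : O) (l' : List O), d (w o) ≠ 0 ∧ l.Perm (o :: l') ∧
        wordProd (fun o => ExteriorAlgebra.ι ℂ (w o)) l' = x} := by
  induction l with
  | nil =>
    rw [wordProd_nil, CliffordAlgebra.contractLeft_one]
    exact zero_mem _
  | cons a l ih =>
    rw [wordProd_cons, ExteriorAlgebra.ι, CliffordAlgebra.contractLeft_ι_mul]
    refine sub_mem ?_ ?_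
    · by_cases h : d (w a) = 0
      · rw [h, zero_smul]
        exact zero_mem _
      · exact Submodule.smul_mem _ _ (Submodule.subset_span ⟨a, l, h, List.Perm.refl _, rfl⟩)
    · have h := Submodule.mem_map_of_mem
        (f := LinearMap.mulLeft ℂ (ExteriorAlgebra.ι ℂ (w a))) ih
      rw [Submodule.map_span] at h
      refine Submodule.span_mono ?_ h
      rintro _ ⟨_, ⟨o, l', ho, hp, rfl⟩, rfl⟩
      exact ⟨o, a :: l', ho, (hp.cons a).trans (List.Perm.swap _ _ _), by simp⟩

end Contraction

section Ghosts

variable {g : Type*} [LieRing g] [LieAlgebra ℂ g] {δ : g} {I : Type*}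

/-- The bilinear form `((φ, v), (ψ, w)) ↦ φ w`. -/
def ghostForm (δ : g) : LinearMap.BilinForm ℂ (Module.Dual ℂ (gPlus δ) × gPlus δ) :=
  (LinearMap.id : Module.Dual ℂ (gPlus δ) →ₗ[ℂ] Module.Dual ℂ (gPlus δ)).compl₁₂
    (LinearMap.fst ℂ _ _) (LinearMap.snd ℂ _ _)

lemma ghostForm_apply (x y : Module.Dual ℂ (gPlus δ) × gPlus δ) : ghostForm δ x y = x.1 y.2 := rfl

lemma ghostForm_toQuadraticMap (δ : g) : (ghostForm δ).toQuadraticMap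
    = QuadraticForm.dualProd ℂ (gPlus δ) - 0 := by
  ext x
  simp [ghostForm_apply]

/-- Normal ordering, from the exterior algebra to the Clifford algebra. -/
def ghostQuant (δ : g) :
    ExteriorAlgebra ℂ (Module.Dual ℂ (gPlus δ) × gPlus δ) ≃ₗ[ℂ] Ghosts δ :=
  CliffordAlgebra.changeFormEquiv (ghostForm_toQuadraticMap δ)

lemma ghostQuant_one : ghostQuant δ 1 = 1 :=
  CliffordAlgebra.changeForm_one (ghostForm_toQuadraticMap δ)

/-- Wick's rule: multiplication by a generator differs from its normally ordered version by a single
contraction. -/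
lemma ι_mul_ghostQuant (m : Module.Dual ℂ (gPlus δ) × gPlus δ)
    (ω : ExteriorAlgebra ℂ (Module.Dual ℂ (gPlus δ) × gPlus δ)) :
    CliffordAlgebra.ι (QuadraticForm.dualProd ℂ (gPlus δ)) m * ghostQuant δ ω
      - ghostQuant δ (ExteriorAlgebra.ι ℂ m * ω)
      = ghostQuant δ (CliffordAlgebra.contractLeft (Q := (0 : QuadraticForm ℂ _))
          (ghostForm δ m) ω) := by
  have h1 := CliffordAlgebra.changeForm_ι_mul (ghostForm_toQuadraticMap δ) m ω
  have h2 := CliffordAlgebra.changeForm_contractLeft (ghostForm_toQuadraticMap δ)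
    (ghostForm δ m) ω
  rw [← h2] at h1
  exact sub_eq_of_eq_add' (sub_eq_iff_eq_add.1 h1.symm)

/-- Normal ordering, with values in `Ω`. -/
def omegaQuant (δ : g) :
    ExteriorAlgebra ℂ (Module.Dual ℂ (gPlus δ) × gPlus δ) →ₗ[ℂ] Omega δ :=
  (Algebra.TensorProduct.includeRight : Ghosts δ →ₐ[ℂ] Omega δ).toLinearMap ∘ₗ
    (ghostQuant δ).toLinearMap

lemma omegaQuant_apply (ω : ExteriorAlgebra ℂ (Module.Dual ℂ (gPlus δ) × gPlus δ)) :
    omegaQuant δ ω = (1 : UniversalEnvelopingAlgebra ℂ g) ⊗ₜ[ℂ] ghostQuant δ ω := rfl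

lemma omegaQuant_one : omegaQuant δ 1 = 1 := by
  rw [omegaQuant_apply, ghostQuant_one, Algebra.TensorProduct.one_def]

lemma mul_omegaQuant (m : Module.Dual ℂ (gPlus δ) × gPlus δ)
    (ω : ExteriorAlgebra ℂ (Module.Dual ℂ (gPlus δ) × gPlus δ)) :
    (1 : UniversalEnvelopingAlgebra ℂ g) ⊗ₜ[ℂ]
        CliffordAlgebra.ι (QuadraticForm.dualProd ℂ (gPlus δ)) m * omegaQuant δ ω
      - omegaQuant δ (ExteriorAlgebra.ι ℂ m * ω)
      = omegaQuant δ (CliffordAlgebra.contractLeft (Q := (0 : QuadraticForm ℂ _))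
          (ghostForm δ m) ω) := by
  rw [omegaQuant_apply, omegaQuant_apply, omegaQuant_apply, Algebra.TensorProduct.tmul_mul_tmul,
    one_mul, ← TensorProduct.tmul_sub, ι_mul_ghostQuant]

variable {E O : Type*} {gen : E ⊕ O → Omega δ} {w : O → Module.Dual ℂ (gPlus δ) × gPlus δ}
  (hgen : ∀ o, gen (Sum.inr o) = (1 : UniversalEnvelopingAlgebra ℂ g) ⊗ₜ[ℂ]
    CliffordAlgebra.ι (QuadraticForm.dualProd ℂ (gPlus δ)) (w o))
include hgen

/-- The two claims are proved by a joint induction on length: the correction in the second is a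
contraction, hence involves shorter words, and the second yields the first for words one letter
longer. -/
lemma omegaQuant_wordProd_mem {wt : E ⊕ O → ℕ} (hwt : ∀ o, 0 < wt (Sum.inr o)) (n : ℕ) :
    (∀ l : List O, l.length ≤ n →
      omegaQuant δ (wordProd (fun o => ExteriorAlgebra.ι ℂ (w o)) l)
        ∈ wordFil gen wt (wordWt (wt ∘ Sum.inr) l + 1)) ∧
    ∀ o, ∀ l : List O, l.length ≤ n + 1 →
      gen (Sum.inr o) * omegaQuant δ (wordProd (fun o => ExteriorAlgebra.ι ℂ (w o)) l)
        - omegaQuant δ (ExteriorAlgebra.ι ℂ (w o)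
          * wordProd (fun o => ExteriorAlgebra.ι ℂ (w o)) l)
        ∈ wordFil gen wt (wt (Sum.inr o) + wordWt (wt ∘ Sum.inr) l) := by
  have step : ∀ n, (∀ l : List O, l.length ≤ n →
      omegaQuant δ (wordProd (fun o => ExteriorAlgebra.ι ℂ (w o)) l)
        ∈ wordFil gen wt (wordWt (wt ∘ Sum.inr) l + 1)) →
    ∀ o, ∀ l : List O, l.length ≤ n + 1 →
      gen (Sum.inr o) * omegaQuant δ (wordProd (fun o => ExteriorAlgebra.ι ℂ (w o)) l)
        - omegaQuant δ (ExteriorAlgebra.ι ℂ (w o)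
          * wordProd (fun o => ExteriorAlgebra.ι ℂ (w o)) l)
        ∈ wordFil gen wt (wt (Sum.inr o) + wordWt (wt ∘ Sum.inr) l) := by
    intro n hn o l hl
    rw [hgen, mul_omegaQuant]
    have h := Submodule.mem_map_of_mem (f := omegaQuant δ)
      (contractLeft_wordProd_mem w (ghostForm δ (w o)) l)
    rw [Submodule.map_span] at h
    refine Submodule.span_le.2 ?_ h
    rintro _ ⟨_, ⟨o', l', -, hp, rfl⟩, rfl⟩
    have h1 := hp.length_eq
    have h2 := wordWt_perm (wt ∘ Sum.inr) hp
    simp only [List.length_cons, wordWt_cons, Function.comp_apply] at h1 h2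
    have h3 := hwt o
    have h4 := hwt o'
    exact wordFil_mono (by omega) (hn l' (by omega))
  induction n with
  | zero =>
    have h0 : ∀ l : List O, l.length ≤ 0 →
        omegaQuant δ (wordProd (fun o => ExteriorAlgebra.ι ℂ (w o)) l)
          ∈ wordFil gen wt (wordWt (wt ∘ Sum.inr) l + 1) := by
      intro l hl
      rw [List.eq_nil_of_length_eq_zero (Nat.le_zero.1 hl), wordProd_nil, omegaQuant_one]
      exact one_mem_wordFil (Nat.succ_pos _)
    exact ⟨h0, step 0 h0⟩
  | succ n ih =>
    have h1 : ∀ l : List O, l.length ≤ n + 1 →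
        omegaQuant δ (wordProd (fun o => ExteriorAlgebra.ι ℂ (w o)) l)
          ∈ wordFil gen wt (wordWt (wt ∘ Sum.inr) l + 1) := by
      intro l hl
      rcases l with _ | ⟨o, l⟩
      · exact ih.1 [] (Nat.zero_le _)
      · have hl' : l.length ≤ n := by simpa using hl
        have h2 := mul_mem_wordFil (k := wordWt (wt ∘ Sum.inr) (o :: l) + 1)
          (by simp; omega) (gen_mem_wordFil (gen := gen) (Nat.lt_succ_self (wt (Sum.inr o))))
          (ih.1 l hl')
        have h3 := sub_mem h2 (wordFil_mono (n := wordWt (wt ∘ Sum.inr) (o :: l) + 1) (by simp)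
          (ih.2 o l (by omega)))
        rw [wordProd_cons]
        rwa [sub_sub_cancel] at h3
    exact ⟨h1, step _ h1⟩

lemma omegaQuant_odd_mem {wt : E ⊕ O → ℕ} (hwt : ∀ o, 0 < wt (Sum.inr o)) (o : O) (l : List O) :
    gen (Sum.inr o) * omegaQuant δ (wordProd (fun o => ExteriorAlgebra.ι ℂ (w o)) l)
        - omegaQuant δ (ExteriorAlgebra.ι ℂ (w o)
          * wordProd (fun o => ExteriorAlgebra.ι ℂ (w o)) l)
      ∈ wordFil gen wt (wt (Sum.inr o) + wordWt (wt ∘ Sum.inr) l) :=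
  (omegaQuant_wordProd_mem hgen hwt l.length).2 o l (Nat.le_succ _)

end Ghosts

end

end FiniteW

namespace FiniteW

noncomputable section

set_option linter.unusedSectionVars false

attribute [local instance] LieRing.ofAssociativeRing

/-! ### The grading of `Ω` by ghost number -/

variable {g : Type*} [LieRing g] [LieAlgebra ℂ g] {δ : g}

lemma tmul_ghostMonomial_mem (u : UniversalEnvelopingAlgebra ℂ g)
    (w : List (gPlus δ ⊕ Module.Dual ℂ (gPlus δ))) :
    u ⊗ₜ[ℂ] ghostMonomial w ∈ omegaDeg δ (ghostNumber w) :=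
  Submodule.subset_span ⟨u, w, rfl, rfl⟩

lemma tmul_one_mem_omegaDeg (u : UniversalEnvelopingAlgebra ℂ g) :
    u ⊗ₜ[ℂ] (1 : Ghosts δ) ∈ omegaDeg δ 0 :=
  tmul_ghostMonomial_mem u []

lemma one_mem_omegaDeg : (1 : Omega δ) ∈ omegaDeg δ 0 :=
  tmul_one_mem_omegaDeg 1

lemma tmul_ghost_mem_omegaDeg (u : UniversalEnvelopingAlgebra ℂ g) (v : gPlus δ) :
    u ⊗ₜ[ℂ] ghost v ∈ omegaDeg δ 1 := by
  simpa [ghostMonomial, ghostNumber] using tmul_ghostMonomial_mem u [Sum.inl v]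

lemma tmul_antighost_mem_omegaDeg (u : UniversalEnvelopingAlgebra ℂ g)
    (φ : Module.Dual ℂ (gPlus δ)) : u ⊗ₜ[ℂ] antighost φ ∈ omegaDeg δ (-1) := by
  simpa [ghostMonomial, ghostNumber] using tmul_ghostMonomial_mem u [Sum.inr φ]

lemma mul_mem_omegaDeg {j k : ℤ} {X Y : Omega δ} (hX : X ∈ omegaDeg δ j)
    (hY : Y ∈ omegaDeg δ k) : X * Y ∈ omegaDeg δ (j + k) := by
  have h := Submodule.mul_mem_mul hX hY
  rw [omegaDeg, omegaDeg, Submodule.span_mul_span] at h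
  refine Submodule.span_mono ?_ h
  rintro _ ⟨_, ⟨u, w, rfl, rfl⟩, _, ⟨u', w', rfl, rfl⟩, rfl⟩
  exact ⟨u * u', w ++ w', by simp [ghostNumber], by
    simp [ghostMonomial, Algebra.TensorProduct.tmul_mul_tmul]⟩

lemma iSup_omegaDeg : ⨆ k, omegaDeg δ k = ⊤ := by
  have hmul : ∀ (j : ℤ) (X : Omega δ), X ∈ omegaDeg δ j → ∀ Y ∈ ⨆ k, omegaDeg δ k,
      X * Y ∈ ⨆ k, omegaDeg δ k := by
    intro j X hX Y hY
    have : ⨆ k, omegaDeg δ k ≤ (⨆ k, omegaDeg δ k).comap (LinearMap.mulLeft ℂ X) :=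
      iSup_le fun k Z hZ => Submodule.mem_iSup_of_mem (j + k) (mul_mem_omegaDeg hX hZ)
    exact this hY
  refine top_le_iff.1 fun X _ => ?_
  induction X using TensorProduct.induction_on with
  | zero => exact zero_mem _
  | add X Y hX hY => exact add_mem (hX trivial) (hY trivial)
  | tmul u y =>
    induction y using CliffordAlgebra.left_induction with
    | algebraMap r =>
      rw [Algebra.algebraMap_eq_smul_one, TensorProduct.tmul_smul]
      exact Submodule.smul_mem _ _ (Submodule.mem_iSup_of_mem 0 (tmul_one_mem_omegaDeg u))
    | add x y hx hy =>
      rw [TensorProduct.tmul_add]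
      exact add_mem (hx trivial) (hy trivial)
    | ι_mul x m hx =>
      have h : u ⊗ₜ[ℂ] (CliffordAlgebra.ι (QuadraticForm.dualProd ℂ (gPlus δ)) m * x)
          = ((1 : UniversalEnvelopingAlgebra ℂ g) ⊗ₜ[ℂ] antighost m.1
            + (1 : UniversalEnvelopingAlgebra ℂ g) ⊗ₜ[ℂ] ghost m.2) * (u ⊗ₜ[ℂ] x) := by
        rw [← TensorProduct.tmul_add, Algebra.TensorProduct.tmul_mul_tmul, one_mul, antighost,
          ghost, ← map_add]
        simp
      rw [h, add_mul]
      exact add_mem (hmul _ _ (tmul_antighost_mem_omegaDeg _ _) _ (hx trivial))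
        (hmul _ _ (tmul_ghost_mem_omegaDeg _ _) _ (hx trivial))

variable {I : Type*} [Fintype I] [DecidableEq I] (t : HomogeneousBasis δ I)

lemma repr_sum_gPlus (v : gPlus δ) :
    ∑ α : t.Pos, t.basis.repr v α • (⟨t.basis α, t.mem_gPlus α.2⟩ : gPlus δ) = v := by
  have h : Submodule.span ℂ (Set.range fun α : t.Pos => t.basis α)
      ≤ LinearMap.ker ((∑ α : t.Pos, (t.basis.coord α).smulRight (t.basis α)) - LinearMap.id) := by
    rw [Submodule.span_le]
    rintro _ ⟨α, rfl⟩
    rw [SetLike.mem_coe, LinearMap.mem_ker, LinearMap.sub_apply, sub_eq_zero,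
      LinearMap.sum_apply, Finset.sum_eq_single α]
    · simp
    · intro β _ hβ
      simp [Finsupp.single_eq_of_ne fun h => hβ (Subtype.ext h)]
    · simp
  rw [← gPlus_eq_span t] at h
  have hv := h v.2
  rw [LinearMap.mem_ker, LinearMap.sub_apply, sub_eq_zero] at hv
  ext
  simpa using hv

/-- The ghost number operator. -/
def ghostNumberOp : Ghosts δ := ∑ α : t.Pos, ghostC t α * antighostB t α

lemma ghostNumberOp_lie_ghost (v : gPlus δ) :
    ghostNumberOp t * ghost v - ghost v * ghostNumberOp t = ghost v := by
  have h1 : ∀ α : t.Pos, ghostC t α * antighostB t α * ghost v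
      - ghost v * (ghostC t α * antighostB t α) = t.basis.repr v α • ghostC t α := by
    intro α
    have h := antighost_mul_ghost_add ((t.basis.coord α).comp (gPlus δ).subtype) v
    rw [ghostC, antighostB, ← mul_assoc (ghost v), ghost_mul_self_swap v, mul_assoc,
      eq_sub_of_add_eq h, mul_sub, ← Algebra.commutes, ← Algebra.smul_def]
    simp only [neg_mul, mul_assoc]
    simp
  rw [ghostNumberOp, Finset.sum_mul, Finset.mul_sum, ← Finset.sum_sub_distrib,
    Finset.sum_congr rfl fun α _ => h1 α]
  conv_rhs => rw [← repr_sum_gPlus t v]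
  have h : ∀ v : gPlus δ, ghost v = (CliffordAlgebra.ι (QuadraticForm.dualProd ℂ (gPlus δ)) ∘ₗ
    LinearMap.inr ℂ (Module.Dual ℂ (gPlus δ)) (gPlus δ)) v := fun v => rfl
  rw [h, map_sum]
  exact Finset.sum_congr rfl fun α _ => by rw [map_smul, ← h]; rfl

lemma dual_gPlus_eq_sum (φ : Module.Dual ℂ (gPlus δ)) :
    ∑ α : t.Pos, φ ⟨t.basis α, t.mem_gPlus α.2⟩ • (t.basis.coord α).comp (gPlus δ).subtype
      = φ := by
  ext v
  conv_rhs => rw [← repr_sum_gPlus t v, map_sum]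
  rw [LinearMap.sum_apply]
  refine Finset.sum_congr rfl fun α _ => ?_
  rw [map_smul, LinearMap.smul_apply, smul_eq_mul, smul_eq_mul, mul_comm]
  rfl

lemma ghostNumberOp_lie_antighost (φ : Module.Dual ℂ (gPlus δ)) :
    ghostNumberOp t * antighost φ - antighost φ * ghostNumberOp t = -antighost φ := by
  have h1 : ∀ α : t.Pos, ghostC t α * antighostB t α * antighost φ
      - antighost φ * (ghostC t α * antighostB t α)
      = -(φ ⟨t.basis α, t.mem_gPlus α.2⟩ • antighostB t α) := by
    intro α
    have h := antighost_mul_ghost_add φ ⟨t.basis α, t.mem_gPlus α.2⟩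
    rw [ghostC, antighostB, ← mul_assoc (antighost φ), eq_sub_of_add_eq h, sub_mul,
      ← Algebra.smul_def, mul_assoc, antighost_mul_self_swap _ φ, mul_neg, mul_assoc]
    abel
  rw [ghostNumberOp, Finset.sum_mul, Finset.mul_sum, ← Finset.sum_sub_distrib,
    Finset.sum_congr rfl fun α _ => h1 α, Finset.sum_neg_distrib, neg_inj]
  conv_rhs => rw [← dual_gPlus_eq_sum t φ]
  have h : ∀ φ : Module.Dual ℂ (gPlus δ), antighost φ
    = (CliffordAlgebra.ι (QuadraticForm.dualProd ℂ (gPlus δ)) ∘ₗ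
    LinearMap.inl ℂ (Module.Dual ℂ (gPlus δ)) (gPlus δ)) φ := fun φ => rfl
  rw [h, map_sum]
  exact Finset.sum_congr rfl fun α _ => by rw [map_smul, ← h]; rfl

lemma ghostNumberOp_lie_ghostMonomial (w : List (gPlus δ ⊕ Module.Dual ℂ (gPlus δ))) :
    ghostNumberOp t * ghostMonomial w - ghostMonomial w * ghostNumberOp t
      = (ghostNumber w : ℂ) • ghostMonomial w := by
  induction w with
  | nil => simp [ghostMonomial, ghostNumber]
  | cons a w ih =>
    have hder : ∀ (N x y : Ghosts δ), N * (x * y) - x * y * N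
        = (N * x - x * N) * y + x * (N * y - y * N) := by
      intro N x y; noncomm_ring
    have hc : ghostMonomial (a :: w) = Sum.elim ghost antighost a * ghostMonomial w := by
      simp [ghostMonomial]
    rw [hc, hder, ih]
    rcases a with v | φ
    · rw [Sum.elim_inl, ghostNumberOp_lie_ghost]
      simp [ghostNumber, add_smul]
    · rw [Sum.elim_inr, ghostNumberOp_lie_antighost]
      simp [ghostNumber, add_smul]

include t in
-- `Ω^k` lies in the eigenspace of the commutator with the ghost number operator for the eigenvalue
-- `k`, and eigenspaces for distinct eigenvalues are independent.
lemma isInternal_omegaDeg : DirectSum.IsInternal (omegaDeg δ) := by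
  rw [DirectSum.isInternal_submodule_iff_iSupIndep_and_iSup_eq_top]
  refine ⟨?_, iSup_omegaDeg⟩
  set N : Omega δ := (1 : UniversalEnvelopingAlgebra ℂ g) ⊗ₜ[ℂ] ghostNumberOp t
  have h1 := (Module.End.eigenspaces_iSupIndep
    (LinearMap.mulLeft ℂ N - LinearMap.mulRight ℂ N)).comp (Int.cast_injective (α := ℂ))
  refine h1.mono fun k => Submodule.span_le.2 ?_
  rintro _ ⟨u, w, rfl, rfl⟩
  rw [SetLike.mem_coe, Function.comp_apply, Module.End.mem_eigenspace_iff, LinearMap.sub_apply,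
    LinearMap.mulLeft_apply, LinearMap.mulRight_apply, Algebra.TensorProduct.tmul_mul_tmul,
    Algebra.TensorProduct.tmul_mul_tmul, one_mul, mul_one, ← TensorProduct.tmul_sub,
    ghostNumberOp_lie_ghostMonomial, TensorProduct.tmul_smul]

end

end FiniteW

namespace FiniteW

noncomputable section

set_option linter.unusedSectionVars false

attribute [local instance] LieRing.ofAssociativeRing

/-! ### The BRST differential -/

variable {g : Type*} [LieRing g] [LieAlgebra ℂ g] {δ : g} {I : Type*} [Fintype I] [DecidableEq I]
  (K : LinearMap.BilinForm ℂ g) (hK : K.Nondegenerate) (hsymm : K.IsSymm)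
  (hinv : ∀ x y z : g, K ⁅x, y⁆ z = K x ⁅y, z⁆) (t : HomogeneousBasis δ I)

section Degrees

lemma currentMap_mem (x : g) : currentMap δ x ∈ omegaDeg δ 0 :=
  tmul_one_mem_omegaDeg _

lemma antighostMap_mem_omegaDeg (x : g) : antighostMap δ K x ∈ omegaDeg δ (-1) :=
  tmul_antighost_mem_omegaDeg _ _

lemma ghostMap_mem_omegaDeg (z : g) : ghostMap t z ∈ omegaDeg δ 1 := by
  obtain ⟨v, hv⟩ := ghostMap_mem t z
  rw [hv]
  exact tmul_ghost_mem_omegaDeg _ _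

lemma charge_mem (i : Sl2Embedding g) : charge i K hK t ∈ omegaDeg δ 1 := by
  refine sub_mem (sum_mem fun α _ => tmul_ghost_mem_omegaDeg _ _)
    (Submodule.smul_mem _ _ (sum_mem fun α _ => sum_mem fun β _ => sum_mem fun γ _ =>
      Submodule.smul_mem _ _ ?_))
  have := tmul_ghostMonomial_mem (1 : UniversalEnvelopingAlgebra ℂ g)
    [Sum.inr ((t.basis.coord γ).comp (gPlus δ).subtype),
      Sum.inl ⟨t.basis α, t.mem_gPlus α.2⟩, Sum.inl ⟨t.basis β, t.mem_gPlus β.2⟩]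
  simpa [ghostMonomial, ghostNumber, mul_assoc, ghostC, antighostB] using this

lemma differential_mem (i : Sl2Embedding g) {k : ℤ} {X : Omega δ} (hX : X ∈ omegaDeg δ k) :
    differential i K hK t X ∈ omegaDeg δ (k + 1) := by
  rw [differential_of_mem i K hK t hX]
  refine sub_mem ?_ (Submodule.smul_mem _ _ (mul_mem_omegaDeg hX (charge_mem K hK t i)))
  rw [add_comm]
  exact mul_mem_omegaDeg (charge_mem K hK t i) hX

lemma differential_apply (i : Sl2Embedding g) (X : Omega δ) :
    differential i K hK t X = charge i K hK t * X - parity δ X * charge i K hK t := rfl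

lemma differential_mul (i : Sl2Embedding g) (X Y : Omega δ) :
    differential i K hK t (X * Y)
      = differential i K hK t X * Y + parity δ X * differential i K hK t Y := by
  simp only [differential_apply, map_mul]
  noncomm_ring

lemma parity_parity (X : Omega δ) : parity δ (parity δ X) = X := by
  induction X using TensorProduct.induction_on with
  | zero => simp
  | add X Y hX hY => rw [map_add, map_add, hX, hY]
  | tmul u y => simp [parity]

lemma parity_charge (i : Sl2Embedding g) :
    parity δ (charge i K hK t) = -charge i K hK t := by
  rw [parity_of_mem (charge_mem K hK t i)]
  simp

/-- `Q` is odd, so the mixed terms cancel. Hence `d² = 0` needs `Q²` only to be central. -/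
lemma differential_differential (i : Sl2Embedding g) (X : Omega δ) :
    differential i K hK t (differential i K hK t X)
      = charge i K hK t * charge i K hK t * X - X * (charge i K hK t * charge i K hK t) := by
  simp only [differential_apply, map_sub, map_mul, parity_parity, parity_charge]
  noncomm_ring

end Degrees

include hK t in
lemma exists_antighostMap_eq (φ : Module.Dual ℂ (gPlus δ)) :
    ∃ x, antighostMap δ K x = (1 : UniversalEnvelopingAlgebra ℂ g) ⊗ₜ[ℂ] antighost φ := by
  refine ⟨∑ α : t.Pos, φ ⟨t.basis α, t.mem_gPlus α.2⟩ • upper K hK t α, ?_⟩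
  have h : ∀ φ : Module.Dual ℂ (gPlus δ), antighost φ
    = (CliffordAlgebra.ι (QuadraticForm.dualProd ℂ (gPlus δ)) ∘ₗ
    LinearMap.inl ℂ (Module.Dual ℂ (gPlus δ)) (gPlus δ)) φ := fun φ => rfl
  conv_rhs => rw [← dual_gPlus_eq_sum t φ]
  rw [h]
  simp only [map_sum, map_smul, TensorProduct.tmul_sum, TensorProduct.tmul_smul,
    antighostMap_upper]
  rfl

lemma ghostMap_gPlus (v : gPlus δ) :
    ghostMap t v = (1 : UniversalEnvelopingAlgebra ℂ g) ⊗ₜ[ℂ] ghost v := by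
  have h : ∀ v : gPlus δ, ghost v = (CliffordAlgebra.ι (QuadraticForm.dualProd ℂ (gPlus δ)) ∘ₗ
    LinearMap.inr ℂ (Module.Dual ℂ (gPlus δ)) (gPlus δ)) v := fun v => rfl
  rw [ghostMap_apply]
  conv_rhs => rw [← repr_sum_gPlus t v, h]
  simp only [map_sum, map_smul, TensorProduct.tmul_sum, TensorProduct.tmul_smul]
  rfl

include hK in
/-- `Ω` is generated by the currents, the antighosts and the ghosts. -/
lemma commute_of_generators {Z : Omega δ} (hJ : ∀ x, Z * currentMap δ x = currentMap δ x * Z)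
    (hb : ∀ x, Z * antighostMap δ K x = antighostMap δ K x * Z)
    (hc : ∀ x, Z * ghostMap t x = ghostMap t x * Z) (X : Omega δ) : Z * X = X * Z := by
  have h1 : ∀ u : UniversalEnvelopingAlgebra ℂ g,
      (u ⊗ₜ[ℂ] (1 : Ghosts δ)) ∈ Subalgebra.centralizer ℂ {Z} := by
    intro u
    have : Algebra.adjoin ℂ (Set.range (UniversalEnvelopingAlgebra.ι ℂ (L := g)))
        ≤ (Subalgebra.centralizer ℂ {Z}).comap
          (Algebra.TensorProduct.includeLeft : _ →ₐ[ℂ] Omega δ) := by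
      refine Algebra.adjoin_le ?_
      rintro _ ⟨x, rfl⟩
      refine (Subalgebra.mem_centralizer_iff ℂ).2 fun Y hY => ?_
      rw [Set.mem_singleton_iff.1 hY]
      exact hJ x
    rw [adjoin_range_universalEnvelopingAlgebra_ι] at this
    exact this (Algebra.mem_top (x := u))
  have h2 : ∀ y : Ghosts δ, ((1 : UniversalEnvelopingAlgebra ℂ g) ⊗ₜ[ℂ] y)
      ∈ Subalgebra.centralizer ℂ {Z} := by
    intro y
    have : Algebra.adjoin ℂ (Set.range (CliffordAlgebra.ι (QuadraticForm.dualProd ℂ (gPlus δ))))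
        ≤ (Subalgebra.centralizer ℂ {Z}).comap
          (Algebra.TensorProduct.includeRight : _ →ₐ[ℂ] Omega δ) := by
      refine Algebra.adjoin_le ?_
      rintro _ ⟨m, rfl⟩
      obtain ⟨x, hx⟩ := exists_antighostMap_eq K hK t m.1
      have hm : (1 : UniversalEnvelopingAlgebra ℂ g) ⊗ₜ[ℂ]
          CliffordAlgebra.ι (QuadraticForm.dualProd ℂ (gPlus δ)) m
          = antighostMap δ K x + ghostMap t m.2 := by
        rw [hx, ghostMap_gPlus, ← TensorProduct.tmul_add, antighost, ghost, ← map_add]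
        simp
      refine (Subalgebra.mem_centralizer_iff ℂ).2 fun Y hY => ?_
      rw [Set.mem_singleton_iff.1 hY]
      change Z * ((1 : UniversalEnvelopingAlgebra ℂ g) ⊗ₜ[ℂ] _)
        = ((1 : UniversalEnvelopingAlgebra ℂ g) ⊗ₜ[ℂ] _) * Z
      rw [hm, mul_add, add_mul, hb, hc]
    rw [CliffordAlgebra.adjoin_range_ι] at this
    exact this (Algebra.mem_top (x := y))
  have h3 : X ∈ Subalgebra.centralizer ℂ {Z} := by
    induction X using TensorProduct.induction_on with
    | zero => exact zero_mem _
    | add X Y hX hY => exact add_mem hX hY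
    | tmul u y => simpa using mul_mem (h1 u) (h2 y)
  exact (Subalgebra.mem_centralizer_iff ℂ).1 h3 Z rfl

include hsymm hinv in
/-- `d² = 0`. -/
lemma differential_sq (i : Sl2Embedding g) (hi : i.tplus ∈ degSub δ 1) (X : Omega δ) :
    differential i K hK t (differential i K hK t X) = 0 := by
  have H := ghostSystem K hK hsymm hinv t i hi
  rw [differential_differential, sub_eq_zero, charge_eq_ghostCharge K hK hsymm hinv t i hi]
  exact commute_of_generators K hK t H.charge_sq_commute_J H.charge_sq_commute_b
    H.charge_sq_commute_c X

section Parity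

lemma parity_antighostMap (x : g) : parity δ (antighostMap δ K x) = -antighostMap δ K x := by
  rw [parity_of_mem (antighostMap_mem_omegaDeg K x)]; simp

lemma parity_ghostMap (x : g) : parity δ (ghostMap t x) = -ghostMap t x := by
  rw [parity_of_mem (ghostMap_mem_omegaDeg t x)]; simp

end Parity

end

end FiniteW

namespace FiniteW

noncomputable section

set_option linter.unusedSectionVars false

attribute [local instance] LieRing.ofAssociativeRing

/-! ### The BRST complex is a quantized Koszul complex -/

variable {g : Type*} [LieRing g] [LieAlgebra ℂ g] {δ : g}

/-- Normal ordering preserves ghost number, since a nonzero contraction pairs letters of opposite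
degree. -/
lemma omegaQuant_wordProd_mem_omegaDeg {O : Type*}
    {w : O → Module.Dual ℂ (gPlus δ) × gPlus δ} {dg : O → ℤ}
    (hw : ∀ o, (1 : UniversalEnvelopingAlgebra ℂ g) ⊗ₜ[ℂ]
      CliffordAlgebra.ι (QuadraticForm.dualProd ℂ (gPlus δ)) (w o) ∈ omegaDeg δ (dg o))
    (hdg : ∀ o o', ghostForm δ (w o) (w o') ≠ 0 → dg o + dg o' = 0) (n : ℕ) :
    ∀ l : List O, l.length ≤ n →
      omegaQuant δ (wordProd (fun o => ExteriorAlgebra.ι ℂ (w o)) l)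
        ∈ omegaDeg δ (l.map dg).sum := by
  induction n with
  | zero =>
    intro l hl
    rw [List.eq_nil_of_length_eq_zero (Nat.le_zero.1 hl), wordProd_nil, omegaQuant_one]
    exact one_mem_omegaDeg
  | succ n ih =>
    intro l hl
    rcases l with _ | ⟨o, l⟩
    · exact ih [] (Nat.zero_le _)
    · have hl' : l.length ≤ n := by simpa using hl
      have h1 := mul_mem_omegaDeg (hw o) (ih l hl')
      have h2 := mul_omegaQuant (w o) (wordProd (fun o => ExteriorAlgebra.ι ℂ (w o)) l)
      have h3 : omegaQuant δ (CliffordAlgebra.contractLeft (Q := (0 : QuadraticForm ℂ _))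
          (ghostForm δ (w o)) (wordProd (fun o => ExteriorAlgebra.ι ℂ (w o)) l))
          ∈ omegaDeg δ (dg o + (l.map dg).sum) := by
        have h := Submodule.mem_map_of_mem (f := omegaQuant δ)
          (contractLeft_wordProd_mem w (ghostForm δ (w o)) l)
        rw [Submodule.map_span] at h
        refine Submodule.span_le.2 ?_ h
        rintro _ ⟨_, ⟨o', l', ho, hp, rfl⟩, rfl⟩
        have h4 := hp.length_eq
        have h5 := (hp.map dg).sum_eq
        simp only [List.length_cons, List.map_cons, List.sum_cons] at h4 h5
        have h6 := hdg o o' ho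
        rw [h5, ← add_assoc, h6, zero_add]
        exact ih l' (by omega)
      rw [wordProd_cons, List.map_cons, List.sum_cons]
      rw [← h2] at h3
      have := sub_mem h1 h3
      rwa [sub_sub_cancel] at this

variable {I : Type*} [Fintype I] [DecidableEq I]

/-- The odd letters as vectors. -/
def oddVec (t : HomogeneousBasis δ I) : t.Pos ⊕ t.Pos → Module.Dual ℂ (gPlus δ) × gPlus δ :=
  Sum.elim (fun α => ((t.basis.coord α).comp (gPlus δ).subtype, 0))
    (fun α => (0, ⟨t.basis α, t.mem_gPlus α.2⟩))

/-- The coordinates of the odd letters. -/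
def oddDual (t : HomogeneousBasis δ I) :
    t.Pos ⊕ t.Pos → Module.Dual ℂ (Module.Dual ℂ (gPlus δ) × gPlus δ) :=
  Sum.elim (fun α => (Module.Dual.eval ℂ _ ⟨t.basis α, t.mem_gPlus α.2⟩) ∘ₗ LinearMap.fst ℂ _ _)
    (fun α => ((t.basis.coord α).comp (gPlus δ).subtype) ∘ₗ LinearMap.snd ℂ _ _)

lemma coord_basis_pos (t : HomogeneousBasis δ I) (α β : t.Pos) :
    t.basis.coord α (t.basis β) = if α = β then 1 else 0 := by
  rw [Module.Basis.coord_apply, Module.Basis.repr_self, Finsupp.single_apply]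
  simp [Subtype.ext_iff, eq_comm]

lemma oddDual_oddVec (t : HomogeneousBasis δ I) (o o' : t.Pos ⊕ t.Pos) :
    oddDual t o (oddVec t o') = if o = o' then 1 else 0 := by
  rcases o with α | α <;> rcases o' with β | β
  · have := coord_basis_pos t β α
    simp only [oddDual, oddVec, Sum.elim_inl, LinearMap.comp_apply, LinearMap.fst_apply,
      Module.Dual.eval_apply, Submodule.subtype_apply, Sum.inl.injEq]
    rw [this]
    simp [eq_comm]
  · simp [oddDual, oddVec]
  · simp [oddDual, oddVec]
  · have := coord_basis_pos t α β
    simp only [oddDual, oddVec, Sum.elim_inr, LinearMap.comp_apply, LinearMap.snd_apply,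
      Submodule.subtype_apply, Sum.inr.injEq]
    rw [this]

lemma span_range_oddVec (t : HomogeneousBasis δ I) :
    Submodule.span ℂ (Set.range (oddVec t)) = ⊤ := by
  refine top_le_iff.1 fun x _ => ?_
  have h : x = ∑ α : t.Pos, x.1 ⟨t.basis α, t.mem_gPlus α.2⟩ • oddVec t (Sum.inl α)
      + ∑ α : t.Pos, t.basis.repr x.2 α • oddVec t (Sum.inr α) := by
    refine Prod.ext ?_ ?_
    · conv_lhs => rw [← dual_gPlus_eq_sum t x.1]
      simp [oddVec, Prod.fst_sum]
    · conv_lhs => rw [← repr_sum_gPlus t x.2]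
      simp [oddVec, Prod.snd_sum]
  rw [h]
  exact add_mem (sum_mem fun α _ => Submodule.smul_mem _ _ (Submodule.subset_span ⟨_, rfl⟩))
    (sum_mem fun α _ => Submodule.smul_mem _ _ (Submodule.subset_span ⟨_, rfl⟩))

lemma oddVec_mem_omegaDeg {H : Type*} (t : HomogeneousBasis δ I) (o : t.Pos ⊕ t.Pos) :
    (1 : UniversalEnvelopingAlgebra ℂ g) ⊗ₜ[ℂ]
      CliffordAlgebra.ι (QuadraticForm.dualProd ℂ (gPlus δ)) (oddVec t o)
      ∈ omegaDeg δ (letterDeg (H := H) (Sum.inr o)) := by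
  rcases o with α | α
  · exact tmul_antighost_mem_omegaDeg _ _
  · exact tmul_ghost_mem_omegaDeg _ _

lemma omegaQuant_oddVec_mem {H : Type*} (t : HomogeneousBasis δ I) (l : List (t.Pos ⊕ t.Pos)) :
    omegaQuant δ (wordProd (extGen (oddVec t)) l)
      ∈ omegaDeg δ (wordDeg (H := H) (l.map Sum.inr)) := by
  have h := omegaQuant_wordProd_mem_omegaDeg (oddVec_mem_omegaDeg (H := H) t) ?_ l.length l le_rfl
  · rw [wordDeg, List.map_map]
    exact h
  · rintro (α | α) (β | β) h
    · simp [ghostForm_apply, oddVec] at h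
    · simp [letterDeg]
    · simp [ghostForm_apply, oddVec] at h
    · simp [ghostForm_apply, oddVec] at h

/-! ### Quantization with the uncorrected currents. -/

section Uncorrected

variable {E O : Type*} [Fintype E] [DecidableEq E] (tb : Module.Basis E ℂ g)
  (w : O → Module.Dual ℂ (gPlus δ) × gPlus δ)

/-- The uncorrected currents and the odd generators. -/
def currentGen : E ⊕ O → Omega δ :=
  Sum.elim (fun a => currentMap δ (tb a)) (fun o => (1 : UniversalEnvelopingAlgebra ℂ g) ⊗ₜ[ℂ]
    CliffordAlgebra.ι (QuadraticForm.dualProd ℂ (gPlus δ)) (w o))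

/-- Auxiliary weights, for which the corrections to the currents have lower weight. -/
def currentWt : E ⊕ O → ℕ := Sum.elim (fun _ => 3) (fun _ => 1)

lemma currentGen_isAlmostCommutative : IsAlmostCommutative (currentGen tb w)
    (fun o => ExteriorAlgebra.ι ℂ (w o)) (omegaQuant δ) currentWt where
  q_one := omegaQuant_one
  even_even a b := by
    have h : currentGen tb w (Sum.inl a) * currentGen tb w (Sum.inl b)
        - currentGen tb w (Sum.inl b) * currentGen tb w (Sum.inl a)
        = currentMap δ ⁅tb a, tb b⁆ := by
      simp only [currentGen, Sum.elim_inl, currentMap_apply, Algebra.TensorProduct.tmul_mul_tmul,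
        LieHom.map_lie, LieRing.of_associative_ring_bracket, TensorProduct.sub_tmul, mul_one]
    rw [h]
    exact map_mem_of_basis tb (currentMap δ) _ (fun c => gen_mem_wordFil
      (gen := currentGen tb w) (a := Sum.inl c) (by simp [currentWt])) _
  odd_even o a := by
    have h : currentGen tb w (Sum.inr o) * currentGen tb w (Sum.inl a)
        - currentGen tb w (Sum.inl a) * currentGen tb w (Sum.inr o) = 0 := by
      simp only [currentGen, Sum.elim_inl, Sum.elim_inr, currentMap_apply,
        Algebra.TensorProduct.tmul_mul_tmul, one_mul, mul_one, sub_self]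
    rw [h]
    exact zero_mem _
  odd_q o l := omegaQuant_odd_mem (fun _ => rfl) (fun _ => Nat.one_pos) o l

/-- Uncorrected currents commute with the ghosts, so quantization is the tensor product of the
Poincaré–Birkhoff–Witt map with normal ordering. -/
lemma quantize_currentGen_bijective {n : Type*} [Fintype n] [DecidableEq n]
    (ρ : g →ₗ⁅ℂ⁆ Matrix n n ℂ) (hρ : Function.Injective ρ) :
    Function.Bijective (quantize (currentGen tb w) (omegaQuant δ)) := by
  let M := LinearEquiv.ofBijective _ (monomialProd_bijective tb ρ hρ)
  have h : quantize (currentGen tb w) (omegaQuant δ)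
      = (TensorProduct.congr M (ghostQuant δ)).toLinearMap := by
    refine TensorProduct.ext' fun p ω => ?_
    have h1 : monomialProd (currentGen tb w ∘ Sum.inl) p
        = (monomialProd fun a => UniversalEnvelopingAlgebra.ι ℂ (tb a)) p ⊗ₜ[ℂ] (1 : Ghosts δ) :=
      monomialProd_map (Algebra.TensorProduct.includeLeft :
        UniversalEnvelopingAlgebra ℂ g →ₐ[ℂ] Omega δ) _ p
    rw [quantize_tmul, h1, omegaQuant_apply, Algebra.TensorProduct.tmul_mul_tmul, one_mul, mul_one]
    rfl
  rw [h]
  exact (TensorProduct.congr M (ghostQuant δ)).bijective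

end Uncorrected

end

end FiniteW

namespace FiniteW

noncomputable section

set_option linter.unusedSectionVars false

attribute [local instance] LieRing.ofAssociativeRing

/-! ### The BRST complex as a model of the Koszul complex. -/

section Model

variable {g : Type*} [LieRing g] [LieAlgebra ℂ g] {δ : g} {I : Type*} [Fintype I] [DecidableEq I]
  (K : LinearMap.BilinForm ℂ g) (hK : K.Nondegenerate) (hsymm : K.IsSymm)
  (hinv : ∀ x y z : g, K ⁅x, y⁆ z = K x ⁅y, z⁆) (t : HomogeneousBasis δ I)
  (i : Sl2Embedding g) {H : Type*} [Fintype H] [DecidableEq H]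
  (tb : HomogeneousBasis δ (t.Pos ⊕ t.Pos ⊕ H))

/-- The generators of `Ω` adapted to the leading part of the differential. -/
def brstGen : Letter t.Pos H → Omega δ :=
  ghostGen (fun α : t.Pos => upper K hK t α) (fun α : t.Pos => t.basis α)
    (currentMap δ) (antighostMap δ K) (ghostMap t) tb
    (Sum.elim (fun α => K i.tplus (upper K hK t α)) 0)

/-- The weights of the generators of `Ω`. -/
abbrev brstWt : Letter t.Pos H → ℕ := ghostWt tb fun α : t.Pos => t.deg α

lemma brstGen_inr (o : t.Pos ⊕ t.Pos) :
    brstGen K hK t i tb (Sum.inr o) = (1 : UniversalEnvelopingAlgebra ℂ g) ⊗ₜ[ℂ]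
      CliffordAlgebra.ι (QuadraticForm.dualProd ℂ (gPlus δ)) (oddVec t o) := by
  rcases o with α | α
  · exact antighostMap_upper K hK t α
  · exact ghostMap_basis t α

lemma brstWt_pos (v : Letter t.Pos H) : 0 < brstWt t tb v := by
  rcases v with a | α | α
  · exact Nat.succ_pos _
  · exact Nat.one_pos
  · have := α.2
    simp only [brstWt, ghostWt, Sum.elim_inr]
    omega

lemma brstGen_mem (v : Letter t.Pos H) : brstGen K hK t i tb v ∈ omegaDeg δ (letterDeg v) := by
  rcases v with a | o
  · rw [brstGen, ghostGen, Sum.elim_inl, ghostCurrent_apply,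
      show letterDeg (Sum.inl a : Letter t.Pos H) = 0 from rfl]
    refine sub_mem (add_mem (currentMap_mem _) (sum_mem fun β _ => ?_)) ?_
    · have h := mul_mem_omegaDeg (antighostMap_mem_omegaDeg K ⁅tb.basis a, upper K hK t β⁆)
        (ghostMap_mem_omegaDeg t (t.basis β))
      rwa [neg_add_cancel] at h
    · rw [Algebra.algebraMap_eq_smul_one]
      exact Submodule.smul_mem _ _ one_mem_omegaDeg
  · rw [brstGen_inr]
    exact oddVec_mem_omegaDeg t o

lemma parity_brstGen (v : Letter t.Pos H) :
    parity δ (brstGen K hK t i tb v) = letterSign v • brstGen K hK t i tb v := by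
  rw [parity_of_mem (brstGen_mem K hK t i tb v)]
  rcases v with a | α | α <;> simp [letterDeg, letterSign]

include hsymm hinv in
lemma brstGen_isAlmostCommutative (hi : i.tplus ∈ degSub δ 1) :
    IsAlmostCommutative (brstGen K hK t i tb) (extGen (oddVec t)) (omegaQuant δ)
      (brstWt t tb) := by
  have Hs := ghostSystem K hK hsymm hinv t i hi
  have hm : ∀ α : t.Pos, 0 < t.deg α := fun α => α.2
  have hu : ∀ α : t.Pos, upper K hK t α ∈ degSub δ (-t.deg α) :=
    fun α => upper_mem K hK hinv t α
  have hv : ∀ α : t.Pos, t.basis α ∈ degSub δ (t.deg α) := fun α => t.basis_mem α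
  have hp : ∀ k < 0, ∀ x ∈ degSub δ k, negProj K hK t x = x :=
    fun k hk x hx => negProj_of_neg K hK hinv t hk hx
  exact
    { q_one := omegaQuant_one
      even_even := fun a b => Hs.ghostGen_even_even tb _ hm hu hv hp a b
      odd_even := fun o a => Hs.ghostGen_odd_even tb _ hm hu hv o a
      odd_q := fun o l => omegaQuant_odd_mem (brstGen_inr K hK t i tb)
        (fun o => brstWt_pos t tb _) o l }

include hK in
lemma antighostMap_mem_currentGen (x : g) :
    antighostMap δ K x ∈ wordFil (currentGen tb.basis (oddVec t)) currentWt 2 := by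
  have h : ∀ x : g, antighostMap δ K x
      = antighostMap δ K (negProj K hK t x) := by
    intro x
    rw [antighostMap_apply, antighostMap_apply]
    congr 2
    ext v
    exact (form_negProj_gPlus K hK t x v.2).symm
  rw [h, negProj, lowerProj_apply, map_sum]
  refine sum_mem fun α _ => ?_
  rw [map_smul, antighostMap_upper]
  exact Submodule.smul_mem _ _ (gen_mem_wordFil (gen := currentGen tb.basis (oddVec t))
    (a := Sum.inr (Sum.inl α)) (by simp [currentWt]))

/-- With the auxiliary weights `3` and `1`, the ghost bilinear and the scalar that distinguish the
two sets of currents have weight at most `2`, so this is a lower order perturbation of the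
uncorrected quantization. -/
lemma quantize_brstGen_bijective {n : Type*} [Fintype n] [DecidableEq n]
    (ρ : g →ₗ⁅ℂ⁆ Matrix n n ℂ) (hρ : Function.Injective ρ) :
    Function.Bijective (quantize (brstGen K hK t i tb) (omegaQuant δ)) := by
  refine (currentGen_isAlmostCommutative tb.basis (oddVec t)).quantize_bijective
    (fun a => ?_) (quantize_currentGen_bijective tb.basis (oddVec t) ρ hρ)
    (exists_mem_symbolFil (span_range_oddVec t) currentWt)
  have h : brstGen K hK t i tb (Sum.inl a) - currentGen tb.basis (oddVec t) (Sum.inl a)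
      = ∑ β : t.Pos, antighostMap δ K ⁅tb.basis a, upper K hK t β⁆ * ghostMap t (t.basis β)
        - algebraMap ℂ _ ((Sum.elim (fun α : t.Pos => K i.tplus (upper K hK t α)) 0 :
            t.Pos ⊕ t.Pos ⊕ H → ℂ) a) := by
    rw [brstGen, ghostGen, Sum.elim_inl, ghostCurrent_apply, currentGen, Sum.elim_inl]
    abel
  rw [h]
  refine sub_mem (sum_mem fun β _ => ?_) (algebraMap_mem_wordFil _ (Nat.succ_pos _))
  refine mul_mem_wordFil (m := 2) (n := 2) le_rfl (antighostMap_mem_currentGen K hK t tb _) ?_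
  rw [ghostMap_basis]
  exact gen_mem_wordFil (gen := currentGen tb.basis (oddVec t)) (a := Sum.inr (Sum.inr β))
    (by simp [currentWt])

variable (hz : ∀ α, tb.basis (Sum.inl α) = upper K hK t α ∧ tb.deg (Sum.inl α) = -t.deg α)
  (hy : ∀ α, ⁅tb.basis (Sum.inr (Sum.inl α)), i.tplus⁆ = t.basis α ∧
    tb.deg (Sum.inr (Sum.inl α)) = t.deg α - 1)
  (hη : ∀ η, ⁅tb.basis (Sum.inr (Sum.inr η)), i.tplus⁆ = 0)

include hsymm hinv hz hy hη in
-- The leading term for a current is `c([y, e])`: it vanishes for `z`, where `χ` is a character, and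
-- for `η`, which centralizes `e`, and equals `c_α` for `y α`.
lemma differential_brstGen (hi : i.tplus ∈ degSub δ 1) (v : Letter t.Pos H) :
    differential i K hK t (brstGen K hK t i tb v) - optGen (brstGen K hK t i tb) (letterD v)
      ∈ wordFil (brstGen K hK t i tb) (brstWt t tb) (brstWt t tb v) := by
  have Hs := ghostSystem K hK hsymm hinv t i hi
  have hm : ∀ α : t.Pos, 0 < t.deg α := fun α => α.2
  have hu : ∀ α : t.Pos, upper K hK t α ∈ degSub δ (-t.deg α) :=
    fun α => upper_mem K hK hinv t α
  have hv : ∀ α : t.Pos, t.basis α ∈ degSub δ (t.deg α) := fun α => t.basis_mem α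
  have hp : ∀ k < 0, ∀ x ∈ degSub δ k, negProj K hK t x = x :=
    fun k hk x hx => negProj_of_neg K hK hinv t hk hx
  have hcur : ∀ a, differential i K hK t (brstGen K hK t i tb (Sum.inl a))
      - ghostMap t ⁅tb.basis a, i.tplus⁆
      ∈ wordFil (brstGen K hK t i tb) (brstWt t tb) (brstWt t tb (Sum.inl a)) := by
    intro a
    have h := Hs.charge_lie_ghostCurrent_sub_mem tb
      (Sum.elim (fun α => K i.tplus (upper K hK t α)) 0) hm hu hv hp (tb.basis_mem a)
    refine (congrArg (· ∈ wordFil (brstGen K hK t i tb) (brstWt t tb)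
      (brstWt t tb (Sum.inl a))) ?_).mpr h
    rw [differential_apply, parity_brstGen, letterSign, Sum.elim_inl, Pi.one_apply, one_smul,
      charge_eq_ghostCharge K hK hsymm hinv t i hi, brstGen, ghostGen, Sum.elim_inl, mul_sub,
      sub_mul, Algebra.commutes]
    abel
  rcases v with (α | α | η) | (α | α)
  · have h := hcur (Sum.inl α)
    rw [(hz α).1, ← hp _ (neg_lt_zero.2 α.2) _ (hu α), Hs.c_lie_lowerProj] at h
    exact h
  · have h := hcur (Sum.inr (Sum.inl α))
    rw [(hy α).1] at h
    exact h
  · have h := hcur (Sum.inr (Sum.inr η))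
    rw [hη, map_zero] at h
    exact h
  · have h : differential i K hK t (brstGen K hK t i tb (Sum.inr (Sum.inl α)))
        = brstGen K hK t i tb (Sum.inl (Sum.inl α)) := by
      have h1 := Hs.charge_mul_b (upper K hK t α)
      rw [hp _ (neg_lt_zero.2 α.2) _ (hu α)] at h1
      have h2 : brstGen K hK t i tb (Sum.inr (Sum.inl α)) = antighostMap δ K (upper K hK t α) :=
        rfl
      rw [differential_apply, h2, parity_antighostMap, neg_mul, sub_neg_eq_add,
        charge_eq_ghostCharge K hK hsymm hinv t i hi, h1, brstGen, ghostGen, Sum.elim_inl,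
        Sum.elim_inl, (hz α).1]
    rw [h]
    simp only [letterD, optGen, Option.elim_some, sub_self]
    exact zero_mem _
  · have h := Hs.charge_mul_c_mem tb
      (Sum.elim (fun α => K i.tplus (upper K hK t α)) 0) hm hu hv α
    have h2 : brstGen K hK t i tb (Sum.inr (Sum.inr α)) = ghostMap t (t.basis α) := rfl
    rw [differential_apply, h2, parity_ghostMap, neg_mul, sub_neg_eq_add,
      charge_eq_ghostCharge K hK hsymm hinv t i hi]
    simp only [letterD, optGen, Option.elim_none, sub_zero]
    exact h

include hsymm hinv hz hy hη in
/-- The BRST complex is a quantized Koszul complex. -/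
theorem koszulModel [FiniteDimensional ℂ g] [LieAlgebra.IsSimple ℂ g]
    (hi : i.tplus ∈ degSub δ 1) :
    KoszulModel (brstGen K hK t i tb) (omegaQuant δ) (oddVec t) (oddDual t) (brstWt t tb)
      (differential i K hK t) (omegaDeg δ) where
  almostComm := brstGen_isAlmostCommutative K hK hsymm hinv t i tb hi
  bijective :=
    let ⟨ρ, hρ⟩ := exists_faithful_matrix_rep g
    quantize_brstGen_bijective K hK t i tb ρ hρ
  span_eq := span_range_oddVec t
  dual := oddDual_oddVec t
  D_one := by rw [differential_apply, map_one, one_mul, mul_one, sub_self]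
  D_mul v X := by rw [differential_mul, parity_brstGen, smul_mul_assoc]
  D_gen := differential_brstGen K hK hsymm hinv t i tb hz hy hη hi
  -- For `y ↦ c` the weights match because `2 (deg α - 1) + 1 = 2 deg α - 1`. For `b ↦ z` both are
  -- `1`, the degree of `z` being negative.
  wt_D := by
    rintro ((α | α | η) | (α | α)) u hu <;> simp only [letterD, Option.mem_def, Option.some.injEq,
      reduceCtorEq] at hu
    · have := α.2
      have := (hy α).2
      rw [← hu]
      simp only [brstWt, ghostWt, Sum.elim_inr, Sum.elim_inl]
      omega
    · have := α.2
      have := (hz α).2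
      rw [← hu]
      simp only [brstWt, ghostWt, Sum.elim_inr, Sum.elim_inl]
      omega
  num_le v := by
    refine le_trans ?_ (brstWt_pos t tb v)
    rcases v with (α | α | η) | (α | α) <;> simp [letterNum]
  internal := isInternal_omegaDeg t
  gen_mul_mem v _ _ hX := mul_mem_omegaDeg (brstGen_mem K hK t i tb v) hX
  q_mem l := omegaQuant_oddVec_mem t l
  D_mem hX := differential_mem K hK t i hX
  D_sq := differential_sq K hK hsymm hinv t i hi

end Model

end

end FiniteW

namespace FiniteW

noncomputable section

attribute [local instance] LieRing.ofAssociativeRing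

/-! ### The cohomology -/

section Cohomology

variable {g : Type*} [LieRing g] [LieAlgebra ℂ g] {δ : g} {I : Type*} [Fintype I] [DecidableEq I]
  {K : LinearMap.BilinForm ℂ g} {hK : K.Nondegenerate} {t : HomogeneousBasis δ I}
  {i : Sl2Embedding g}

lemma subsingleton_cohomology {k : ℤ}
    (h : ∀ x ∈ omegaDeg δ k, differential i K hK t x = 0 →
      ∃ y ∈ omegaDeg δ (k - 1), x = differential i K hK t y) :
    Subsingleton (Cohomology i K hK t k) := by
  rw [Submodule.Quotient.subsingleton_iff, Submodule.submoduleOf_eq_top]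
  rintro x ⟨hx, hdx⟩
  obtain ⟨y, hy, rfl⟩ := h x hx hdx
  exact ⟨y, hy, rfl⟩

/-- A complete independent family of cocycles gives the cohomology. -/
lemma nonempty_cohomology_equiv {V : Type*} [AddCommGroup V] [Module ℂ V]
    (ψ : V →ₗ[ℂ] Omega δ)
    (h1 : ∀ c, ψ c ∈ omegaDeg δ 0 ∧ differential i K hK t (ψ c) = 0)
    (h2 : ∀ c, ∀ y ∈ omegaDeg δ (-1), ψ c = differential i K hK t y → c = 0)
    (h3 : ∀ x ∈ omegaDeg δ 0, differential i K hK t x = 0 →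
      ∃ c, ∃ y ∈ omegaDeg δ (-1), x = ψ c + differential i K hK t y) :
    Nonempty (Cohomology i K hK t 0 ≃ₗ[ℂ] V) := by
  let Ψ : V →ₗ[ℂ] Cohomology i K hK t 0 :=
    Submodule.mkQ _ ∘ₗ ψ.codRestrict (cocycles i K hK t 0) fun c => ⟨(h1 c).1, (h1 c).2⟩
  refine ⟨(LinearEquiv.ofBijective Ψ ⟨?_, ?_⟩).symm⟩
  · rw [← LinearMap.ker_eq_bot, LinearMap.ker_eq_bot']
    intro c hc
    obtain ⟨y, hy, hyc⟩ := (Submodule.Quotient.mk_eq_zero _).1 hc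
    exact h2 c y hy hyc.symm
  · intro X
    obtain ⟨⟨x, hx, hdx⟩, rfl⟩ := Submodule.Quotient.mk_surjective _ X
    obtain ⟨c, y, hy, rfl⟩ := h3 x hx hdx
    refine ⟨c, (Submodule.Quotient.eq _).2 ⟨-y, neg_mem hy, ?_⟩⟩
    rw [map_neg]
    change -differential i K hK t y = ψ c - (ψ c + differential i K hK t y)
    abel

end Cohomology

/-- The Poincaré-Birkhoff-Witt theorem for subalgebras of simple Lie algebras. -/
lemma nonempty_mvPolynomial_equiv {g : Type*} [LieRing g] [LieAlgebra ℂ g]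
    [FiniteDimensional ℂ g] [LieAlgebra.IsSimple ℂ g] (L : LieSubalgebra ℂ g) {E : Type*}
    (b : Module.Basis E ℂ L) :
    Nonempty (MvPolynomial E ℂ ≃ₗ[ℂ] UniversalEnvelopingAlgebra ℂ L) := by
  obtain ⟨ρ, hρ⟩ := exists_faithful_matrix_rep g
  exact ⟨LinearEquiv.ofBijective _ (monomialProd_bijective b (ρ.comp L.incl)
    (hρ.comp Subtype.val_injective))⟩

end

end FiniteW

/-! ### The main theorem. -/

theorem mainTheorem1 {g : Type*} [LieRing g] [LieAlgebra ℂ g] [FiniteDimensional ℂ g]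
    [LieAlgebra.IsSimple ℂ g] (i : FiniteW.Sl2Embedding g)
    (δ : g) (hδ : FiniteW.IsGradingElement i δ)
    (K : LinearMap.BilinForm ℂ g) (hK : K.Nondegenerate) (hK_symm : K.IsSymm)
    (hK_inv : ∀ x y z : g, K ⁅x, y⁆ z = K x ⁅y, z⁆)
    {I : Type*} [Fintype I] [DecidableEq I] (t : FiniteW.HomogeneousBasis δ I) :
    DirectSum.IsInternal (FiniteW.omegaDeg δ) ∧
    (∀ k : ℤ, (FiniteW.omegaDeg δ k).map (FiniteW.differential i K hK t)
      ≤ FiniteW.omegaDeg δ (k + 1)) ∧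
    FiniteW.differential i K hK t ∘ₗ FiniteW.differential i K hK t = 0 ∧
    (∀ k : ℤ, k ≠ 0 → Subsingleton (FiniteW.Cohomology i K hK t k)) ∧
    Nonempty (FiniteW.Cohomology i K hK t 0 ≃ₗ[ℂ]
      UniversalEnvelopingAlgebra ℂ (FiniteW.gLowestWeight i)) ∧
    Nonempty (FiniteW.Cohomology i K hK t 0 ≃ₗ[ℂ]
      SymmetricAlgebra ℂ (FiniteW.gLowestWeight i)) := by
  have hgood := hδ.isGoodGrading
  obtain ⟨tb, hz, hy, hη⟩ := FiniteW.exists_adapted_basis K hK hK_symm hK_inv t hgood.plus_mem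
    hgood.plus_injective
  have M := FiniteW.koszulModel K hK hK_symm hK_inv t i tb hz hy (fun η => (hη η).1) hgood.plus_mem
  have L := M.triangularLaplacian
  -- The variables `η` are indexed by a basis of `ker (ad t₊)`, whereas the statement involves `ker
  -- (ad t₋)`; only the equality of dimensions is needed.
  have hdim := FiniteW.finrank_ker_eq K hK hK_symm hK_inv t hgood.plus_mem hgood.minus_mem
    hgood.plus_injective hgood.minus_injective
  refine ⟨FiniteW.isInternal_omegaDeg t, fun k => Submodule.map_le_iff_le_comap.2 fun X hX =>
    FiniteW.differential_mem K hK t i hX, LinearMap.ext fun X =>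
    FiniteW.differential_sq K hK hK_symm hK_inv t i hgood.plus_mem X, fun k hk =>
    FiniteW.subsingleton_cohomology fun x hx hdx => L.exists_eq_of_ne_zero hk hx hdx, ?_⟩
  obtain ⟨ψ, h1, h2, h3⟩ := L.exists_cocycles
  obtain ⟨e1⟩ := FiniteW.nonempty_cohomology_equiv ψ h1 h2 h3
  let b : Module.Basis (Fin (Module.finrank ℂ (LinearMap.ker
      (LieAlgebra.ad ℂ g i.tplus : g →ₗ[ℂ] g)))) ℂ (FiniteW.gLowestWeight i) :=
    Module.finBasisOfFinrankEq ℂ (FiniteW.gLowestWeight i) hdim.symm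
  let e2 := (MvPolynomial.basisMonomials (Fin (Module.finrank ℂ (LinearMap.ker
      (LieAlgebra.ad ℂ g i.tplus : g →ₗ[ℂ] g)))) ℂ).repr
  obtain ⟨e3⟩ := FiniteW.nonempty_mvPolynomial_equiv (FiniteW.gLowestWeight i) b
  exact ⟨⟨(e1.trans e2.symm).trans e3⟩, ⟨(e1.trans e2.symm).trans
    (SymmetricAlgebra.equivMvPolynomial b).symm.toLinearEquiv⟩⟩
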